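/- Let $V$ be a complex vector space of dimension $2n$, $n\ge 1$, with a nondegenerate quadratic form $q$, and let $V=E\oplus F$ be a splitting into two totally isotropic subspaces. Let the group $\mathrm{Spin}(V)$, contained in the Clifford algebra of $V$, act on the space of spinors $\wedge E$, a vector $v=v'+v''$ $(v'\in E,\ v''\in F)$ acting by exterior product with $v'$ plus contraction with $2q(v'',\cdot)$. Let the spinor variety $S_+$ be the $\mathrm{Spin}(V)$-orbit of the line $\wedge^{n}E$ in the projective space of spinors (it parametrizes one of the two families of maximal isotropic subspaces of $V$, a point of $S_+$ corresponding to the subspace of the vectors of $V$ that annihilate it). Products $S_+^k$ carry their Zariski topology as projective varieties. Then: 1. $\mathrm{Spin}(V)$ acts generically $3$-transitively on $S_+$: it has a Zariski open and dense orbit in $S_+\times S_+\times S_+$. 2. Suppose $n=2m$ is even, and let $(H_1,H_2,H_3)$ be the maximal isotropic subspaces corresponding to any triple in this open orbit. Then the stabilizer of the triple is a copy of the symplectic group $Sp_n=Sp_{2m}(\mathbb C)$ in $SO(V)$. More precisely, there is a basis of $H_1$ such that sending a transformation to the matrix of its restriction to $H_1$ in this basis defines an isomorphism from the stabilizer of $(H_1,H_2,H_3)$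 in $SO(V)$ onto $Sp_{2m}(\mathbb C)$, and, through the action of $\mathrm{Spin}(V)$ on $V$ by conjugation in the Clifford algebra, a surjective homomorphism with kernel $\{\pm 1\}$ from the stabilizer of the triple in $\mathrm{Spin}(V)$ onto $Sp_{2m}(\mathbb C)$. 3. If $n\ne 1,3$, the action is not generically $4$-transitive: $\mathrm{Spin}(V)$ has no Zariski open orbit in $S_+\times S_+\times S_+\times S_+$. -/

import Mathlib

open scoped LinearAlgebra.Projectivization Topology Pointwise

noncomputable section

/-! ### The Zariski topology on a product of projective spaces -/

/-- Polynomial functions on the vector space `W ^ k`: the algebra of complex-valued functions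
generated by the linear forms. -/
def polyFunctionsPow (k : ℕ) (W : Type*) [AddCommGroup W] [Module ℂ W] :
    Subalgebra ℂ ((Fin k → W) → ℂ) :=
  Algebra.adjoin ℂ (Set.range fun φ : Module.Dual ℂ (Fin k → W) => fun w => φ w)

/-- Multihomogeneous functions on `W ^ k`: homogeneous in each of the `k` variables, of some
multidegree `d`. -/
def IsMultihomogeneous {k : ℕ} {W : Type*} [AddCommGroup W] [Module ℂ W]
    (p : (Fin k → W) → ℂ) : Prop :=
  ∃ d : Fin k → ℕ, ∀ (c : Fin k → ℂ) (w : Fin k → W),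
    p (fun i => c i • w i) = (∏ i, c i ^ d i) * p w

/-- The closed algebraic subset of `ℙ(W) ^ k` defined by a set `I` of functions on `W ^ k`
(meant for multihomogeneous ones, whose vanishing does not depend on the representatives). -/
def multiprojectiveZeroLocus {k : ℕ} {W : Type*} [AddCommGroup W] [Module ℂ W]
    (I : Set ((Fin k → W) → ℂ)) : Set (Fin k → ℙ ℂ W) :=
  {x | ∀ p ∈ I, p (fun i => (x i).rep) = 0}

/-- `Z ⊆ ℙ(W) ^ k` is Zariski closed if it is the common zero locus of a set of multihomogeneous
polynomial functions on `W ^ k`. -/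
def IsMultiprojectiveClosed {k : ℕ} {W : Type*} [AddCommGroup W] [Module ℂ W]
    (Z : Set (Fin k → ℙ ℂ W)) : Prop :=
  ∃ I : Set ((Fin k → W) → ℂ),
    (∀ p ∈ I, p ∈ polyFunctionsPow k W ∧ IsMultihomogeneous p) ∧
      Z = multiprojectiveZeroLocus I

/-- The Zariski topology on the variety `ℙ(W) × ⋯ × ℙ(W)` (`k` factors); for `k ≥ 2` it is finer
than the product of the Zariski topologies of the factors. -/
@[reducible] def multiprojectiveZariski (k : ℕ) (W : Type*) [AddCommGroup W] [Module ℂ W] :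
    TopologicalSpace (Fin k → ℙ ℂ W) :=
  TopologicalSpace.ofClosed {Z | IsMultiprojectiveClosed Z}
    (by
      refine ⟨{1}, ?_, ?_⟩
      · rintro p rfl
        exact ⟨one_mem _, 0, fun c w => by simp⟩
      · ext x
        simp [multiprojectiveZeroLocus])
    (by
      intro A hA
      refine ⟨{p | (p ∈ polyFunctionsPow k W ∧ IsMultihomogeneous p) ∧
        ∃ Z ∈ A, ∀ x ∈ Z, p (fun i => (x i).rep) = 0}, fun p hp => hp.1, ?_⟩
      ext x
      constructor
      · rintro hx p ⟨-, Z, hZ, hp⟩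
        exact hp x (hx Z hZ)
      · intro hx Z hZ
        obtain ⟨I, hI, rfl⟩ := hA hZ
        exact fun p hp => hx p ⟨hI p hp, _, hZ, fun y hy => hy p hp⟩)
    (by
      rintro _ ⟨I, hI, rfl⟩ _ ⟨J, hJ, rfl⟩
      refine ⟨{r | ∃ p ∈ I, ∃ q ∈ J, r = p * q}, ?_, ?_⟩
      · rintro _ ⟨p, hp, q, hq, rfl⟩
        obtain ⟨hp1, d, hd⟩ := hI p hp
        obtain ⟨hq1, e, he⟩ := hJ q hq
        refine ⟨mul_mem hp1 hq1, d + e, fun c w => ?_⟩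
        simp only [Pi.mul_apply, hd, he, Pi.add_apply, pow_add, Finset.prod_mul_distrib]
        ring
      · ext x
        constructor
        · rintro (hx | hx) _ ⟨p, hp, q, hq, rfl⟩
          · simp [hx p hp]
          · simp [hx q hq]
        · intro hx
          by_contra hcon
          simp only [Set.mem_union, not_or, multiprojectiveZeroLocus, Set.mem_ofPred_eq,
            not_forall] at hcon
          obtain ⟨⟨p, hp, hp0⟩, q, hq, hq0⟩ := hcon
          exact mul_ne_zero hp0 hq0 (hx _ ⟨p, hp, q, hq, rfl⟩))

/-! ### Spinors and the spinor variety -/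

variable {V : Type*} [AddCommGroup V] [Module ℂ V]

/-- A splitting `V = E ⊕ F` into two totally isotropic subspaces. When `Q` is nondegenerate both
have dimension `dim V / 2`, hence are maximal isotropic. -/
structure Polarization (Q : QuadraticForm ℂ V) where
  E : Submodule ℂ V
  F : Submodule ℂ V
  isCompl : IsCompl E F
  isotropic_E : ∀ v ∈ E, Q v = 0
  isotropic_F : ∀ v ∈ F, Q v = 0

namespace Polarization

variable {Q : QuadraticForm ℂ V}

/-- The space of spinors `⋀ E`. -/
def Spinor (P : Polarization Q) : Type _ := ExteriorAlgebra ℂ P.E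

instance (P : Polarization Q) : AddCommGroup P.Spinor :=
  inferInstanceAs (AddCommGroup (ExteriorAlgebra ℂ P.E))

instance (P : Polarization Q) : Module ℂ P.Spinor :=
  inferInstanceAs (Module ℂ (ExteriorAlgebra ℂ P.E))

/-- The linear form `2 q(v, ·)` on `E`, where `q` is the symmetric bilinear form with
`q(v, v) = Q v`; so `2 q(v, w) = Q (v + w) - Q v - Q w`. -/
def pairing (P : Polarization Q) : V →ₗ[ℂ] Module.Dual ℂ P.E :=
  (LinearMap.lcomp ℂ ℂ P.E.subtype) ∘ₗ Q.polarBilin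

/-- The action of a vector `v = v' + v''`, `v' ∈ E`, `v'' ∈ F`, on `⋀ E`: exterior product by `v'`
plus contraction with the linear form `2 q(v'', ·)`. -/
def vectorAction (P : Polarization Q) : V →ₗ[ℂ] Module.End ℂ (ExteriorAlgebra ℂ P.E) :=
  (LinearMap.mul ℂ (ExteriorAlgebra ℂ P.E)) ∘ₗ (ExteriorAlgebra.ι ℂ) ∘ₗ
      (P.E.projectionOnto P.F P.isCompl) +
    CliffordAlgebra.contractLeft ∘ₗ P.pairing ∘ₗ P.F.subtype ∘ₗ
      (P.F.projectionOnto P.E P.isCompl.symm)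

theorem vectorAction_apply (P : Polarization Q) (v : V) (x : ExteriorAlgebra ℂ P.E) :
    P.vectorAction v x =
      ExteriorAlgebra.ι ℂ (P.E.projectionOnto P.F P.isCompl v) * x +
        CliffordAlgebra.contractLeft
          (P.pairing (P.F.projectionOnto P.E P.isCompl.symm v : V)) x :=
  rfl

theorem vectorAction_mul_self (P : Polarization Q) (v : V) :
    P.vectorAction v * P.vectorAction v = algebraMap ℂ _ (Q v) := by
  refine LinearMap.ext fun x => ?_
  have hv : (P.E.projectionOnto P.F P.isCompl v : V) +
      (P.F.projectionOnto P.E P.isCompl.symm v : V) = v :=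
    Submodule.projection_add_projection_eq_self P.isCompl v
  have hd : P.pairing (P.F.projectionOnto P.E P.isCompl.symm v : V)
      (P.E.projectionOnto P.F P.isCompl v) = Q v := by
    change Q ((P.F.projectionOnto P.E P.isCompl.symm v : V) +
        (P.E.projectionOnto P.F P.isCompl v : V)) -
      Q (P.F.projectionOnto P.E P.isCompl.symm v : V) -
      Q (P.E.projectionOnto P.F P.isCompl v : V) = Q v
    rw [P.isotropic_E _ (Submodule.coe_mem _), P.isotropic_F _ (Submodule.coe_mem _), add_comm,
      hv, sub_zero, sub_zero]
  rw [Module.End.mul_apply, Module.algebraMap_end_apply]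
  simp only [vectorAction_apply, map_add]
  rw [← mul_assoc, ExteriorAlgebra.ι_sq_zero, zero_mul, CliffordAlgebra.contractLeft_contractLeft,
    ExteriorAlgebra.ι, CliffordAlgebra.contractLeft_ι_mul, hd]
  abel

/-- The Clifford module structure on `⋀ E`. -/
def spinRep (P : Polarization Q) :
    CliffordAlgebra Q →ₐ[ℂ] Module.End ℂ P.Spinor :=
  CliffordAlgebra.lift Q ⟨P.vectorAction, P.vectorAction_mul_self⟩

/-- `Spin(V)`, a group of invertible elements of the Clifford algebra, acts on `⋀ E`. -/
instance (P : Polarization Q) : DistribMulAction (spinGroup Q) P.Spinor where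
  smul g u := P.spinRep (g : CliffordAlgebra Q) u
  one_smul u := by
    change P.spinRep ((1 : spinGroup Q) : CliffordAlgebra Q) u = u
    simp
  mul_smul g h u := by
    change P.spinRep ((g * h : spinGroup Q) : CliffordAlgebra Q) u = P.spinRep _ (P.spinRep _ u)
    simp
  smul_zero g := map_zero (P.spinRep (g : CliffordAlgebra Q))
  smul_add g := map_add (P.spinRep (g : CliffordAlgebra Q))

instance (P : Polarization Q) : SMulCommClass (spinGroup Q) ℂ P.Spinor where
  smul_comm g c u := map_smul (P.spinRep (g : CliffordAlgebra Q)) c u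

variable [FiniteDimensional ℂ V]

/-- The line `⋀^top E`, a point of the projective space of `⋀ E`. -/
def topLine (P : Polarization Q) : ℙ ℂ P.Spinor :=
  Projectivization.mk'' (K := ℂ) (V := P.Spinor) (⋀[ℂ]^(Module.finrank ℂ P.E) P.E)
    ((exteriorPower.finrank_eq (R := ℂ) (M := P.E) (Module.finrank ℂ P.E)).trans (Nat.choose_self _))

/-- The spinor variety `S₊`: the orbit of the line `⋀^top E` under `Spin(V)`, in the projective
space of spinors. It lies in the linear subspace `ℙ(Δ₊)` of `ℙ(⋀ E)`, where `Δ₊` is the sum of the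
`⋀^k E` with `k` of the parity of `dim E`. -/
abbrev SpinorVariety (P : Polarization Q) : Set (ℙ ℂ P.Spinor) :=
  MulAction.orbit (spinGroup Q) P.topLine

/-- The Zariski topology of the variety `S₊ × ⋯ × S₊` (`k` factors), as a subvariety of
`ℙ(⋀ E) × ⋯ × ℙ(⋀ E)`. -/
@[reducible] def zariski (P : Polarization Q) (k : ℕ) : TopologicalSpace (Fin k → P.SpinorVariety) :=
  TopologicalSpace.induced (fun x i => (x i : ℙ ℂ P.Spinor)) (multiprojectiveZariski k P.Spinor)

/-- The subspace of `V` represented by a point of `S₊`: the vectors that annihilate the pure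
spinor. -/
def isotropicSpace (P : Polarization Q) (x : P.SpinorVariety) : Submodule ℂ V where
  carrier := {v | ∀ u ∈ (x : ℙ ℂ P.Spinor).submodule, P.spinRep (CliffordAlgebra.ι Q v) u = 0}
  zero_mem' := by simp
  add_mem' := by
    intro v w hv hw u hu
    simp [hv u hu, hw u hu]
  smul_mem' := by
    intro c v hv u hu
    simp [hv u hu]

end Polarization

/-- `SO(V)`: the isometries of `(V, Q)` of determinant one. -/
def specialOrthogonalGroup (Q : QuadraticForm ℂ V) : Subgroup (V ≃ₗ[ℂ] V) where
  carrier := {T | (∀ v, Q (T v) = Q v) ∧ LinearEquiv.det T = 1}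
  one_mem' := ⟨fun _ => rfl, map_one _⟩
  mul_mem' := by
    rintro S T ⟨hS, hS1⟩ ⟨hT, hT1⟩
    exact ⟨fun v => (hS (T v)).trans (hT v), by rw [map_mul, hS1, hT1, one_mul]⟩
  inv_mem' := by
    rintro T ⟨hT, hT1⟩
    refine ⟨fun v => ?_, by rw [map_inv, hT1, inv_one]⟩
    have h := hT (T⁻¹ v)
    rw [show T (T⁻¹ v) = v from T.apply_symm_apply v] at h
    exact h.symm

end

/-! Everything is translated into linear algebra. An element of `Spin(V)` is, up to sign, an even
product of unit vectors, and conjugation turns such a product into the corresponding product of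
reflections. With the theorem of Cartan and Dieudonné this gives a surjection `spinGroup.toSO` onto
`SO(V)` with kernel `{1, -1}`. A point of `S₊` is determined by its annihilator, a Lagrangian
subspace, equivariantly (`isotropicSpace_smul`, `isotropicSpace_injective`). So the orbits on `S₊ ^
k` are orbits of `SO(V)` on tuples of Lagrangian subspaces of one family. Two facts control the
family: an isometry that preserves a Lagrangian subspace, or carries one member of the family to
another, has determinant one, and for odd `n` no two members are disjoint.

Triples. If `n = 2m` and the three subspaces are pairwise transversal, the third is the graph of an
isomorphism between the first two. Combined with the pairing between them, this isomorphism becomes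
a symplectic form, whose only invariant is its rank. If `n = 2m + 3`, a general triple meets
pairwise in three lines without a common vector. Dual vectors to these lines complete them to three
hyperbolic planes, and the orthogonal complement of the planes is in the even situation. Both cases
are treated with a single coordinate space `TripleModel ε m`, the proposition `ε` saying whether the
three planes are present. All triples with a frame are conjugate, and having a frame is an open
condition, because it amounts to the injectivity of some linear systems, that is, to the
nonvanishing of minors (`isOpen_setOf_injective`). A nonempty open set is dense because products of
`S₊` are irreducible: a product of unit vectors is joined to `1` by moving each factor along a line
(`ReflectionProduct.exists_curve`). For `n = 1` the variety is a point. In the even case, an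
isometry preserving the triple acts by the same operator `A` on both summands, and being an isometry
means that `A` is symplectic.

Quadruples. Four subspaces have moduli, like the cross-ratio of four points on a line. For `(s :
t)`, consider the pairs `(u, v)` with `u`, `v`, `u + v`, `s u + t v` in the four subspaces. For each
fixed `(s : t)`, quadruples with no nonzero pair form a nonempty invariant open set, apart from
three special values when `n` is odd, where one line of trivial pairs is always present and has to
be cut out by an extra linear form `B`. An open orbit would lie in all these sets at once. But over
`ℂ` every quadruple has an eigenvector, hence some `(s : t)` at which a nontrivial pair exists. The
eigenvector needs `m > 0`, which excludes exactly `n = 1` and `n = 3`. -/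

set_option linter.unusedSectionVars false
open scoped LinearAlgebra.Projectivization Topology Pointwise
noncomputable section
variable {V : Type*} [AddCommGroup V] [Module ℂ V]

section

/-! ### Reflections and the theorem of Cartan and Dieudonné -/

/-- The reflection in a vector `u` with `Q u = 1`. -/
def unitReflection (Q : QuadraticForm ℂ V) (u : V) (hu : Q u = 1) : V ≃ₗ[ℂ] V :=
  LinearEquiv.ofInvolutive (LinearMap.transvection (Q.polarBilin u) (-u)) (by
    intro x
    have h2 : Q.polarBilin u u = 2 := by
      rw [QuadraticMap.polarBilin_apply_apply, QuadraticMap.polar_self, hu]; norm_num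
    simp only [LinearMap.transvection.apply, map_add, map_smul, map_neg, h2]
    module)

theorem unitReflection_apply (Q : QuadraticForm ℂ V) (u : V) (hu : Q u = 1) (x : V) :
    unitReflection Q u hu x = x - QuadraticMap.polar Q u x • u := by
  change LinearMap.transvection (Q.polarBilin u) (-u) x = _
  simp [LinearMap.transvection.apply, sub_eq_add_neg]

theorem QuadraticMap.map_add_smul (Q : QuadraticForm ℂ V) (x u : V) (c : ℂ) :
    Q (x + c • u) = Q x + c * QuadraticMap.polar Q u x + c * c * Q u := by
  rw [QuadraticMap.map_add (⇑Q), QuadraticMap.polar_smul_right, QuadraticMap.map_smul,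
    QuadraticMap.polar_comm]
  simp only [smul_eq_mul]; ring

theorem map_unitReflection (Q : QuadraticForm ℂ V) (u : V) (hu : Q u = 1) (x : V) :
    Q (unitReflection Q u hu x) = Q x := by
  rw [unitReflection_apply, sub_eq_add_neg, ← neg_smul, QuadraticMap.map_add_smul, hu]
  ring

theorem det_unitReflection [FiniteDimensional ℂ V] (Q : QuadraticForm ℂ V) (u : V)
    (hu : Q u = 1) : LinearEquiv.det (unitReflection Q u hu) = -1 := by
  rw [← Units.val_inj, LinearEquiv.coe_det]
  have : ((unitReflection Q u hu : V ≃ₗ[ℂ] V) : V →ₗ[ℂ] V) =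
      LinearMap.transvection (Q.polarBilin u) (-u) := rfl
  rw [this, LinearMap.transvection.det, map_neg, QuadraticMap.polarBilin_apply_apply,
    QuadraticMap.polar_self, hu]
  norm_num

/-- The linear maps that are products of an even number (`b = true`) or an odd number
(`b = false`) of reflections in unit vectors, paired with the corresponding product
in the Clifford algebra. -/
inductive ReflectionProduct (Q : QuadraticForm ℂ V) :
    Bool → (V ≃ₗ[ℂ] V) → CliffordAlgebra Q → Prop
  | one : ReflectionProduct Q true 1 1
  | cons {b : Bool} {T : V ≃ₗ[ℂ] V} {g : CliffordAlgebra Q} (u : V) (hu : Q u = 1)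
      (h : ReflectionProduct Q b T g) :
      ReflectionProduct Q (!b) (unitReflection Q u hu * T) (CliffordAlgebra.ι Q u * g)

namespace ReflectionProduct

variable {Q : QuadraticForm ℂ V} {b c : Bool} {S T : V ≃ₗ[ℂ] V} {g h : CliffordAlgebra Q}

theorem mul (h₁ : ReflectionProduct Q b S g) (h₂ : ReflectionProduct Q c T h) :
    ReflectionProduct Q (b == c) (S * T) (g * h) := by
  induction h₁ with
  | one => simpa using h₂
  | cons u hu _ ih =>
    have := cons u hu ih
    rw [mul_assoc, mul_assoc]
    convert this using 1
    rename_i b _ _ _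
    cases b <;> cases c <;> rfl

theorem isometry (h₁ : ReflectionProduct Q b S g) (v : V) : Q (S v) = Q v := by
  induction h₁ generalizing v with
  | one => rfl
  | cons u hu _ ih => rw [LinearEquiv.mul_apply, map_unitReflection, ih]

theorem det_eq [FiniteDimensional ℂ V] (h₁ : ReflectionProduct Q b S g) :
    LinearEquiv.det S = if b then 1 else -1 := by
  induction h₁ with
  | one => simp
  | @cons b _ _ u hu _ ih => rw [map_mul, det_unitReflection, ih]; cases b <;> simp

theorem mem_evenOdd (h₁ : ReflectionProduct Q b S g) :
    g ∈ CliffordAlgebra.evenOdd Q (if b then 0 else 1) := by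
  induction h₁ with
  | one => simpa using CliffordAlgebra.one_le_evenOdd_zero Q (Submodule.one_le.mp le_rfl)
  | @cons b _ _ u hu _ ih =>
    have := SetLike.mul_mem_graded (CliffordAlgebra.ι_mem_evenOdd_one Q u) ih
    convert this using 2
    cases b
    · simp
      rfl
    · simp

theorem ι_mul_self_of_unit {u : V} (hu : Q u = 1) :
    CliffordAlgebra.ι Q u * CliffordAlgebra.ι Q u = 1 := by
  rw [CliffordAlgebra.ι_sq_scalar, hu, map_one]

theorem star_mul_self (h₁ : ReflectionProduct Q b S g) :
    star g * g = if b then 1 else -1 := by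
  induction h₁ with
  | one => simp
  | @cons b _ g u hu _ ih =>
    rw [star_mul, CliffordAlgebra.star_ι, mul_assoc, neg_mul, ← mul_assoc
      (CliffordAlgebra.ι Q u), ι_mul_self_of_unit hu, one_mul, mul_neg, ih]
    cases b <;> simp

theorem mul_star_self (h₁ : ReflectionProduct Q b S g) :
    g * star g = if b then 1 else -1 := by
  induction h₁ with
  | one => simp
  | @cons b _ g u hu _ ih =>
    rw [star_mul, CliffordAlgebra.star_ι, mul_assoc, ← mul_assoc g, ih]
    cases b <;> simp [ι_mul_self_of_unit hu]

/-- Since `star` is `-1` on vectors, a single unit vector acts by `v ↦ -u v u`, which is already the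
reflection. No separate sign is needed for odd products. -/
theorem mul_ι_mul_star (h₁ : ReflectionProduct Q b S g) (v : V) :
    g * CliffordAlgebra.ι Q v * star g = CliffordAlgebra.ι Q (S v) := by
  induction h₁ with
  | one => simp
  | @cons b T g u hu _ ih =>
    rw [star_mul, CliffordAlgebra.star_ι,
      show CliffordAlgebra.ι Q u * g * CliffordAlgebra.ι Q v * (star g * -CliffordAlgebra.ι Q u) =
        -(CliffordAlgebra.ι Q u * (g * CliffordAlgebra.ι Q v * star g) * CliffordAlgebra.ι Q u) by
      noncomm_ring, ih, CliffordAlgebra.ι_mul_ι_mul_ι, LinearEquiv.mul_apply,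
      unitReflection_apply, hu, one_smul, ← map_neg, neg_sub]

theorem exists_unit (h₁ : ReflectionProduct Q b S g) :
    ∃ x : (CliffordAlgebra Q)ˣ, (x : CliffordAlgebra Q) = g ∧ x ∈ lipschitzGroup Q := by
  induction h₁ with
  | one => exact ⟨1, rfl, one_mem _⟩
  | @cons b T g u hu _ ih =>
    obtain ⟨x, rfl, hx⟩ := ih
    exact ⟨⟨_, _, ι_mul_self_of_unit hu, ι_mul_self_of_unit hu⟩ * x, rfl,
      mul_mem (Subgroup.subset_closure ⟨u, rfl⟩) hx⟩

theorem mem_spinGroup (h₁ : ReflectionProduct Q true S g) : g ∈ spinGroup Q := by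
  obtain ⟨x, rfl, hx⟩ := h₁.exists_unit
  refine ⟨⟨⟨x, hx, rfl⟩, ?_, ?_⟩, ?_⟩
  · simpa using h₁.star_mul_self
  · simpa using h₁.mul_star_self
  · exact h₁.mem_evenOdd

end ReflectionProduct

theorem exists_smul_unit (Q : QuadraticForm ℂ V) {v : V} (hv : Q v ≠ 0) :
    ∃ (c : ℂ) (u : V), c ≠ 0 ∧ Q u = 1 ∧ v = c • u := by
  obtain ⟨c, hc⟩ := IsAlgClosed.exists_pow_nat_eq (Q v) (n := 2) (by norm_num)
  have hc0 : c ≠ 0 := by rintro rfl; simp at hc; exact hv hc.symm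
  refine ⟨c, c⁻¹ • v, hc0, ?_, by rw [smul_inv_smul₀ hc0]⟩
  rw [QuadraticMap.map_smul, ← hc, smul_eq_mul]
  field_simp

theorem exists_reflectionProduct_of_mem_lipschitzGroup {Q : QuadraticForm ℂ V}
    {x : (CliffordAlgebra Q)ˣ} (hx : x ∈ lipschitzGroup Q) :
    ∃ (c : ℂ) (b : Bool) (T : V ≃ₗ[ℂ] V) (g : CliffordAlgebra Q), c ≠ 0 ∧
      ReflectionProduct Q b T g ∧ (x : CliffordAlgebra Q) = c • g := by
  have key : ∀ x : (CliffordAlgebra Q)ˣ, (x : CliffordAlgebra Q) ∈ Set.range (CliffordAlgebra.ι Q) →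
      ∃ (c : ℂ) (u : V), c ≠ 0 ∧ Q u = 1 ∧ (x : CliffordAlgebra Q) = c • CliffordAlgebra.ι Q u ∧
        ((x⁻¹ : (CliffordAlgebra Q)ˣ) : CliffordAlgebra Q) = c⁻¹ • CliffordAlgebra.ι Q u := by
    rintro x ⟨v, hv⟩
    have hu : IsUnit (Q v) := CliffordAlgebra.isUnit_of_isUnit_ι Q (hv ▸ x.isUnit)
    obtain ⟨c, u, hc, hu1, rfl⟩ := exists_smul_unit Q hu.ne_zero
    refine ⟨c, u, hc, hu1, by rw [← hv, map_smul], ?_⟩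
    apply Units.inv_eq_of_mul_eq_one_right
    rw [← hv, map_smul, smul_mul_smul_comm, mul_inv_cancel₀ hc,
      ReflectionProduct.ι_mul_self_of_unit hu1, one_smul]
  have one_u : ∀ u (hu : Q u = 1), ReflectionProduct Q false (unitReflection Q u hu)
      (CliffordAlgebra.ι Q u) := fun u hu => by
    simpa using ReflectionProduct.cons u hu .one
  unfold lipschitzGroup at hx
  induction hx using Subgroup.closure_induction'' with
  | mem x hx =>
    obtain ⟨c, u, hc, hu, h1, -⟩ := key x hx
    exact ⟨c, _, _, _, hc, one_u u hu, h1⟩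
  | inv_mem x hx =>
    obtain ⟨c, u, hc, hu, -, h1⟩ := key x hx
    exact ⟨c⁻¹, _, _, _, inv_ne_zero hc, one_u u hu, h1⟩
  | one => exact ⟨1, _, _, _, one_ne_zero, .one, by simp⟩
  | mul x y _ _ hx hy =>
    obtain ⟨c, b, T, g, hc, h, h1⟩ := hx
    obtain ⟨c', b', T', g', hc', h', h1'⟩ := hy
    exact ⟨c * c', _, _, _, mul_ne_zero hc hc', h.mul h', by
      rw [Units.val_mul, h1, h1', smul_mul_smul_comm]⟩

/-- An element of the spin group is, up to sign, a product of an even number of unit vectors. -/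
theorem exists_reflectionProduct_of_mem_spinGroup {Q : QuadraticForm ℂ V}
    {g : CliffordAlgebra Q} (hg : g ∈ spinGroup Q) :
    ∃ (c : ℂ) (T : V ≃ₗ[ℂ] V) (h : CliffordAlgebra Q), c * c = 1 ∧
      ReflectionProduct Q true T h ∧ g = c • h := by
  obtain ⟨x, hx, rfl⟩ := hg.1.1
  obtain ⟨c, b, T, h, hc, hh, hxh⟩ := exists_reflectionProduct_of_mem_lipschitzGroup hx
  simp only [Units.coeHom_apply] at hg ⊢
  -- An odd product would lie both in the even and in the odd part of the Clifford algebra, hence be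
  -- zero.
  have hb : b = true := by
    by_contra hb
    rw [Bool.not_eq_true] at hb
    subst hb
    have h0 : (x : CliffordAlgebra Q) ∈ CliffordAlgebra.evenOdd Q 0 := hg.2
    have h1 : (x : CliffordAlgebra Q) ∈ CliffordAlgebra.evenOdd Q 1 := by
      rw [hxh]; exact Submodule.smul_mem _ _ (by simpa using hh.mem_evenOdd)
    have := Submodule.disjoint_def.mp (CliffordAlgebra.evenOdd_isCompl Q).disjoint _ h0 h1
    exact x.ne_zero this
  subst hb
  refine ⟨c, T, h, ?_, hh, hxh⟩
  have h1 := hg.1.2.1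
  rw [hxh, CliffordAlgebra.star_smul, smul_mul_smul_comm, hh.star_mul_self, if_pos rfl] at h1
  have : algebraMap ℂ (CliffordAlgebra Q) (c * c) = algebraMap ℂ _ 1 := by
    rw [map_one, ← h1, Algebra.algebraMap_eq_smul_one]
  exact (algebraMap ℂ (CliffordAlgebra Q)).injective this

theorem exists_unitReflection_eq (Q : QuadraticForm ℂ V) {w e : V} (hwe : Q w = Q e)
    (h : Q (w - e) ≠ 0) :
    ∃ (u : V) (hu : Q u = 1) (c : ℂ), c ≠ 0 ∧ w - e = c • u ∧ unitReflection Q u hu w = e := by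
  obtain ⟨c, u, hc, hu, hcu⟩ := exists_smul_unit Q h
  refine ⟨u, hu, c, hc, hcu, ?_⟩
  have h3 : QuadraticMap.polar Q u w = c := by
    have h5 : Q (w - e) = c * c := by rw [hcu, QuadraticMap.map_smul, hu]; simp
    have h6 : QuadraticMap.polar Q (w - e) w = Q (w - e) := by
      rw [QuadraticMap.polar_sub_left, QuadraticMap.polar_self, nsmul_eq_mul]
      have h7 := QuadraticMap.map_add_smul Q w e (-1)
      rw [neg_one_smul, ← sub_eq_add_neg] at h7
      rw [h7, hwe]; push_cast; ring
    rw [h5, hcu, QuadraticMap.polar_smul_left] at h6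
    exact mul_left_cancel₀ hc h6
  rw [unitReflection_apply, h3, ← hcu]; abel

/-- The theorem of Cartan and Dieudonné. -/
theorem exists_reflectionProduct_of_isometry [FiniteDimensional ℂ V] {Q : QuadraticForm ℂ V}
    (hQ : Q.Nondegenerate) (T : V ≃ₗ[ℂ] V) (hT : ∀ v, Q (T v) = Q v) :
    ∃ b g, ReflectionProduct Q b T g := by
  have hpol : ∀ (T : V ≃ₗ[ℂ] V), (∀ v, Q (T v) = Q v) → ∀ v w,
      QuadraticMap.polar Q (T v) (T w) = QuadraticMap.polar Q v w := fun T hT v w => by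
    simp only [QuadraticMap.polar, ← map_add, hT]
  have hsymm : (QuadraticMap.associated Q).IsSymm := ⟨QuadraticMap.associated_isSymm ℂ Q⟩
  obtain ⟨e, he⟩ := LinearMap.BilinForm.exists_orthogonal_basis hsymm
  have he0 := he.not_isOrtho_basis_self_of_separatingLeft
    (QuadraticMap.nondegenerate_associated_iff.mpr hQ).1
  have hne : ∀ i, Q (e i) ≠ 0 := fun i hi => he0 i (by
    exact (QuadraticMap.associated_eq_self_apply ℂ Q (e i)).trans hi)
  have hort : ∀ i j, i ≠ j → QuadraticMap.polar Q (e i) (e j) = 0 := fun i j hij => by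
    have h : QuadraticMap.associated Q (e i) (e j) = 0 := he hij
    rw [QuadraticMap.associated_apply] at h
    simpa [QuadraticMap.polar] using h
  -- `T` is undone one vector of the orthogonal basis at a time, by composing with reflections that
  -- keep the vectors already restored.
  have key : ∀ s : Finset (Fin (Module.finrank ℂ V)), ∃ (b : Bool) (S : V ≃ₗ[ℂ] V) (g : _),
      ReflectionProduct Q b S g ∧ ∀ i ∈ s, S (T (e i)) = e i := by
    intro s
    induction s using Finset.induction_on with
    | empty => exact ⟨_, _, _, .one, by simp⟩
    | @insert j s hj ih =>
      obtain ⟨b, S, g, hS, hs⟩ := ih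
      set w := S (T (e j)) with hw
      have hQw : Q w = Q (e j) := by rw [hw, hS.isometry, hT]
      have hws : ∀ i ∈ s, QuadraticMap.polar Q w (e i) = 0 := fun i hi => by
        have : QuadraticMap.polar Q w (S (T (e i))) = 0 := by
          rw [hw, hpol S hS.isometry, hpol T hT, hort]
          rintro rfl; exact hj hi
        rwa [hs i hi] at this
      have hes : ∀ i ∈ s, QuadraticMap.polar Q (e j) (e i) = 0 := fun i hi =>
        hort _ _ (by rintro rfl; exact hj hi)
      have hsum : Q (w - e j) + Q (w + e j) = 4 * Q (e j) := by
        rw [sub_eq_add_neg, ← neg_one_smul ℂ, QuadraticMap.map_add_smul]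
        have h2 := QuadraticMap.map_add_smul Q w (e j) 1
        rw [one_smul] at h2
        rw [h2, hQw]; ring
      -- A reflection in a vector orthogonal to `e i` fixes `e i`. For `i ∈ s` both `w` and `e j`
      -- are orthogonal to `e i`, so are `w ± e j`.
      have horth : ∀ {c : ℂ} {x u : V}, c ≠ 0 → x = c • u →
          (∀ i ∈ s, QuadraticMap.polar Q x (e i) = 0) → ∀ i ∈ s, ∀ hu : Q u = 1,
          unitReflection Q u hu (e i) = e i := fun {c x u} hc hx h i hi hu => by
        have h1 := h i hi
        rw [hx, QuadraticMap.polar_smul_left, smul_eq_mul] at h1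
        rw [unitReflection_apply, (mul_eq_zero.mp h1).resolve_left hc, zero_smul, sub_zero]
      -- By `hsum`, `w - e j` and `w + e j` cannot both be isotropic. When the first one is, two
      -- reflections are used: `w` goes to `-e j`, then `-e j` to `e j`.
      by_cases h : Q (w - e j) = 0
      · have h' : Q (w - -e j) ≠ 0 := fun h' => by
          rw [sub_neg_eq_add] at h'
          rw [h, h', add_zero] at hsum
          exact hne j (by simpa using hsum.symm)
        have h'' : Q (-e j - e j) ≠ 0 := by
          rw [← neg_add', QuadraticMap.map_neg, ← two_smul ℂ, QuadraticMap.map_smul]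
          simpa using hne j
        obtain ⟨u, hu, c, hc, hcu, huw⟩ :=
          exists_unitReflection_eq Q (hQw.trans (QuadraticMap.map_neg Q _).symm) h'
        obtain ⟨u', hu', c', hc', hcu', huw'⟩ :=
          exists_unitReflection_eq Q (QuadraticMap.map_neg Q (e j)) h''
        refine ⟨_, _, _, .cons u' hu' (.cons u hu hS), fun i hi => ?_⟩
        simp only [LinearEquiv.mul_apply]
        rcases Finset.mem_insert.mp hi with rfl | hi
        · rw [← hw, huw, huw']
        · rw [hs i hi, horth hc hcu _ i hi, horth hc' hcu' _ i hi]
          · intro i hi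
            rw [QuadraticMap.polar_sub_left, QuadraticMap.polar_neg_left, hes i hi, neg_zero,
              sub_zero]
          · intro i hi
            rw [QuadraticMap.polar_sub_left, QuadraticMap.polar_neg_left, hws i hi, hes i hi,
              neg_zero, sub_zero]
      · obtain ⟨u, hu, c, hc, hcu, huw⟩ := exists_unitReflection_eq Q hQw h
        refine ⟨_, _, _, .cons u hu hS, fun i hi => ?_⟩
        simp only [LinearEquiv.mul_apply]
        rcases Finset.mem_insert.mp hi with rfl | hi
        · rw [← hw, huw]
        · rw [hs i hi, horth hc hcu _ i hi]
          intro i hi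
          rw [QuadraticMap.polar_sub_left, hws i hi, hes i hi, sub_zero]
  obtain ⟨b, S, g, hS, hs⟩ := key Finset.univ
  have hST : S * T = 1 := by
    apply LinearEquiv.toLinearMap_injective
    exact e.ext fun i => hs i (Finset.mem_univ i)
  -- Reflections are involutions, so the inverse is the product in the reverse order.
  have hinv : ∀ {b S g}, ReflectionProduct Q b S g → ∃ g', ReflectionProduct Q b S⁻¹ g' := by
    intro b S g h
    induction h with
    | one => exact ⟨1, by simpa using ReflectionProduct.one⟩
    | @cons b T g u hu _ ih =>
      obtain ⟨g', hg'⟩ := ih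
      have h1 : (unitReflection Q u hu)⁻¹ = unitReflection Q u hu := rfl
      refine ⟨g' * CliffordAlgebra.ι Q u, ?_⟩
      rw [mul_inv_rev, h1]
      have := hg'.mul (.cons u hu .one)
      rw [mul_one, mul_one] at this
      convert this using 1
      cases b <;> rfl
  obtain ⟨g', hg'⟩ := hinv hS
  rw [inv_eq_of_mul_eq_one_right hST] at hg'
  exact ⟨_, _, hg'⟩

end

section

/-! ### The two-to-one homomorphism from the spin group to the special orthogonal group -/

theorem CliffordAlgebra.ι_injective_of_complex (Q : QuadraticForm ℂ V) :
    Function.Injective (CliffordAlgebra.ι Q) := by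
  intro v w h
  have h1 := congrArg (CliffordAlgebra.equivExterior Q) h
  simp only [CliffordAlgebra.equivExterior, CliffordAlgebra.changeFormEquiv_apply,
    CliffordAlgebra.changeForm_ι] at h1
  exact ExteriorAlgebra.ι_leftInverse.injective h1

theorem spinGroup.coe_inv_mul_coe {Q : QuadraticForm ℂ V} (g : spinGroup Q) :
    ((g⁻¹ : spinGroup Q) : CliffordAlgebra Q) * (g : CliffordAlgebra Q) = 1 := by
  rw [← Submonoid.coe_mul, inv_mul_cancel, Submonoid.coe_one]

theorem spinGroup.exists_isometry [FiniteDimensional ℂ V] {Q : QuadraticForm ℂ V}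
    (g : spinGroup Q) :
    ∃ T : specialOrthogonalGroup Q, ∀ v, (g : CliffordAlgebra Q) * CliffordAlgebra.ι Q v *
      ((g⁻¹ : spinGroup Q) : CliffordAlgebra Q) =
        CliffordAlgebra.ι Q ((T : V ≃ₗ[ℂ] V) v) := by
  obtain ⟨c, T, h, hc, hh, hg⟩ := exists_reflectionProduct_of_mem_spinGroup g.2
  refine ⟨⟨T, hh.isometry, by simpa using hh.det_eq⟩, fun v => ?_⟩
  rw [show ((g⁻¹ : spinGroup Q) : CliffordAlgebra Q) = star (g : CliffordAlgebra Q) from rfl,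
    hg, CliffordAlgebra.star_smul, smul_mul_assoc, smul_mul_smul_comm, hc, one_smul,
    hh.mul_ι_mul_star]

/-- The action of the spin group on `V` by conjugation in the Clifford algebra. -/
def spinGroup.toSO [FiniteDimensional ℂ V] (Q : QuadraticForm ℂ V) :
    spinGroup Q →* specialOrthogonalGroup Q where
  toFun g := (spinGroup.exists_isometry g).choose
  map_one' := by
    apply Subtype.ext
    ext v
    apply CliffordAlgebra.ι_injective_of_complex Q
    rw [← (spinGroup.exists_isometry (1 : spinGroup Q)).choose_spec v]
    simp
  map_mul' g h := by
    apply Subtype.ext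
    ext v
    apply CliffordAlgebra.ι_injective_of_complex Q
    rw [← (spinGroup.exists_isometry (g * h)).choose_spec v]
    simp only [Subgroup.coe_mul, LinearEquiv.mul_apply]
    rw [← (spinGroup.exists_isometry g).choose_spec, ← (spinGroup.exists_isometry h).choose_spec,
      mul_inv_rev]
    simp only [Submonoid.coe_mul, mul_assoc]

variable [FiniteDimensional ℂ V] {Q : QuadraticForm ℂ V}

theorem spinGroup.mul_ι_mul_inv (g : spinGroup Q) (v : V) :
    (g : CliffordAlgebra Q) * CliffordAlgebra.ι Q v * ((g⁻¹ : spinGroup Q) : CliffordAlgebra Q) =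
      CliffordAlgebra.ι Q ((spinGroup.toSO Q g : V ≃ₗ[ℂ] V) v) :=
  (spinGroup.exists_isometry g).choose_spec v

theorem spinGroup.mul_ι (g : spinGroup Q) (v : V) :
    (g : CliffordAlgebra Q) * CliffordAlgebra.ι Q v =
      CliffordAlgebra.ι Q ((spinGroup.toSO Q g : V ≃ₗ[ℂ] V) v) * (g : CliffordAlgebra Q) := by
  rw [← spinGroup.mul_ι_mul_inv, mul_assoc, spinGroup.coe_inv_mul_coe, mul_one]

theorem spinGroup.toSO_surjective (hQ : Q.Nondegenerate) :
    Function.Surjective (spinGroup.toSO Q) := by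
  rintro ⟨T, hT, hdet⟩
  obtain ⟨b, g, hg⟩ := exists_reflectionProduct_of_isometry hQ T hT
  have hb : b = true := by
    by_contra hb
    rw [Bool.not_eq_true] at hb
    subst hb
    have h1 := hg.det_eq
    rw [hdet, ← Units.val_inj] at h1
    norm_num at h1
  subst hb
  refine ⟨⟨g, hg.mem_spinGroup⟩, Subtype.ext ?_⟩
  ext v
  apply CliffordAlgebra.ι_injective_of_complex Q
  rw [← spinGroup.mul_ι_mul_inv]
  exact hg.mul_ι_mul_star v

/-- The supercommutator with `v` and the contraction with `polar Q v` are both antiderivations, and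
they agree on vectors by the Clifford relation. It turns commuting with all vectors into vanishing
of all contractions. -/
theorem CliffordAlgebra.ι_mul_sub_involute_mul_ι (Q : QuadraticForm ℂ V) (v : V)
    (x : CliffordAlgebra Q) :
    CliffordAlgebra.ι Q v * x - CliffordAlgebra.involute x * CliffordAlgebra.ι Q v =
      CliffordAlgebra.contractLeft (Q.polarBilin v) x := by
  induction x using CliffordAlgebra.left_induction with
  | algebraMap r =>
    rw [CliffordAlgebra.contractLeft_algebraMap, AlgHom.commutes, Algebra.commutes, sub_self]
  | add x y hx hy => rw [map_add, map_add, ← hx, ← hy]; noncomm_ring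
  | ι_mul y w hy =>
    rw [CliffordAlgebra.contractLeft_ι_mul, ← hy, map_mul, CliffordAlgebra.involute_ι,
      Algebra.smul_def, QuadraticMap.polarBilin_apply_apply,
      ← CliffordAlgebra.ι_mul_ι_add_swap]
    noncomm_ring


/-! ### Contractions and top degree in the exterior algebra -/

section Exterior

variable {M : Type*} [AddCommGroup M] [Module ℂ M]

theorem ExteriorAlgebra.contractLeft_ι_mul (f : Module.Dual ℂ M) (v : M)
    (x : ExteriorAlgebra ℂ M) :
    (CliffordAlgebra.contractLeft f (ExteriorAlgebra.ι ℂ v * x) : ExteriorAlgebra ℂ M) =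
      f v • x - ExteriorAlgebra.ι ℂ v * (CliffordAlgebra.contractLeft f x : ExteriorAlgebra ℂ M) :=
  CliffordAlgebra.contractLeft_ι_mul (Q := 0) f v x

theorem ExteriorAlgebra.left_induction {p : ExteriorAlgebra ℂ M → Prop}
    (h₀ : ∀ r, p (algebraMap ℂ _ r)) (h₁ : ∀ x y, p x → p y → p (x + y))
    (h₂ : ∀ x v, p x → p (ExteriorAlgebra.ι ℂ v * x)) (x : ExteriorAlgebra ℂ M) : p x :=
  CliffordAlgebra.left_induction (Q := 0) h₀ h₁ h₂ x

/-- Replacing each factor `v` of a product by `v - f(v) e` and expanding, the terms with two factors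
`e` vanish, and those with one add up to `-e ∧ (f ⌟ x)`. No condition on `f e` is needed. -/
theorem ExteriorAlgebra.eq_map_add_mul_contractLeft
    (f : Module.Dual ℂ M) (e : M) (x : ExteriorAlgebra ℂ M) :
    x = ExteriorAlgebra.map (LinearMap.id - f.smulRight e) x +
      ExteriorAlgebra.ι ℂ e * (CliffordAlgebra.contractLeft f x : ExteriorAlgebra ℂ M) := by
  induction x using ExteriorAlgebra.left_induction with
  | h₀ r =>
    have h : (CliffordAlgebra.contractLeft f (algebraMap ℂ (ExteriorAlgebra ℂ M) r) :
      ExteriorAlgebra ℂ M) = 0 := CliffordAlgebra.contractLeft_algebraMap (Q := 0) f r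
    rw [h, mul_zero, add_zero, AlgHom.commutes]
  | h₁ x y hx hy =>
    have h : (CliffordAlgebra.contractLeft f (x + y) : ExteriorAlgebra ℂ M) =
      CliffordAlgebra.contractLeft f x + CliffordAlgebra.contractLeft f y := map_add _ x y
    rw [h, map_add, mul_add, add_add_add_comm, ← hx, ← hy]
  | h₂ x v hx =>
    rw [ExteriorAlgebra.contractLeft_ι_mul, map_mul, ExteriorAlgebra.map_apply_ι]
    set y := ExteriorAlgebra.map (LinearMap.id - f.smulRight e) x
    set z : ExteriorAlgebra ℂ M := CliffordAlgebra.contractLeft f x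
    have h1 : ExteriorAlgebra.ι ℂ e * x = ExteriorAlgebra.ι ℂ e * y := by
      rw [hx, mul_add, ← mul_assoc, ExteriorAlgebra.ι_sq_zero, zero_mul, add_zero]
    have h2 := ExteriorAlgebra.ι_add_mul_swap (R := ℂ) e v
    rw [LinearMap.sub_apply, LinearMap.id_apply, LinearMap.smulRight_apply, map_sub, map_smul,
      mul_sub, mul_smul_comm, h1, sub_mul, smul_mul_assoc, ← mul_assoc,
      eq_neg_of_add_eq_zero_left h2, neg_mul, mul_assoc]
    nth_rewrite 1 [hx]
    rw [mul_add]
    abel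

theorem ExteriorAlgebra.map_zero_apply (x : ExteriorAlgebra ℂ M) :
    ExteriorAlgebra.map (0 : M →ₗ[ℂ] M) x =
      algebraMap ℂ _ (ExteriorAlgebra.algebraMapInv x) := by
  have : ExteriorAlgebra.map (0 : M →ₗ[ℂ] M) =
      (Algebra.ofId ℂ _).comp ExteriorAlgebra.algebraMapInv := by
    apply ExteriorAlgebra.hom_ext
    ext v
    simp [ExteriorAlgebra.algebraMapInv]
  rw [this]; rfl

/-- By the preceding formula, `x` is fixed by the map induced by each projection that kills one
basis vector. Composing all of them, `x` is fixed by the map induced by `0`, whose image is the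
scalars. -/
theorem ExteriorAlgebra.eq_algebraMap_of_contractLeft_eq_zero [FiniteDimensional ℂ M]
    (x : ExteriorAlgebra ℂ M)
    (hx : ∀ f : Module.Dual ℂ M, (CliffordAlgebra.contractLeft f x : ExteriorAlgebra ℂ M) = 0) :
    x = algebraMap ℂ _ (ExteriorAlgebra.algebraMapInv x) := by
  let b := Module.finBasis ℂ M
  have key : ∀ s : Finset (Fin (Module.finrank ℂ M)),
      ExteriorAlgebra.map (LinearMap.id - ∑ i ∈ s, (b.coord i).smulRight (b i)) x = x := by
    intro s
    induction s using Finset.induction_on with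
    | empty => simp [ExteriorAlgebra.map_id]
    | @insert j s hj ih =>
      have h1 := ExteriorAlgebra.eq_map_add_mul_contractLeft (b.coord j) (b j) x
      rw [hx, mul_zero, add_zero] at h1
      nth_rewrite 2 [h1]
      nth_rewrite 2 [← ih]
      rw [← AlgHom.comp_apply, ExteriorAlgebra.map_comp_map]
      congr 2
      refine LinearMap.ext fun v => ?_
      have h2 : ∑ i ∈ s, Finsupp.single i (b.repr v i) j = 0 :=
        Finset.sum_eq_zero fun i hi => Finsupp.single_eq_of_ne (by rintro rfl; exact hj hi)
      simp [Finset.sum_insert hj, LinearMap.sum_apply, map_sum, h2]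
      abel
  have h := key Finset.univ
  have h0 : (LinearMap.id - ∑ i, (b.coord i).smulRight (b i)) = 0 := by
    refine LinearMap.ext fun v => ?_
    simp [LinearMap.sum_apply, b.sum_repr]
  rw [h0, ExteriorAlgebra.map_zero_apply] at h
  exact h.symm

/-- The contraction anticommutes with the factors `b j`, `j ≠ i`, so a product of such factors can
still be extracted on the left after contracting. -/
theorem ExteriorAlgebra.exists_contractLeft_prod_mul {ι' : Type*} (b : Module.Basis ι' ℂ M) (i : ι') :
    ∀ (l : List ι'), i ∉ l → ∀ z : ExteriorAlgebra ℂ M, ∃ z' : ExteriorAlgebra ℂ M,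
      (CliffordAlgebra.contractLeft (b.coord i)
        ((l.map fun j => ExteriorAlgebra.ι ℂ (b j)).prod * z) : ExteriorAlgebra ℂ M) =
      (l.map fun j => ExteriorAlgebra.ι ℂ (b j)).prod * z'
  | [], _, z => ⟨CliffordAlgebra.contractLeft (b.coord i) z, by
      simp only [List.map_nil, List.prod_nil, one_mul]⟩
  | j :: l, hi, z => by
    obtain ⟨z', hz'⟩ := exists_contractLeft_prod_mul b i l (fun h => hi (List.mem_cons_of_mem _ h)) z
    refine ⟨-z', ?_⟩
    rw [List.map_cons, List.prod_cons, mul_assoc, ExteriorAlgebra.contractLeft_ι_mul, hz',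
      Module.Basis.coord_apply, Module.Basis.repr_self, Finsupp.single_eq_of_ne, zero_smul,
      zero_sub, mul_assoc, mul_neg, mul_neg]
    rintro rfl
    exact hi List.mem_cons_self

theorem exteriorPower.ι_mul_eq_zero [FiniteDimensional ℂ M] (v : M) (x : ExteriorAlgebra ℂ M)
    (hx : x ∈ ⋀[ℂ]^(Module.finrank ℂ M) M) : 
    ExteriorAlgebra.ι ℂ v * x = 0 ∧ x * ExteriorAlgebra.ι ℂ v = 0 := by
  have h0 : ⋀[ℂ]^(Module.finrank ℂ M + 1) M = ⊥ := by
    rw [← Submodule.finrank_eq_zero (R := ℂ), exteriorPower.finrank_eq, Nat.choose_succ_self]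
  have hv : ExteriorAlgebra.ι ℂ v ∈ LinearMap.range (ExteriorAlgebra.ι ℂ (M := M)) :=
    LinearMap.mem_range_self _ v
  constructor
  · rw [← Submodule.mem_bot ℂ, ← h0, ExteriorAlgebra.exteriorPower, pow_succ']
    exact Submodule.mul_mem_mul hv hx
  · rw [← Submodule.mem_bot ℂ, ← h0, ExteriorAlgebra.exteriorPower, pow_succ]
    exact Submodule.mul_mem_mul hx hv

/-- Elements killed by all exterior products have top degree. -/
theorem exteriorPower.mem_top_of_ι_mul_eq_zero [FiniteDimensional ℂ M] (x : ExteriorAlgebra ℂ M)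
    (hx : ∀ v, ExteriorAlgebra.ι ℂ v * x = 0) : x ∈ ⋀[ℂ]^(Module.finrank ℂ M) M := by
  let b := Module.finBasis ℂ M
  have key : ∀ l : List (Fin (Module.finrank ℂ M)), l.Nodup →
      ∃ z, x = (l.map fun j => ExteriorAlgebra.ι ℂ (b j)).prod * z := by
    intro l hl
    induction l with
    | nil => exact ⟨x, by simp⟩
    | cons i l ih =>
      obtain ⟨z, hz⟩ := ih hl.of_cons
      obtain ⟨z', hz'⟩ := ExteriorAlgebra.exists_contractLeft_prod_mul b i l
        (List.nodup_cons.mp hl).1 z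
      refine ⟨z', ?_⟩
      -- Contracting `b i ∧ x = 0` with the dual coordinate gives `x = b i ∧ (b.coord i ⌟ x)`, and
      -- by `hz'` the contraction keeps the factors already extracted.
      have h1 := ExteriorAlgebra.contractLeft_ι_mul (b.coord i) (b i) x
      rw [hx, Module.Basis.coord_apply, Module.Basis.repr_self, Finsupp.single_eq_same, one_smul,
        eq_comm, sub_eq_iff_eq_add] at h1
      rw [h1, hz, hz', List.map_cons, List.prod_cons, mul_assoc]
      exact (congrArg (· + _) (map_zero _)).trans (zero_add _)
  obtain ⟨z, hz⟩ := key _ (List.nodup_finRange _)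
  set p := ((List.finRange (Module.finrank ℂ M)).map fun j => ExteriorAlgebra.ι ℂ (b j)).prod with hp
  have hpm : p ∈ ⋀[ℂ]^(Module.finrank ℂ M) M := by
    have h1 : ∀ l : List (Fin (Module.finrank ℂ M)),
        (l.map fun j => ExteriorAlgebra.ι ℂ (b j)).prod ∈ ⋀[ℂ]^l.length M := by
      intro l
      induction l with
      | nil => simp [ExteriorAlgebra.exteriorPower]
      | cons i l ih =>
        rw [List.map_cons, List.prod_cons, List.length_cons, ExteriorAlgebra.exteriorPower, pow_succ']
        exact Submodule.mul_mem_mul (LinearMap.mem_range_self _ _) ih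
    simpa using h1 (List.finRange (Module.finrank ℂ M))
  -- On an element of top degree, multiplication sees only the scalar part of the other factor.
  have h2 : ∀ z, p * z = ExteriorAlgebra.algebraMapInv z • p := by
    intro z
    induction z using ExteriorAlgebra.left_induction with
    | h₀ r => 
      rw [← Algebra.commutes, ← Algebra.smul_def, ExteriorAlgebra.algebraMap_leftInverse]
    | h₁ x y hx hy => rw [mul_add, hx, hy, map_add, add_smul]
    | h₂ x v hx =>
      rw [← mul_assoc, (exteriorPower.ι_mul_eq_zero v p hpm).2, zero_mul, map_mul]
      simp [ExteriorAlgebra.algebraMapInv]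
  rw [hz, h2]
  exact Submodule.smul_mem _ _ hpm

end Exterior

/-- An even element acting trivially commutes with all vectors, so its contractions with the forms
`polar Q v` vanish. By nondegeneracy these are all linear forms. Carried to the exterior algebra,
this makes the element a scalar `c`, and its spinor norm gives `c² = 1`. -/
theorem spinGroup.toSO_eq_one_iff (hQ : Q.Nondegenerate) (g : spinGroup Q) :
    spinGroup.toSO Q g = 1 ↔ (g : CliffordAlgebra Q) = 1 ∨ (g : CliffordAlgebra Q) = -1 := by
  constructor
  · intro hg
    have h1 : ∀ v, CliffordAlgebra.contractLeft (Q.polarBilin v) (g : CliffordAlgebra Q) = 0 := by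
      intro v
      rw [← CliffordAlgebra.ι_mul_sub_involute_mul_ι, spinGroup.involute_eq g.2, spinGroup.mul_ι,
        hg]
      exact sub_self _
    have h2 : ∀ f, CliffordAlgebra.contractLeft f (g : CliffordAlgebra Q) = 0 := by
      intro f
      have hnd := QuadraticMap.nondegenerate_polar_iff.mpr hQ
      obtain ⟨v, rfl⟩ := (LinearMap.BilinForm.toDual Q.polarBilin hnd).surjective f
      exact h1 v
    have h3 := ExteriorAlgebra.eq_algebraMap_of_contractLeft_eq_zero
      (CliffordAlgebra.equivExterior Q (g : CliffordAlgebra Q)) (fun f => by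
        have := CliffordAlgebra.changeForm_contractLeft
          (CliffordAlgebra.changeForm.associated_neg_proof (Q := Q)) f (g : CliffordAlgebra Q)
        rw [h2, map_zero] at this
        exact this.symm)
    set c := ExteriorAlgebra.algebraMapInv
      (CliffordAlgebra.equivExterior Q (g : CliffordAlgebra Q)) with hc
    have h4 : (g : CliffordAlgebra Q) = algebraMap ℂ _ c := by
      apply (CliffordAlgebra.equivExterior Q).injective
      rw [h3]
      exact (CliffordAlgebra.changeForm_algebraMap
        (CliffordAlgebra.changeForm.associated_neg_proof (Q := Q)) c).symm
    have h5 : c * c = 1 := by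
      have := g.2.1.2.1
      rw [h4, CliffordAlgebra.star_algebraMap, ← map_mul, ← map_one (algebraMap ℂ _)] at this
      exact (algebraMap ℂ (CliffordAlgebra Q)).injective this
    rcases mul_self_eq_one_iff.mp h5 with h | h
    · left; rw [h4, h, map_one]
    · right; rw [h4, h, map_neg, map_one]
  · intro hg
    apply Subtype.ext
    ext v
    apply CliffordAlgebra.ι_injective_of_complex Q
    rw [← spinGroup.mul_ι_mul_inv]
    change _ * _ * star (g : CliffordAlgebra Q) = _
    rcases hg with hg | hg <;> simp [hg]

end

section

/-! ### Lagrangian subspaces -/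

/-- A subspace that is its own orthogonal complement. -/
def IsLagrangian (Q : QuadraticForm ℂ V) (H : Submodule ℂ V) : Prop :=
  ∀ v, v ∈ H ↔ ∀ w ∈ H, QuadraticMap.polar Q v w = 0

theorem polar_map_of_isometry {Q : QuadraticForm ℂ V} {T : V ≃ₗ[ℂ] V}
    (hT : ∀ v, Q (T v) = Q v) (v w : V) :
    QuadraticMap.polar Q (T v) (T w) = QuadraticMap.polar Q v w := by
  simp only [QuadraticMap.polar, ← map_add, hT]

theorem isometry_of_polar_eq {Q : QuadraticForm ℂ V} {T : V ≃ₗ[ℂ] V}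
    (hT : ∀ v w, QuadraticMap.polar Q (T v) (T w) = QuadraticMap.polar Q v w) (v : V) :
    Q (T v) = Q v := by
  have := hT v v
  simpa [QuadraticMap.polar_self] using this

theorem polar_separating {Q : QuadraticForm ℂ V} (hQ : Q.Nondegenerate) {v : V}
    (hv : ∀ w, QuadraticMap.polar Q v w = 0) : v = 0 :=
  (QuadraticMap.nondegenerate_polar_iff.mpr hQ).1 v hv

namespace IsLagrangian

variable {Q : QuadraticForm ℂ V} {H : Submodule ℂ V}

theorem polar_eq_zero (hH : IsLagrangian Q H) {v w : V} (hv : v ∈ H) (hw : w ∈ H) :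
    QuadraticMap.polar Q v w = 0 :=
  (hH v).mp hv w hw

theorem map_eq_zero (hH : IsLagrangian Q H) {v : V} (hv : v ∈ H) : Q v = 0 := by
  have := hH.polar_eq_zero hv hv
  simpa [QuadraticMap.polar_self] using this

theorem map (hH : IsLagrangian Q H) {T : V ≃ₗ[ℂ] V} (hT : ∀ v, Q (T v) = Q v) :
    IsLagrangian Q (H.map (T : V →ₗ[ℂ] V)) := by
  intro v
  obtain ⟨v, rfl⟩ := T.surjective v
  rw [Submodule.mem_map_equiv, T.symm_apply_apply, hH v]
  constructor
  · rintro h _ ⟨w, hw, rfl⟩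
    exact (polar_map_of_isometry hT v w).trans (h w hw)
  · intro h w hw
    rw [← polar_map_of_isometry hT]
    exact h _ ⟨w, hw, rfl⟩

/-- The isomorphism of `V / H` with the dual of `H`. -/
theorem exists_quotient_equiv_dual [FiniteDimensional ℂ V] (hQ : Q.Nondegenerate)
    (hH : IsLagrangian Q H) :
    ∃ φ : (V ⧸ H) ≃ₗ[ℂ] Module.Dual ℂ H,
      ∀ v (w : H), φ (Submodule.Quotient.mk v) w = QuadraticMap.polar Q v w := by
  let f : V →ₗ[ℂ] Module.Dual ℂ H := LinearMap.lcomp ℂ ℂ H.subtype ∘ₗ Q.polarBilin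
  have hf : ∀ v (w : H), f v w = QuadraticMap.polar Q v w := fun _ _ => rfl
  have hker : H = LinearMap.ker f := by
    ext v
    rw [hH v, LinearMap.mem_ker]
    constructor
    · intro h
      exact LinearMap.ext fun w => h w w.2
    · intro h w hw
      exact LinearMap.congr_fun h ⟨w, hw⟩
  have hsurj : Function.Surjective f := by
    have h1 : Function.Surjective (LinearMap.lcomp ℂ ℂ H.subtype) :=
      LinearMap.dualMap_surjective_of_injective H.injective_subtype
    have h2 : Function.Surjective Q.polarBilin :=
      (LinearMap.BilinForm.toDual Q.polarBilin
        (QuadraticMap.nondegenerate_polar_iff.mpr hQ)).surjective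
    exact h1.comp h2
  refine ⟨(Submodule.quotEquivOfEq _ _ hker).trans (f.quotKerEquivOfSurjective hsurj),
    fun v w => ?_⟩
  rw [← hf]
  simp

theorem finrank [FiniteDimensional ℂ V] (hQ : Q.Nondegenerate) (hH : IsLagrangian Q H) :
    Module.finrank ℂ V = 2 * Module.finrank ℂ H := by
  obtain ⟨φ, -⟩ := hH.exists_quotient_equiv_dual hQ
  rw [← Submodule.finrank_quotient_add_finrank H, φ.finrank_eq, Subspace.dual_finrank_eq, two_mul]

/-- The determinant is the product of those on `H` and on `V / H`. The form identifies `V / H` with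
the dual of `H`, where an isometry acts by the contragredient of its restriction to `H`, so the two
factors are inverse to each other. -/
theorem det_eq_one [FiniteDimensional ℂ V] (hQ : Q.Nondegenerate) (hH : IsLagrangian Q H)
    {T : V ≃ₗ[ℂ] V} (hT : ∀ v, Q (T v) = Q v) (hTH : ∀ v ∈ H, T v ∈ H) :
    LinearEquiv.det T = 1 := by
  obtain ⟨φ, hφ⟩ := hH.exists_quotient_equiv_dual hQ
  have hle : H ≤ H.comap (T : V →ₗ[ℂ] V) := hTH
  rw [← Units.val_inj, LinearEquiv.coe_det, LinearMap.det_eq_det_mul_det H _ hle,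
    ← LinearMap.det_dualMap, ← LinearMap.det_conj (H.mapQ H (T : V →ₗ[ℂ] V) hle) φ,
    ← LinearMap.det_comp, Units.val_one, ← LinearMap.det_id (M := Module.Dual ℂ H) (A := ℂ)]
  congr 1
  refine LinearMap.ext fun ψ => ?_
  obtain ⟨v, rfl⟩ := φ.surjective ψ
  obtain ⟨v, rfl⟩ := Submodule.Quotient.mk_surjective H v
  refine LinearMap.ext fun w => ?_
  simp only [LinearMap.comp_apply, LinearEquiv.coe_coe, LinearEquiv.symm_apply_apply,
    Submodule.mapQ_apply, LinearMap.dualMap_apply, hφ, LinearMap.id_apply]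
  exact polar_map_of_isometry hT v w

theorem eq_of_le {H' : Submodule ℂ V} (hH : IsLagrangian Q H) (hH' : IsLagrangian Q H')
    (h : H ≤ H') : H = H' :=
  le_antisymm h fun v hv => (hH v).mpr fun _ hw => hH'.polar_eq_zero hv (h hw)

end IsLagrangian

/-- A linear map pulling a form back to a nondegenerate one is bijective if the dimensions agree. -/
theorem exists_linearEquiv_of_form {X Y : Type*} [AddCommGroup X] [Module ℂ X]
    [FiniteDimensional ℂ X] [AddCommGroup Y] [Module ℂ Y] [FiniteDimensional ℂ Y]
    (f : X →ₗ[ℂ] Y) (β : Y → Y → ℂ) (hβ : ∀ y, β 0 y = 0)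
    (hnd : ∀ x, (∀ x', β (f x) (f x') = 0) → x = 0)
    (hrank : Module.finrank ℂ X = Module.finrank ℂ Y) :
    ∃ θ : X ≃ₗ[ℂ] Y, ∀ x, θ x = f x := by
  have hinj : Function.Injective f := by
    rw [injective_iff_map_eq_zero]
    intro x hx
    exact hnd x fun x' => by rw [hx, hβ]
  exact ⟨LinearEquiv.ofInjectiveOfFinrankEq f hinj hrank, fun x => rfl⟩

theorem QuadraticMap.polar_sum_left (Q : QuadraticForm ℂ V) {ι' : Type*} (s : Finset ι')
    (f : ι' → V) (w : V) :
    QuadraticMap.polar Q (∑ i ∈ s, f i) w = ∑ i ∈ s, QuadraticMap.polar Q (f i) w := by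
  simp only [← QuadraticMap.polarBilin_apply_apply, map_sum, LinearMap.sum_apply]

theorem QuadraticMap.polar_sum_right (Q : QuadraticForm ℂ V) {ι' : Type*} (s : Finset ι')
    (f : ι' → V) (w : V) :
    QuadraticMap.polar Q w (∑ i ∈ s, f i) = ∑ i ∈ s, QuadraticMap.polar Q w (f i) := by
  simp only [← QuadraticMap.polarBilin_apply_apply, map_sum]

/-- A vector of `L'` orthogonal to `L` lies in `L ∩ L' = 0`, so the form embeds `L'` into the dual
of `L`, and the dimensions agree. -/
theorem IsLagrangian.exists_dual_frame [FiniteDimensional ℂ V] {Q : QuadraticForm ℂ V}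
    (hQ : Q.Nondegenerate) {L L' : Submodule ℂ V} (hL : IsLagrangian Q L)
    (hL' : IsLagrangian Q L') (hdisj : Disjoint L L') {ι' : Type*} [Fintype ι'] [DecidableEq ι']
    (hcard : Module.finrank ℂ L = Fintype.card ι') :
    ∃ e f : ι' → V, (∀ i, e i ∈ L) ∧ (∀ i, f i ∈ L') ∧
      ∀ i j, QuadraticMap.polar Q (e i) (f j) = if i = j then 1 else 0 := by
  let b : Module.Basis ι' ℂ L := (Module.finBasis ℂ L).reindex
    (Fintype.equivOfCardEq (by rw [Fintype.card_fin, hcard]))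
  let φ : L' →ₗ[ℂ] Module.Dual ℂ L :=
    LinearMap.lcomp ℂ ℂ L.subtype ∘ₗ Q.polarBilin ∘ₗ L'.subtype
  have hφ : ∀ v w, φ v w = QuadraticMap.polar Q (v : V) (w : V) := fun _ _ => rfl
  have hinj : Function.Injective φ := by
    rw [injective_iff_map_eq_zero]
    intro v hv
    have h1 : (v : V) ∈ L := (hL v).mpr fun w hw => LinearMap.congr_fun hv ⟨w, hw⟩
    exact Subtype.ext (Submodule.disjoint_def.mp hdisj v h1 v.2)
  have hr : Module.finrank ℂ L' = Module.finrank ℂ (Module.Dual ℂ L) := by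
    have h1 := hL.finrank hQ
    have h2 := hL'.finrank hQ
    rw [Subspace.dual_finrank_eq]
    omega
  let ψ := LinearEquiv.ofInjectiveOfFinrankEq φ hinj hr
  refine ⟨fun i => b i, fun j => (ψ.symm (b.coord j) : L'), fun i => (b i).2,
    fun j => (ψ.symm (b.coord j)).2, fun i j => ?_⟩
  rw [QuadraticMap.polar_comm, ← hφ]
  have h1 : φ (ψ.symm (b.coord j)) = b.coord j := ψ.apply_symm_apply _
  rw [h1, Module.Basis.coord_apply, Module.Basis.repr_self, Finsupp.single_apply]

/-- Complementary Lagrangian subspaces exchanged by a special isometry have even dimension. -/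
theorem IsLagrangian.even_of_disjoint [FiniteDimensional ℂ V] {Q : QuadraticForm ℂ V}
    (hQ : Q.Nondegenerate) {L : Submodule ℂ V} (hL : IsLagrangian Q L)
    (T : specialOrthogonalGroup Q) (hdisj : Disjoint L (L.map ((T : V ≃ₗ[ℂ] V) : V →ₗ[ℂ] V))) :
    Even (Module.finrank ℂ L) := by
  obtain ⟨T, hT, hdet⟩ := T
  set L' := L.map (T : V →ₗ[ℂ] V) with hLdef
  have hL' : IsLagrangian Q L' := hL.map hT
  set n := Module.finrank ℂ L
  obtain ⟨e, f, he, hf, hef⟩ := hL.exists_dual_frame hQ hL' hdisj (ι' := Fin n) (by simp [n])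
  have hee : ∀ i j, QuadraticMap.polar Q (e i) (e j) = 0 := fun i j =>
    hL.polar_eq_zero (he i) (he j)
  have hff : ∀ i j, QuadraticMap.polar Q (f i) (f j) = 0 := fun i j =>
    hL'.polar_eq_zero (hf i) (hf j)
  have hfe : ∀ i j, QuadraticMap.polar Q (f i) (e j) = if i = j then 1 else 0 := fun i j => by
    rw [QuadraticMap.polar_comm, hef]; simp [eq_comm]
  let θ₀ : (Fin n ⊕ Fin n → ℂ) →ₗ[ℂ] V := Fintype.linearCombination ℂ (Sum.elim e f)
  have hθ₀ : ∀ x, θ₀ x = ∑ i, x (.inl i) • e i + ∑ i, x (.inr i) • f i := fun x => by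
    simp [θ₀, Fintype.linearCombination_apply]
  have hpol : ∀ x y, QuadraticMap.polar Q (θ₀ x) (θ₀ y) =
      ∑ i, x (.inl i) * y (.inr i) + ∑ i, x (.inr i) * y (.inl i) := fun x y => by
    simp [hθ₀, QuadraticMap.polar_add_left, QuadraticMap.polar_add_right,
      QuadraticMap.polar_sum_left, QuadraticMap.polar_sum_right, QuadraticMap.polar_smul_left,
      QuadraticMap.polar_smul_right, hee, hff, hef, hfe]
    rw [add_comm]
    simp only [mul_comm]
  obtain ⟨θ, hθ⟩ := exists_linearEquiv_of_form θ₀ (QuadraticMap.polar Q)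
    (fun y => QuadraticMap.polar_zero_left Q y) (fun x hx => by
      funext i
      rcases i with i | i
      · have := hx (Pi.single (.inr i) 1)
        simpa [hpol, Pi.single_apply] using this
      · have := hx (Pi.single (.inl i) 1)
        simpa [hpol, Pi.single_apply] using this)
    (by rw [hL.finrank hQ]; simp [n, two_mul])
  let M : Matrix (Fin n ⊕ Fin n) (Fin n ⊕ Fin n) ℂ := Matrix.fromBlocks 0 1 1 0
  have hM : ∀ x i, (M.mulVec x) i = x i.swap := fun x i => by
    rcases i with i | i <;> simp [M, Matrix.fromBlocks_mulVec]
  have hMdet : M.det = (-1) ^ n := by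
    -- A unipotent factor makes the lower right block the identity, and the Schur complement is then
    -- `-1` of size `n`.
    have h1 : M * Matrix.fromBlocks 1 1 0 1 = Matrix.fromBlocks 0 1 1 1 := by
      simp [M, Matrix.fromBlocks_multiply]
    have h2 := congrArg Matrix.det h1
    rw [Matrix.det_mul, Matrix.det_fromBlocks_zero₂₁, Matrix.det_fromBlocks_one₂₂] at h2
    simpa [Matrix.det_neg] using h2
  let s : (Fin n ⊕ Fin n → ℂ) ≃ₗ[ℂ] (Fin n ⊕ Fin n → ℂ) :=
    LinearEquiv.ofInvolutive (Matrix.toLin' M) (fun x => by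
      funext i
      rw [Matrix.toLin'_apply, Matrix.toLin'_apply, hM, hM, Sum.swap_swap])
  have hs : ∀ x i, s x i = x i.swap := fun x i => hM x i
  let S : V ≃ₗ[ℂ] V := (θ.symm.trans s).trans θ
  have hS : ∀ x, S (θ x) = θ (s x) := fun x => by simp [S]
  have hSQ : ∀ v, Q (S v) = Q v := by
    apply isometry_of_polar_eq
    intro v w
    obtain ⟨x, rfl⟩ := θ.surjective v
    obtain ⟨y, rfl⟩ := θ.surjective w
    rw [hS, hS, hθ, hθ, hθ, hθ, hpol, hpol]
    simp only [hs, Sum.swap_inl, Sum.swap_inr]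
    ring
  have hSdet : LinearMap.det (S : V →ₗ[ℂ] V) = (-1) ^ n := by
    rw [← hMdet, ← LinearMap.det_toLin', ← LinearMap.det_conj (Matrix.toLin' M) θ]
    rfl
  have hSL : ∀ v ∈ L, S v ∈ L' := by
    intro v hv
    obtain ⟨x, rfl⟩ := θ.surjective v
    have hx : ∀ i, x (.inr i) = 0 := fun i => by
      have := hL.polar_eq_zero hv (he i)
      rw [hθ, hθ₀, QuadraticMap.polar_add_left, QuadraticMap.polar_sum_left,
        QuadraticMap.polar_sum_left] at this
      simpa [QuadraticMap.polar_smul_left, hee, hfe] using this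
    rw [hS, hθ, hθ₀]
    simp only [hs, Sum.swap_inl, Sum.swap_inr, hx, zero_smul, Finset.sum_const_zero, zero_add]
    exact Submodule.sum_mem _ fun i _ => Submodule.smul_mem _ _ (hf i)
  have hST : ∀ v, Q ((T⁻¹ * S) v) = Q v := fun v => by
    rw [← hT, ← hSQ v, LinearEquiv.mul_apply]
    exact congrArg Q (T.apply_symm_apply (S v))
  -- The exchange `S` of the dual frames also carries `L` to `L'`, so `T⁻¹ S` preserves `L` and has
  -- determinant one. Hence `(-1) ^ n = det S = det T = 1`.
  have h1 := hL.det_eq_one hQ hST (fun v hv => by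
    obtain ⟨w, hw, hw'⟩ := hSL v hv
    rw [LinearEquiv.mul_apply, ← hw']
    have h2 : T⁻¹ ((T : V →ₗ[ℂ] V) w) = w := T.symm_apply_apply w
    rwa [h2])
  rw [map_mul, map_inv, hdet, inv_one, one_mul, ← Units.val_inj, LinearEquiv.coe_det, hSdet,
    Units.val_one] at h1
  exact (neg_one_pow_eq_one_iff_even (by norm_num)).mp h1

end

section

/-! ### Points of the spinor variety as Lagrangian subspaces -/

namespace Polarization

variable [FiniteDimensional ℂ V] {Q : QuadraticForm ℂ V} (P : Polarization Q)

theorem isLagrangian_of_isCompl (hQ : Q.Nondegenerate) {E F : Submodule ℂ V} (h : IsCompl E F)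
    (hE : ∀ v ∈ E, Q v = 0) (hF : ∀ v ∈ F, Q v = 0) : IsLagrangian Q E := by
  have hE2 : ∀ v ∈ E, ∀ w ∈ E, QuadraticMap.polar Q v w = 0 := fun v hv w hw => by
    rw [QuadraticMap.polar, hE _ hv, hE _ hw, hE _ (add_mem hv hw)]; ring
  have hF2 : ∀ v ∈ F, ∀ w ∈ F, QuadraticMap.polar Q v w = 0 := fun v hv w hw => by
    rw [QuadraticMap.polar, hF _ hv, hF _ hw, hF _ (add_mem hv hw)]; ring
  refine fun v => ⟨hE2 v, fun hv => ?_⟩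
  obtain ⟨e, he, f, hf, rfl⟩ := Submodule.mem_sup.mp (h.sup_eq_top.symm ▸ Submodule.mem_top : v ∈ E ⊔ F)
  have : f = 0 := by
    apply polar_separating hQ
    intro w
    obtain ⟨e', he', f', hf', rfl⟩ := Submodule.mem_sup.mp (h.sup_eq_top.symm ▸ Submodule.mem_top : w ∈ E ⊔ F)
    have h1 := hv e' he'
    rw [QuadraticMap.polar_add_left, hE2 e he e' he', zero_add] at h1
    rw [QuadraticMap.polar_add_right, h1, hF2 f hf f' hf', add_zero]
  rw [this, add_zero]
  exact he

theorem isLagrangian_E (hQ : Q.Nondegenerate) : IsLagrangian Q P.E :=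
  isLagrangian_of_isCompl hQ P.isCompl P.isotropic_E P.isotropic_F

theorem isLagrangian_F (hQ : Q.Nondegenerate) : IsLagrangian Q P.F :=
  isLagrangian_of_isCompl hQ P.isCompl.symm P.isotropic_F P.isotropic_E

variable {P}

theorem mem_isotropicSpace_iff (x : P.SpinorVariety) {u : P.Spinor}
    (hu : (x : ℙ ℂ P.Spinor).submodule = ℂ ∙ u) (v : V) :
    v ∈ P.isotropicSpace x ↔ P.spinRep (CliffordAlgebra.ι Q v) u = 0 := by
  change (∀ u ∈ (x : ℙ ℂ P.Spinor).submodule, P.spinRep (CliffordAlgebra.ι Q v) u = 0) ↔ _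
  rw [hu]
  constructor
  · exact fun h => h u (Submodule.mem_span_singleton_self u)
  · intro h w hw
    obtain ⟨c, rfl⟩ := Submodule.mem_span_singleton.mp hw
    rw [map_smul, h, smul_zero]

theorem mem_isotropicSpace_iff_rep (x : P.SpinorVariety) (v : V) :
    v ∈ P.isotropicSpace x ↔
      P.spinRep (CliffordAlgebra.ι Q v) (x : ℙ ℂ P.Spinor).rep = 0 :=
  mem_isotropicSpace_iff x (Projectivization.submodule_eq _) v

theorem submodule_smul (g : spinGroup Q) (x : ℙ ℂ P.Spinor) :
    (g • x).submodule = ℂ ∙ (P.spinRep (g : CliffordAlgebra Q) x.rep) := by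
  have h : g • x = Projectivization.mk ℂ (g • x.rep)
      ((smul_ne_zero_iff_ne g).mpr x.rep_nonzero) := by
    conv_lhs => rw [← x.mk_rep]
    exact Projectivization.smul_mk g x.rep_nonzero
  rw [h, Projectivization.submodule_mk]
  rfl

theorem spinRep_mul_apply (a b : CliffordAlgebra Q) (u : P.Spinor) :
    P.spinRep (a * b) u = P.spinRep a (P.spinRep b u) := by
  rw [map_mul]; rfl

theorem isotropicSpace_smul (g : spinGroup Q) (x : P.SpinorVariety) :
    P.isotropicSpace (g • x) =
      (P.isotropicSpace x).map ((spinGroup.toSO Q g : V ≃ₗ[ℂ] V) : V →ₗ[ℂ] V) := by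
  ext w
  obtain ⟨v, rfl⟩ := (spinGroup.toSO Q g : V ≃ₗ[ℂ] V).surjective w
  rw [Submodule.mem_map_equiv, LinearEquiv.symm_apply_apply, mem_isotropicSpace_iff_rep x,
    mem_isotropicSpace_iff (g • x) (submodule_smul g (x : ℙ ℂ P.Spinor)), ← spinRep_mul_apply,
    ← spinGroup.mul_ι, spinRep_mul_apply]
  constructor
  · intro h
    have h1 := congrArg (P.spinRep ((g⁻¹ : spinGroup Q) : CliffordAlgebra Q)) h
    rwa [← spinRep_mul_apply, spinGroup.coe_inv_mul_coe, map_one, map_zero] at h1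
  · intro h
    rw [h, map_zero]

theorem vectorAction_apply_E {v : V} (hv : v ∈ P.E) (x : ExteriorAlgebra ℂ P.E) :
    P.vectorAction v x = ExteriorAlgebra.ι ℂ (⟨v, hv⟩ : P.E) * x := by
  rw [vectorAction_apply]
  have h1 : P.E.projectionOnto P.F P.isCompl v = ⟨v, hv⟩ :=
    Submodule.projectionOnto_apply_left P.isCompl ⟨v, hv⟩
  have h2 : P.F.projectionOnto P.E P.isCompl.symm v = 0 :=
    Submodule.projectionOnto_apply_right P.isCompl.symm ⟨v, hv⟩
  rw [h1, h2, Submodule.coe_zero, map_zero, map_zero, LinearMap.zero_apply, add_zero]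

theorem spinRep_ι (v : V) : P.spinRep (CliffordAlgebra.ι Q v) = P.vectorAction v :=
  CliffordAlgebra.lift_ι_apply _ _ v

theorem topLine_submodule :
    P.topLine.submodule = (⋀[ℂ]^(Module.finrank ℂ P.E) P.E : Submodule ℂ P.Spinor) :=
  Projectivization.submodule_mk'' _ _

variable (P) in
/-- The base point of the spinor variety. -/
def basePoint : P.SpinorVariety := ⟨P.topLine, MulAction.mem_orbit_self _⟩

/-- Vectors of `E` kill the top degree. Conversely, two vectors killing the same nonzero spinor are
orthogonal, because `v w + w v` acts as the scalar `polar Q v w`; so the annihilator lies in the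
orthogonal of `E`, which is `E`. -/
theorem isotropicSpace_basePoint (hQ : Q.Nondegenerate) : P.isotropicSpace P.basePoint = P.E := by
  have hE := P.isLagrangian_E hQ
  have hle : P.E ≤ P.isotropicSpace P.basePoint := by
    intro v hv u hu
    rw [show (P.basePoint : ℙ ℂ P.Spinor) = P.topLine from rfl, topLine_submodule] at hu
    rw [spinRep_ι]
    exact (vectorAction_apply_E hv u).trans (exteriorPower.ι_mul_eq_zero _ u hu).1
  refine le_antisymm (fun v hv => (hE v).mpr fun w hw => ?_) hle
  have h1 := (mem_isotropicSpace_iff_rep _ _).mp hv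
  have h2 := (mem_isotropicSpace_iff_rep _ _).mp (hle hw)
  have h3 := congrArg (fun a => P.spinRep a (P.basePoint : ℙ ℂ P.Spinor).rep)
    (CliffordAlgebra.ι_mul_ι_add_swap (Q := Q) v w)
  simp only [map_add, map_mul, AlgHom.commutes, LinearMap.add_apply, Module.End.mul_apply, h1, h2,
    map_zero, add_zero, Module.algebraMap_end_apply] at h3
  exact (smul_eq_zero.mp h3.symm).resolve_right (Projectivization.rep_nonzero _)

theorem exists_smul_basePoint (x : P.SpinorVariety) : ∃ g : spinGroup Q, g • P.basePoint = x := by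
  obtain ⟨x, g, rfl⟩ := x
  exact ⟨g, rfl⟩

theorem isLagrangian_isotropicSpace (hQ : Q.Nondegenerate) (x : P.SpinorVariety) :
    IsLagrangian Q (P.isotropicSpace x) := by
  obtain ⟨g, rfl⟩ := exists_smul_basePoint x
  rw [isotropicSpace_smul, isotropicSpace_basePoint hQ]
  exact (P.isLagrangian_E hQ).map (spinGroup.toSO Q g).2.1

/-- A spinor killed by exterior multiplication with all of `E` has top degree, and the top degree is
one line. Homogeneity extends this to the injectivity of `isotropicSpace`. -/
theorem eq_basePoint_of_isotropicSpace_eq (x : P.SpinorVariety)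
    (hx : P.isotropicSpace x = P.E) : x = P.basePoint := by
  have h1 : (x : ℙ ℂ P.Spinor).rep ∈ P.topLine.submodule := by
    rw [topLine_submodule]
    refine exteriorPower.mem_top_of_ι_mul_eq_zero _ fun v => ?_
    have hv : (v : V) ∈ P.isotropicSpace x := by rw [hx]; exact v.2
    rw [mem_isotropicSpace_iff_rep, spinRep_ι] at hv
    exact (vectorAction_apply_E v.2 _).symm.trans hv
  apply Subtype.ext
  apply Projectivization.submodule_injective
  apply Submodule.eq_of_le_of_finrank_eq
  · rw [Projectivization.submodule_eq, Submodule.span_singleton_le_iff_mem]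
    exact h1
  · rw [Projectivization.finrank_submodule, Projectivization.finrank_submodule]

theorem toSO_map_map (g h : spinGroup Q) (H : Submodule ℂ V) :
    (H.map ((spinGroup.toSO Q h : V ≃ₗ[ℂ] V) : V →ₗ[ℂ] V)).map
        ((spinGroup.toSO Q g : V ≃ₗ[ℂ] V) : V →ₗ[ℂ] V) =
      H.map ((spinGroup.toSO Q (g * h) : V ≃ₗ[ℂ] V) : V →ₗ[ℂ] V) := by
  rw [← Submodule.map_comp, map_mul]; rfl

theorem isotropicSpace_injective (hQ : Q.Nondegenerate) :
    Function.Injective P.isotropicSpace := by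
  intro x y hxy
  obtain ⟨g, rfl⟩ := exists_smul_basePoint x
  rw [isotropicSpace_smul, isotropicSpace_basePoint hQ] at hxy
  rw [eq_comm, ← inv_smul_eq_iff]
  apply eq_basePoint_of_isotropicSpace_eq
  rw [isotropicSpace_smul, ← hxy, toSO_map_map, inv_mul_cancel, map_one]
  exact Submodule.map_id _

theorem exists_isotropicSpace_eq_map (hQ : Q.Nondegenerate) (x : P.SpinorVariety)
    (T : specialOrthogonalGroup Q) :
    ∃ y : P.SpinorVariety, P.isotropicSpace y =
      (P.isotropicSpace x).map ((T : V ≃ₗ[ℂ] V) : V →ₗ[ℂ] V) := by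
  obtain ⟨g, rfl⟩ := spinGroup.toSO_surjective hQ T
  exact ⟨g • x, isotropicSpace_smul g x⟩

theorem exists_toSO_map_eq (x y : P.SpinorVariety) :
    ∃ T : specialOrthogonalGroup Q, (P.isotropicSpace x).map ((T : V ≃ₗ[ℂ] V) : V →ₗ[ℂ] V) =
      P.isotropicSpace y := by
  obtain ⟨g, rfl⟩ := exists_smul_basePoint x
  obtain ⟨h, rfl⟩ := exists_smul_basePoint y
  refine ⟨spinGroup.toSO Q (h * g⁻¹), ?_⟩
  rw [← isotropicSpace_smul, smul_smul, inv_mul_cancel_right]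

theorem finrank_isotropicSpace (hQ : Q.Nondegenerate) {n : ℕ}
    (hdim : Module.finrank ℂ V = 2 * n) (x : P.SpinorVariety) :
    Module.finrank ℂ (P.isotropicSpace x) = n := by
  have := (isLagrangian_isotropicSpace hQ x).finrank hQ
  omega

theorem not_disjoint_isotropicSpace (hQ : Q.Nondegenerate) {n : ℕ}
    (hdim : Module.finrank ℂ V = 2 * n) (hn : ¬ Even n) (x y : P.SpinorVariety) :
    ¬ Disjoint (P.isotropicSpace x) (P.isotropicSpace y) := by
  obtain ⟨T, hT⟩ := exists_toSO_map_eq x y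
  rw [← hT]
  intro h
  have := (isLagrangian_isotropicSpace hQ x).even_of_disjoint hQ T h
  rw [finrank_isotropicSpace hQ hdim] at this
  exact hn this

/-- An isometry carrying one point of `S₊` to another has determinant one. -/
theorem det_eq_one_of_map_le (hQ : Q.Nondegenerate) {x y : P.SpinorVariety} {T : V ≃ₗ[ℂ] V}
    (hT : ∀ v, Q (T v) = Q v) (h : ∀ v ∈ P.isotropicSpace x, T v ∈ P.isotropicSpace y) :
    LinearEquiv.det T = 1 := by
  obtain ⟨S, hS⟩ := exists_toSO_map_eq y x
  have h1 : LinearEquiv.det ((S : V ≃ₗ[ℂ] V) * T) = 1 := by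
    refine (isLagrangian_isotropicSpace hQ x).det_eq_one hQ
      (fun v => (S.2.1 (T v)).trans (hT v)) (fun v hv => ?_)
    rw [← hS]
    exact ⟨T v, h v hv, rfl⟩
  rwa [map_mul, S.2.2, one_mul] at h1

end Polarization

end

section

/-! ### Zariski open sets of tuples of points of the spinor variety -/

/-! ### Multihomogeneous functions, representatives and polynomial curves -/

section MultiprojectiveOpen

variable {k : ℕ} {W : Type*} [AddCommGroup W] [Module ℂ W]

theorem IsMultihomogeneous.ne_zero_iff {p : (Fin k → W) → ℂ} (hp : IsMultihomogeneous p)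
    {w w' : Fin k → W} (h : ∀ i, ℂ ∙ w i = ℂ ∙ w' i) : p w ≠ 0 ↔ p w' ≠ 0 := by
  have key : ∀ w w' : Fin k → W, (∀ i, ℂ ∙ w i = ℂ ∙ w' i) → p w ≠ 0 → p w' ≠ 0 := by
    intro w w' h hw
    obtain ⟨d, hd⟩ := hp
    have h1 : ∀ i, ∃ c : ℂ, c • w' i = w i := fun i =>
      Submodule.mem_span_singleton.mp (h i ▸ Submodule.mem_span_singleton_self (w i))
    choose c hc using h1
    have h2 := hd c w'
    simp only [hc] at h2
    rw [h2] at hw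
    exact right_ne_zero_of_mul hw
  exact ⟨key w w' h, key w' w fun i => (h i).symm⟩

theorem polyFunctionsPow.exists_polynomial_of_curve {p : (Fin k → W) → ℂ}
    (hp : p ∈ polyFunctionsPow k W) {w : ℂ → Fin k → W}
    (hw : ∀ i (φ : Module.Dual ℂ W), ∃ f : Polynomial ℂ, ∀ t, φ (w t i) = f.eval t) :
    ∃ f : Polynomial ℂ, ∀ t, p (w t) = f.eval t := by
  induction hp using Algebra.adjoin_induction with
  | mem p hp =>
    obtain ⟨φ, rfl⟩ := hp
    choose f hf using fun i => hw i (φ ∘ₗ LinearMap.single ℂ (fun _ => W) i)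
    refine ⟨∑ i, f i, fun t => ?_⟩
    rw [Polynomial.eval_finsetSum]
    simp only [← hf, LinearMap.comp_apply, ← map_sum]
    congr 1
    funext j
    simp [Finset.sum_apply, Pi.single_apply]
  | algebraMap c => exact ⟨Polynomial.C c, fun t => by simp [Pi.algebraMap_apply]⟩
  | add p q _ _ hp hq =>
    obtain ⟨f, hf⟩ := hp
    obtain ⟨g, hg⟩ := hq
    exact ⟨f + g, fun t => by rw [Pi.add_apply, hf, hg, Polynomial.eval_add]⟩
  | mul p q _ _ hp hq =>
    obtain ⟨f, hf⟩ := hp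
    obtain ⟨g, hg⟩ := hq
    exact ⟨f * g, fun t => by rw [Pi.mul_apply, hf, hg, Polynomial.eval_mul]⟩

end MultiprojectiveOpen

/-- A polynomial curve in the Clifford algebra from `1` to a product of reflections, made of
scalar multiples of such products away from finitely many parameters. -/
theorem ReflectionProduct.exists_curve {Q : QuadraticForm ℂ V} {u₀ : V} (hu₀ : Q u₀ = 1)
    {b : Bool} {T : V ≃ₗ[ℂ] V} {g : CliffordAlgebra Q} (hg : ReflectionProduct Q b T g) :
    ∃ (γ : ℂ → CliffordAlgebra Q) (D : Polynomial ℂ),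
      (∀ φ : Module.Dual ℂ (CliffordAlgebra Q), ∃ f : Polynomial ℂ, ∀ t, φ (γ t) = f.eval t) ∧
      γ 0 = (if b then 1 else CliffordAlgebra.ι Q u₀) ∧ γ 1 = g ∧ D ≠ 0 ∧
      ∀ t, D.eval t ≠ 0 → ∃ (c : ℂ) (S : V ≃ₗ[ℂ] V) (h : CliffordAlgebra Q), c ≠ 0 ∧
        ReflectionProduct Q b S h ∧ γ t = c • h := by
  induction hg with
  | one =>
    exact ⟨fun _ => 1, 1, fun φ => ⟨Polynomial.C (φ 1), fun t => by simp⟩, by simp, rfl,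
      one_ne_zero, fun t _ => ⟨1, _, _, one_ne_zero, .one, by simp⟩⟩
  | @cons b T g u hu _ ih =>
    obtain ⟨γ, D, hγ, h0, h1, hD, hDt⟩ := ih
    obtain ⟨D', hQ⟩ : ∃ D' : Polynomial ℂ, ∀ t : ℂ, Q (u₀ + t • (u - u₀)) = D'.eval t :=
      ⟨Polynomial.C 1 + Polynomial.X * Polynomial.C (QuadraticMap.polar Q (u - u₀) u₀) +
        Polynomial.X * Polynomial.X * Polynomial.C (Q (u - u₀)), fun t => by
          rw [QuadraticMap.map_add_smul, hu₀]; simp⟩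
    -- Each factor `u` is moved along the line from `u₀` to `u`. At `t = 0` the factors `u₀` cancel
    -- in pairs. `D` vanishes where some factor becomes isotropic; it is not zero because `Q u₀ =
    -- 1`.
    refine ⟨fun t => CliffordAlgebra.ι Q (u₀ + t • (u - u₀)) * γ t, D * D', fun φ => ?_, ?_, ?_,
      mul_ne_zero hD (fun h => ?_), fun t ht => ?_⟩
    · obtain ⟨f₁, hf₁⟩ := hγ (φ ∘ₗ LinearMap.mulLeft ℂ (CliffordAlgebra.ι Q u₀))
      obtain ⟨f₂, hf₂⟩ := hγ (φ ∘ₗ LinearMap.mulLeft ℂ (CliffordAlgebra.ι Q (u - u₀)))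
      refine ⟨f₁ + Polynomial.X * f₂, fun t => ?_⟩
      rw [Polynomial.eval_add, Polynomial.eval_mul, Polynomial.eval_X, ← hf₁, ← hf₂]
      change φ (CliffordAlgebra.ι Q (u₀ + t • (u - u₀)) * γ t) = _
      rw [map_add, map_smul, add_mul, map_add, smul_mul_assoc, map_smul]
      rfl
    · simp only [zero_smul, add_zero, h0]
      cases b <;> simp [ReflectionProduct.ι_mul_self_of_unit hu₀]
    · simp [h1]
    · have h2 := hQ 0
      rw [h] at h2
      simp [hu₀] at h2
    · rw [Polynomial.eval_mul, ← hQ] at ht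
      obtain ⟨c, S, h, hc, hh, hγt⟩ := hDt t (left_ne_zero_of_mul ht)
      obtain ⟨c', u', hc', hu', h'⟩ := exists_smul_unit Q (right_ne_zero_of_mul ht)
      refine ⟨c' * c, _, _, mul_ne_zero hc' hc, .cons u' hu' hh, ?_⟩
      change CliffordAlgebra.ι Q (u₀ + t • (u - u₀)) * γ t = _
      rw [h', hγt, map_smul, smul_mul_smul_comm]

namespace Polarization

variable [FiniteDimensional ℂ V] {Q : QuadraticForm ℂ V} {P : Polarization Q} {k : ℕ}

theorem exists_multihomogeneous_of_isOpen {U : Set (Fin k → P.SpinorVariety)}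
    (hU : IsOpen[P.zariski k] U) {x : Fin k → P.SpinorVariety} (hx : x ∈ U) :
    ∃ p : (Fin k → P.Spinor) → ℂ, p ∈ polyFunctionsPow k P.Spinor ∧ IsMultihomogeneous p ∧
      p (fun i => (x i : ℙ ℂ P.Spinor).rep) ≠ 0 ∧
      ∀ y : Fin k → P.SpinorVariety, p (fun i => (y i : ℙ ℂ P.Spinor).rep) ≠ 0 → y ∈ U := by
  obtain ⟨O, ⟨I, hI, hO⟩, rfl⟩ := hU
  have hmem : ∀ y : Fin k → P.SpinorVariety, (fun i => (y i : ℙ ℂ P.Spinor)) ∈ O ↔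
      ∃ p ∈ I, p (fun i => (y i : ℙ ℂ P.Spinor).rep) ≠ 0 := fun y => by
    rw [← not_iff_not, ← Set.mem_compl_iff, hO]
    simp [multiprojectiveZeroLocus]
  obtain ⟨p, hp, hpx⟩ := (hmem x).mp hx
  exact ⟨p, (hI p hp).1, (hI p hp).2, hpx, fun y hy => (hmem y).mpr ⟨p, hp, hy⟩⟩

/-- Products of copies of the spinor variety are irreducible. -/
theorem inter_nonempty_of_isOpen {u₀ : V} (hu₀ : Q u₀ = 1) {U₁ U₂ : Set (Fin k → P.SpinorVariety)}
    (hU₁ : IsOpen[P.zariski k] U₁) (hU₂ : IsOpen[P.zariski k] U₂) (h₁ : U₁.Nonempty)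
    (h₂ : U₂.Nonempty) : (U₁ ∩ U₂).Nonempty := by
  obtain ⟨x, hx⟩ := h₁
  obtain ⟨y, hy⟩ := h₂
  obtain ⟨p₁, hp₁, hom₁, hx₁, hU₁⟩ := exists_multihomogeneous_of_isOpen hU₁ hx
  obtain ⟨p₂, hp₂, hom₂, hy₂, hU₂⟩ := exists_multihomogeneous_of_isOpen hU₂ hy
  -- In each factor, a curve moves `x i` to `y i` through points of `S₊`, away from the zeros of
  -- `D`; the parameter `t` is common to all factors.
  have hcurve : ∀ i, ∃ (γ : ℂ → CliffordAlgebra Q) (D : Polynomial ℂ),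
      (∀ φ : Module.Dual ℂ (CliffordAlgebra Q), ∃ f : Polynomial ℂ, ∀ t, φ (γ t) = f.eval t) ∧
      γ 0 = 1 ∧ ℂ ∙ (P.spinRep (γ 1) (x i : ℙ ℂ P.Spinor).rep) =
        ℂ ∙ (y i : ℙ ℂ P.Spinor).rep ∧ D ≠ 0 ∧
      ∀ t, D.eval t ≠ 0 → ∃ z : P.SpinorVariety, ℂ ∙ (z : ℙ ℂ P.Spinor).rep =
        ℂ ∙ (P.spinRep (γ t) (x i : ℙ ℂ P.Spinor).rep) := by
    intro i
    obtain ⟨g, hg⟩ := exists_smul_basePoint (x i)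
    obtain ⟨g', hg'⟩ := exists_smul_basePoint (y i)
    have hgg : (g' * g⁻¹) • x i = y i := by
      rw [← hg, ← hg', smul_smul, inv_mul_cancel_right]
    obtain ⟨c, T, h, hc, hh, hch⟩ := exists_reflectionProduct_of_mem_spinGroup (g' * g⁻¹).2
    have hc0 : c ≠ 0 := left_ne_zero_of_mul (hc.trans_ne one_ne_zero)
    obtain ⟨γ, D, hγ, h0, h1, hD, hDt⟩ := hh.exists_curve hu₀
    have hsp : ∀ (c : ℂ), c ≠ 0 → ∀ (a : CliffordAlgebra Q) (w : P.Spinor),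
        ℂ ∙ (P.spinRep (c • a) w) = ℂ ∙ (P.spinRep a w) := fun c hc a w => by
      rw [map_smul, LinearMap.smul_apply]
      exact Submodule.span_singleton_smul_eq hc.isUnit _
    refine ⟨γ, D, hγ, by simpa using h0, ?_, hD, fun t ht => ?_⟩
    · rw [← Projectivization.submodule_eq, ← hgg, h1]
      change _ = ((g' * g⁻¹) • (x i : ℙ ℂ P.Spinor)).submodule
      rw [submodule_smul, hch, hsp c hc0]
    · obtain ⟨c', S, h', hc', hh', hγt⟩ := hDt t ht
      refine ⟨(⟨h', hh'.mem_spinGroup⟩ : spinGroup Q) • x i, ?_⟩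
      rw [← Projectivization.submodule_eq, hγt, hsp c' hc']
      exact submodule_smul (⟨h', hh'.mem_spinGroup⟩ : spinGroup Q) (x i : ℙ ℂ P.Spinor)
  choose γ D hγ h0 h1 hD hDt using hcurve
  let w : ℂ → Fin k → P.Spinor := fun t i => P.spinRep (γ i t) (x i : ℙ ℂ P.Spinor).rep
  have hw : ∀ i (φ : Module.Dual ℂ P.Spinor), ∃ f : Polynomial ℂ, ∀ t, φ (w t i) = f.eval t :=
    fun i φ => hγ i (φ ∘ₗ LinearMap.applyₗ (x i : ℙ ℂ P.Spinor).rep ∘ₗ P.spinRep.toLinearMap)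
  obtain ⟨f₁, hf₁⟩ := polyFunctionsPow.exists_polynomial_of_curve hp₁ hw
  obtain ⟨f₂, hf₂⟩ := polyFunctionsPow.exists_polynomial_of_curve hp₂ hw
  have hw0 : w 0 = fun i => (x i : ℙ ℂ P.Spinor).rep := by
    funext i
    simp only [w, h0, map_one]
    rfl
  have hf₁0 : f₁ ≠ 0 := by
    rintro rfl
    have := hf₁ 0
    rw [hw0, Polynomial.eval_zero] at this
    exact hx₁ this
  have hf₂0 : f₂ ≠ 0 := by
    rintro rfl
    have := hf₂ 1
    rw [Polynomial.eval_zero] at this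
    exact (hom₂.ne_zero_iff (h1 ·)).mpr hy₂ this
  -- `f₁` is nonzero at `0` and `f₂` at `1`; a parameter where no factor of this product vanishes
  -- gives a point of both open sets.
  have hprod : f₁ * f₂ * ∏ i, D i ≠ 0 :=
    mul_ne_zero (mul_ne_zero hf₁0 hf₂0) (Finset.prod_ne_zero_iff.mpr fun i _ => hD i)
  obtain ⟨t, ht⟩ : ∃ t, (f₁ * f₂ * ∏ i, D i).eval t ≠ 0 := by
    by_contra! h
    exact hprod (Polynomial.funext fun t => by rw [h t, Polynomial.eval_zero])
  rw [Polynomial.eval_mul, Polynomial.eval_mul, Polynomial.eval_prod] at ht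
  have hDi : ∀ i, (D i).eval t ≠ 0 := fun i =>
    Finset.prod_ne_zero_iff.mp (right_ne_zero_of_mul ht) i (Finset.mem_univ i)
  choose z hz using fun i => hDt i t (hDi i)
  refine ⟨z, hU₁ z ?_, hU₂ z ?_⟩
  · rw [hom₁.ne_zero_iff hz, hf₁]
    exact left_ne_zero_of_mul (left_ne_zero_of_mul ht)
  · rw [hom₂.ne_zero_iff hz, hf₂]
    exact right_ne_zero_of_mul (left_ne_zero_of_mul ht)

theorem dense_of_isOpen {u₀ : V} (hu₀ : Q u₀ = 1) {U : Set (Fin k → P.SpinorVariety)}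
    (hU : IsOpen[P.zariski k] U) (hne : U.Nonempty) : @Dense _ (P.zariski k) U := by
  let := P.zariski k
  rw [dense_iff_inter_open]
  intro U' hU' hne'
  exact inter_nonempty_of_isOpen hu₀ hU' hU hne' hne

/-- The injectivity of a system of linear conditions "`A i m` annihilates the `i`-th spinor" is
an open condition. -/
theorem isOpen_setOf_injective {M : Type*} [AddCommGroup M] [Module ℂ M] [FiniteDimensional ℂ M]
    (A : Fin k → M →ₗ[ℂ] V) (B : Module.Dual ℂ M) :
    IsOpen[P.zariski k] {x | ∀ m, (∀ i, A i m ∈ P.isotropicSpace (x i)) → B m = 0 → m = 0} := by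
  -- The rows of the system are all coordinates of all the conditions, with `none` for the extra
  -- form `B`. They depend linearly on one spinor, respectively on none.
  let row : (Fin k → P.Spinor) → Option (Fin k × Module.Dual ℂ P.Spinor) → Module.Dual ℂ M :=
    fun w r => r.elim B fun r => r.2 ∘ₗ LinearMap.applyₗ (w r.1) ∘ₗ P.spinRep.toLinearMap ∘ₗ
      CliffordAlgebra.ι Q ∘ₗ A r.1
  have hrow : ∀ w i φ m, row w (some (i, φ)) m =
      φ (P.spinRep (CliffordAlgebra.ι Q (A i m)) (w i)) := fun _ _ _ _ => rfl
  let Inj : (Fin k → P.Spinor) → Prop := fun w =>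
    ∀ m, (∀ i, P.spinRep (CliffordAlgebra.ι Q (A i m)) (w i) = 0) → B m = 0 → m = 0
  have hInj : ∀ w, Inj w ↔ ∀ m, (∀ r, row w r m = 0) → m = 0 := by
    intro w
    refine forall_congr' fun m => ⟨fun h hr => h (fun i => ?_) (hr none), fun h h1 h2 => h ?_⟩
    · exact (Module.forall_dual_apply_eq_zero_iff ℂ _).mp fun φ => hr (some (i, φ))
    · rintro (_ | ⟨i, φ⟩)
      · exact h2
      · rw [hrow, h1, map_zero]
  -- Any multihomogeneous polynomial whose nonvanishing forces injectivity is admitted. It remains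
  -- to find, for each injective system, one such polynomial not vanishing there: a maximal minor.
  let I : Set ((Fin k → P.Spinor) → ℂ) := {p | (p ∈ polyFunctionsPow k P.Spinor ∧
    IsMultihomogeneous p) ∧ ∀ w, p w ≠ 0 → Inj w}
  have hI : ∀ w, Inj w → ∃ p ∈ I, p w ≠ 0 := by
    intro w hw
    rw [hInj] at hw
    let b := Module.finBasis ℂ M
    set d := Module.finrank ℂ M
    have hspan : Submodule.span ℂ (Set.range (row w)) = ⊤ := by
      by_contra hne
      obtain ⟨ψ, hψ, hle⟩ := Submodule.exists_le_ker_of_lt_top _ (lt_top_iff_ne_top.mpr hne)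
      obtain ⟨m, rfl⟩ := (Module.evalEquiv ℂ M).surjective ψ
      have hm : m = 0 := hw m fun r => hle (Submodule.subset_span ⟨r, rfl⟩)
      exact hψ (by rw [hm, map_zero])
    obtain ⟨κ, a, -, hsp, hli⟩ := exists_linearIndependent' ℂ (row w)
    rw [hspan] at hsp
    let c : Module.Basis κ ℂ (Module.Dual ℂ M) := Module.Basis.mk hli hsp.ge
    have : Fintype κ := FiniteDimensional.fintypeBasisIndex c
    have hcard : Fintype.card (Fin d) = Fintype.card κ := by
      rw [Fintype.card_fin, ← Module.finrank_eq_card_basis c, Subspace.dual_finrank_eq]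
    let e : Fin d ≃ κ := Fintype.equivOfCardEq hcard
    let r : Fin d → Option (Fin k × Module.Dual ℂ P.Spinor) := fun l => a (e l)
    let mat : (Fin k → P.Spinor) → Matrix (Fin d) (Fin d) ℂ :=
      fun w => Matrix.of fun l j => row w (r l) (b j)
    refine ⟨fun w => (mat w).det, ⟨⟨?_, ?_⟩, fun w' hw' => ?_⟩, ?_⟩
    · have : (fun w => (mat w).det) = ∑ σ : Equiv.Perm (Fin d),
          (Equiv.Perm.sign σ : ℤ) • ∏ i, fun w => mat w (σ i) i := by
        funext w
        rw [Matrix.det_apply, Finset.sum_apply]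
        refine Finset.sum_congr rfl fun σ _ => ?_
        rw [Pi.smul_apply, Finset.prod_apply]
        rfl
      rw [this]
      refine sum_mem fun σ _ => zsmul_mem (prod_mem fun i _ => ?_) _
      change (fun w => row w (r (σ i)) (b i)) ∈ _
      rcases r (σ i) with _ | ⟨j, φ⟩
      · exact algebraMap_mem (polyFunctionsPow k P.Spinor) (B (b i))
      · exact Algebra.subset_adjoin ⟨φ ∘ₗ P.spinRep (CliffordAlgebra.ι Q (A j (b i))) ∘ₗ
          LinearMap.proj j, rfl⟩
    -- The degree of the minor in the `i`-th spinor is the number of chosen rows coming from it.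
    · refine ⟨fun i => (Finset.univ.filter fun l => (r l).map Prod.fst = some i).card,
        fun c w => ?_⟩
      have h1 : mat (fun i => c i • w i) = Matrix.of fun l j =>
          (∏ i, if (r l).map Prod.fst = some i then c i else 1) * mat w l j := by
        ext l j
        simp only [mat, Matrix.of_apply]
        rcases r l with _ | ⟨i, φ⟩
        · simp [row]
        · simp [hrow]
      change (mat fun i => c i • w i).det = _ * (mat w).det
      rw [h1, Matrix.det_mul_column, Finset.prod_comm]
      congr 1
      refine Finset.prod_congr rfl fun i _ => ?_
      rw [Finset.prod_ite, Finset.prod_const, Finset.prod_const_one, mul_one]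
    · rw [hInj]
      intro m hm
      have h1 : (mat w').mulVec (b.repr m) = 0 := by
        funext l
        have h2 := hm (r l)
        rw [← b.sum_repr m, map_sum] at h2
        simpa [Matrix.mulVec, dotProduct, mat, mul_comm] using h2
      have h2 := Matrix.eq_zero_of_mulVec_eq_zero hw' h1
      exact b.repr.map_eq_zero_iff.mp (DFunLike.coe_injective h2)
    · have hli' : LinearIndependent ℂ (mat w).row := by
        have h1 : (mat w).row = (b.constr ℂ).symm ∘ (row w ∘ a) ∘ e := by
          funext l j
          simp [mat, r, Matrix.row]
        rw [h1]
        exact (hli.comp e e.injective).map' _ (LinearEquiv.ker _)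
      exact ((Matrix.isUnit_iff_isUnit_det _).mp
        (Matrix.linearIndependent_rows_iff_isUnit.mp hli')).ne_zero
  refine ⟨(multiprojectiveZeroLocus I)ᶜ, ⟨I, fun p hp => hp.1, compl_compl _⟩, ?_⟩
  ext x
  have h1 : x ∈ {x : Fin k → P.SpinorVariety | ∀ m, (∀ i, A i m ∈ P.isotropicSpace (x i)) →
      B m = 0 → m = 0} ↔ Inj (fun i => (x i : ℙ ℂ P.Spinor).rep) := by
    simp only [Set.mem_ofPred_eq, mem_isotropicSpace_iff_rep, Inj]
  rw [h1]
  constructor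
  · intro h
    have h2 : ¬ ∀ p ∈ I, p (fun i => (x i : ℙ ℂ P.Spinor).rep) = 0 := h
    push Not at h2
    obtain ⟨p, hp, hpx⟩ := h2
    exact hp.2 _ hpx
  · intro h h2
    obtain ⟨p, hp, hpx⟩ := hI _ h
    exact hpx (h2 p hp)

end Polarization

end

section

/-! ### Normal forms of triples of Lagrangian subspaces -/

/-- A hyperbolic pair is split off and the induction continues on its orthogonal complement, which
is why `M` is quantified after `m`. The normalization `ω (f i) (e i) = 1` matches the sign of
`Matrix.J`. -/
theorem exists_symplectic_family (m : ℕ) : ∀ {M : Type*} [AddCommGroup M] [Module ℂ M]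
    [FiniteDimensional ℂ M] (ω : LinearMap.BilinForm ℂ M), (∀ x, ω x x = 0) →
    (∀ x, (∀ y, ω x y = 0) → x = 0) → Module.finrank ℂ M = 2 * m →
    ∃ e f : Fin m → M, (∀ i j, ω (e i) (e j) = 0) ∧ (∀ i j, ω (f i) (f j) = 0) ∧
      ∀ i j, ω (f i) (e j) = if i = j then 1 else 0 := by
  induction m with
  | zero => 
    intro M _ _ _ ω _ _ _
    exact ⟨Fin.elim0, Fin.elim0, fun i => i.elim0, fun i => i.elim0, fun i => i.elim0⟩
  | succ m ih =>
    intro M _ _ _ ω halt hnd hrank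
    have hskew : ∀ x y, ω x y = -ω y x := fun x y => by
      have := halt (x + y)
      simp only [map_add, LinearMap.add_apply, halt, zero_add, add_zero] at this
      exact eq_neg_of_add_eq_zero_right this
    have hpos : 0 < Module.finrank ℂ M := by omega
    have : Nontrivial M := Module.finrank_pos_iff.mp hpos
    obtain ⟨x, hx⟩ := exists_ne (0 : M)
    obtain ⟨y, hy⟩ : ∃ y, ω y x = 1 := by
      by_contra! h
      apply hx
      apply hnd
      intro y
      by_contra hxy
      have h1 : ω y x ≠ 0 := by rw [hskew]; exact neg_ne_zero.mpr hxy
      apply h ((ω y x)⁻¹ • y)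
      rw [map_smul, LinearMap.smul_apply, smul_eq_mul, inv_mul_cancel₀ h1]
    let φ : M →ₗ[ℂ] ℂ × ℂ := (ω x).prod (ω y)
    have hφs : Function.Surjective φ := by
      rintro ⟨s, t⟩
      refine ⟨t • x - s • y, ?_⟩
      have hxy : ω x y = -1 := by rw [hskew, hy]
      simp [φ, halt, hy, hxy]
    let N := LinearMap.ker φ
    have hN : ∀ z : N, ω x z = 0 ∧ ω y z = 0 := fun z => by
      have h : φ z = 0 := LinearMap.mem_ker.mp z.2
      exact Prod.ext_iff.mp h
    have hNrank : Module.finrank ℂ N = 2 * m := by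
      have h1 := φ.finrank_range_add_finrank_ker
      rw [LinearMap.range_eq_top.mpr hφs, finrank_top, Module.finrank_prod,
        Module.finrank_self] at h1
      change 1 + 1 + Module.finrank ℂ N = _ at h1
      omega
    obtain ⟨e, f, he, hf, hef⟩ := ih (ω.domRestrict₁₂ N N) (fun z => halt z) (fun z hz => by
      apply Subtype.ext
      apply hnd
      intro w
      have hxy : ω x y = -1 := by rw [hskew, hy]
      have hmem : w - ω y w • x + ω x w • y ∈ N := by
        rw [LinearMap.mem_ker]
        simp [φ, halt, hy, hxy]
      have h1 : ω z (w - ω y w • x + ω x w • y) = 0 := hz ⟨_, hmem⟩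
      have h2 : ω z x = 0 := by rw [hskew, (hN z).1, neg_zero]
      have h3 : ω z y = 0 := by rw [hskew, (hN z).2, neg_zero]
      simpa [h2, h3] using h1) hNrank
    have he' : ∀ i j, ω (e i) (e j) = 0 := he
    have hf' : ∀ i j, ω (f i) (f j) = 0 := hf
    have hef' : ∀ i j, ω (f i) (e j) = if i = j then 1 else 0 := hef
    have hx2 : ∀ z : N, ω z x = 0 := fun z => by rw [hskew, (hN z).1, neg_zero]
    have hy2 : ∀ z : N, ω z y = 0 := fun z => by rw [hskew, (hN z).2, neg_zero]
    refine ⟨Fin.cons x fun i => (e i : M), Fin.cons y fun i => (f i : M), fun i j => ?_,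
      fun i j => ?_, fun i j => ?_⟩ <;>
    cases i using Fin.cases <;> cases j using Fin.cases <;>
    simp [halt, hy, hN, hx2, hy2, he', hf', hef', Fin.succ_ne_zero, (Fin.succ_ne_zero _).symm]

/-- The standard symplectic form. -/
def standardSymplectic (m : ℕ) : LinearMap.BilinForm ℂ (Fin m ⊕ Fin m → ℂ) :=
  Matrix.toBilin' (Matrix.J (Fin m) ℂ)

theorem standardSymplectic_apply (m : ℕ) (x y : Fin m ⊕ Fin m → ℂ) :
    standardSymplectic m x y =
      ∑ i, x (.inr i) * y (.inl i) - ∑ i, x (.inl i) * y (.inr i) := by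
  rw [standardSymplectic, Matrix.toBilin'_apply', Matrix.J, Matrix.fromBlocks_mulVec]
  simp [dotProduct, sub_eq_add_neg, add_comm, Matrix.neg_mulVec]

theorem standardSymplectic_neg (m : ℕ) (x y : Fin m ⊕ Fin m → ℂ) :
    standardSymplectic m x y = -standardSymplectic m y x := by
  rw [standardSymplectic_apply, standardSymplectic_apply]
  simp [mul_comm]

theorem standardSymplectic_separating (m : ℕ) (x : Fin m ⊕ Fin m → ℂ)
    (hx : ∀ y, standardSymplectic m x y = 0) : x = 0 := by
  funext i
  rcases i with i | i
  · have := hx (Pi.single (.inr i) 1)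
    simpa [standardSymplectic_apply, Pi.single_apply] using this
  · have := hx (Pi.single (.inl i) 1)
    simpa [standardSymplectic_apply, Pi.single_apply] using this

theorem exists_symplectic_equiv {m : ℕ} {M : Type*} [AddCommGroup M] [Module ℂ M]
    [FiniteDimensional ℂ M] (ω : LinearMap.BilinForm ℂ M) (halt : ∀ x, ω x x = 0)
    (hnd : ∀ x, (∀ y, ω x y = 0) → x = 0) (hrank : Module.finrank ℂ M = 2 * m) :
    ∃ β : (Fin m ⊕ Fin m → ℂ) ≃ₗ[ℂ] M, ∀ x y, ω (β x) (β y) = standardSymplectic m x y := by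
  obtain ⟨e, f, he, hf, hfe⟩ := exists_symplectic_family m ω halt hnd hrank
  have hef : ∀ i j, ω (e i) (f j) = if i = j then -1 else 0 := fun i j => by
    have := halt (e i + f j)
    simp only [map_add, LinearMap.add_apply, halt, zero_add, add_zero, hfe] at this
    rw [eq_neg_of_add_eq_zero_right this]
    by_cases h : i = j
    · rw [if_pos h, if_pos h.symm]
    · rw [if_neg h, if_neg (Ne.symm h), neg_zero]
  let β₀ : (Fin m ⊕ Fin m → ℂ) →ₗ[ℂ] M := Fintype.linearCombination ℂ (Sum.elim e f)
  have hβ₀ : ∀ x, β₀ x = ∑ i, x (.inl i) • e i + ∑ i, x (.inr i) • f i := fun x => by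
    simp [β₀, Fintype.linearCombination_apply]
  have hω : ∀ x y, ω (β₀ x) (β₀ y) = standardSymplectic m x y := fun x y => by
    simp [hβ₀, standardSymplectic_apply, he, hf, hef, hfe, map_sum, LinearMap.sum_apply]
    simp only [mul_comm]
    ring
  obtain ⟨β, hβ⟩ := exists_linearEquiv_of_form β₀ (fun x y => ω x y) (fun y => by simp)
    (fun x hx => standardSymplectic_separating m x fun y => (hω x y).symm.trans (hx y))
    (by rw [hrank]; simp [two_mul])
  exact ⟨β, fun x y => by rw [hβ, hβ, hω]⟩

/-- The index set of the three hyperbolic planes: empty unless `ε` holds. -/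
abbrev TripleIndex (ε : Prop) : Type := {_j : Fin 3 // ε}

/-- The coordinate space adapted to a triple of Lagrangian subspaces: hyperbolic planes indexed by
the three subspaces when `ε` holds, and two copies of a symplectic space. -/
abbrev TripleModel (ε : Prop) (m : ℕ) : Type :=
  ((TripleIndex ε → ℂ) × (TripleIndex ε → ℂ)) ×
    ((Fin m ⊕ Fin m → ℂ) × (Fin m ⊕ Fin m → ℂ))

namespace TripleModel

variable {ε : Prop} [Decidable ε] {m : ℕ}

/-- The symmetric bilinear form on the coordinate space. -/
def form (x y : TripleModel ε m) : ℂ :=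
  ∑ j, x.1.1 j * y.1.2 j + ∑ j, x.1.2 j * y.1.1 j +
    (standardSymplectic m x.2.2 y.2.1 + standardSymplectic m y.2.2 x.2.1)

/-- The three standard Lagrangian subspaces of the coordinate space. -/
def Mem (i : Fin 3) (x : TripleModel ε m) : Prop :=
  (∀ j : TripleIndex ε, if (j : Fin 3) = i then x.1.1 j = 0 else x.1.2 j = 0) ∧
    ![x.2.2 = 0, x.2.1 = 0, x.2.1 = x.2.2] i

theorem eq_zero_of_form_eq_zero (x : TripleModel ε m) (hx : ∀ y, form x y = 0) : x = 0 := by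
  have h1 : x.1.1 = 0 := funext fun j => by
    simpa [form, Pi.single_apply] using hx ((0, Pi.single j 1), 0)
  have h2 : x.1.2 = 0 := funext fun j => by
    simpa [form, Pi.single_apply] using hx ((Pi.single j 1, 0), 0)
  have h3 : x.2.2 = 0 := standardSymplectic_separating m _ fun y => by
    simpa [form] using hx (0, (y, 0))
  have h4 : x.2.1 = 0 := standardSymplectic_separating m _ fun y => by
    rw [standardSymplectic_neg]
    simpa [form] using hx (0, (0, y))
  exact Prod.ext (Prod.ext h1 h2) (Prod.ext h4 h3)

/-- The standard subspaces contain their orthogonals. This turns one inclusion between Lagrangian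
subspaces and standard ones into an equality. -/
theorem mem_of_form_eq_zero (i : Fin 3) (x : TripleModel ε m)
    (hx : ∀ y, Mem i y → form x y = 0) : Mem i x := by
  refine ⟨fun j => ?_, ?_⟩
  · split_ifs with hj
    · have h := hx ((0, Pi.single j 1), 0) ⟨fun j' => by
        by_cases h : (j' : Fin 3) = i
        · simp [h]
        · have : j' ≠ j := by rintro rfl; exact h hj
          simp [h, this], by fin_cases i <;> simp⟩
      simpa [form, Pi.single_apply] using h
    · have h := hx ((Pi.single j 1, 0), 0) ⟨fun j' => by
        by_cases h : (j' : Fin 3) = i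
        · have : j' ≠ j := by rintro rfl; exact hj h
          simp [h, this]
        · simp [h], by fin_cases i <;> simp⟩
      simpa [form, Pi.single_apply] using h
  · fin_cases i
    · refine standardSymplectic_separating m _ fun y => ?_
      simpa [form] using hx (0, (y, 0)) ⟨by simp, by simp⟩
    · refine standardSymplectic_separating m _ fun y => ?_
      rw [standardSymplectic_neg]
      simpa [form] using hx (0, (0, y)) ⟨by simp, by simp⟩
    · refine sub_eq_zero.mp (standardSymplectic_separating m _ fun y => ?_)
      have h := hx (0, (y, y)) ⟨by simp, by simp⟩
      rw [map_sub, LinearMap.sub_apply, standardSymplectic_neg m x.2.1]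
      have h2 : standardSymplectic m x.2.2 y + standardSymplectic m y x.2.1 = 0 := by
        simpa [form] using h
      linear_combination -h2

end TripleModel

/-- A frame: coordinates in which a triple of subspaces is in normal form. -/
structure IsTripleFrame {ε : Prop} [Decidable ε] {m : ℕ} (Q : QuadraticForm ℂ V)
    (H : Fin 3 → Submodule ℂ V) (θ : TripleModel ε m ≃ₗ[ℂ] V) : Prop where
  polar_eq : ∀ x y, QuadraticMap.polar Q (θ x) (θ y) = TripleModel.form x y
  mem_iff : ∀ i x, θ x ∈ H i ↔ TripleModel.Mem i x

/-- Bijectivity follows from the nondegeneracy of the model form, and the reverse inclusions from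
`mem_of_form_eq_zero`. So a frame only has to be constructed as a linear map with one inclusion for
each subspace. -/
theorem exists_tripleFrame [FiniteDimensional ℂ V] {ε : Prop} [Decidable ε] {m : ℕ}
    {Q : QuadraticForm ℂ V} {H : Fin 3 → Submodule ℂ V} (hH : ∀ i, IsLagrangian Q (H i))
    (θ : TripleModel ε m →ₗ[ℂ] V)
    (hθ : ∀ x y, QuadraticMap.polar Q (θ x) (θ y) = TripleModel.form x y)
    (hmem : ∀ i x, TripleModel.Mem i x → θ x ∈ H i)
    (hrank : Module.finrank ℂ (TripleModel ε m) = Module.finrank ℂ V) :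
    ∃ θ : TripleModel ε m ≃ₗ[ℂ] V, IsTripleFrame Q H θ := by
  obtain ⟨θ', hθ'⟩ := exists_linearEquiv_of_form θ (QuadraticMap.polar Q)
    (fun y => QuadraticMap.polar_zero_left Q y)
    (fun x hx => TripleModel.eq_zero_of_form_eq_zero x fun y => (hθ x y).symm.trans (hx y)) hrank
  refine ⟨θ', fun x y => by rw [hθ', hθ', hθ], fun i x => ⟨fun h => ?_, fun h => ?_⟩⟩
  · refine TripleModel.mem_of_form_eq_zero i x fun y hy => ?_
    rw [← hθ, ← hθ']
    exact (hH i).polar_eq_zero h (hmem i y hy)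
  · rw [hθ']; exact hmem i x h

/-- Normal form of three pairwise transversal Lagrangian subspaces. -/
theorem exists_tripleFrame_of_disjoint [FiniteDimensional ℂ V] {m : ℕ} {Q : QuadraticForm ℂ V}
    (hQ : Q.Nondegenerate) {H : Fin 3 → Submodule ℂ V} (hH : ∀ i, IsLagrangian Q (H i))
    (hdisj : ∀ i j, i ≠ j → Disjoint (H i) (H j)) (hrank : Module.finrank ℂ V = 4 * m) :
    ∃ θ : TripleModel False m ≃ₗ[ℂ] V, IsTripleFrame Q H θ := by
  have hHr : ∀ i, Module.finrank ℂ (H i) = 2 * m := fun i => by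
    have := (hH i).finrank hQ
    omega
  have hcompl : ∀ i j, i ≠ j → IsCompl (H i) (H j) := fun i j hij => by
    refine ⟨hdisj i j hij, ?_⟩
    rw [codisjoint_iff]
    apply Submodule.eq_top_of_finrank_eq
    have h1 := Submodule.finrank_sup_add_finrank_inf_eq (H i) (H j)
    rw [(hdisj i j hij).eq_bot, finrank_bot, hHr, hHr] at h1
    omega
  have h01 := hcompl 0 1 (by decide)
  let π₀ : H 2 →ₗ[ℂ] V := (H 0).subtype ∘ₗ (H 0).projectionOnto (H 1) h01 ∘ₗ (H 2).subtype
  let π₁ : H 2 →ₗ[ℂ] V := (H 1).subtype ∘ₗ (H 1).projectionOnto (H 0) h01.symm ∘ₗ (H 2).subtype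
  have hπ : ∀ x, π₀ x + π₁ x = x := fun x =>
    Submodule.projection_add_projection_eq_self h01 (x : V)
  have hπ₀ : ∀ x, π₀ x ∈ H 0 := fun x => Submodule.coe_mem _
  have hπ₁ : ∀ x, π₁ x ∈ H 1 := fun x => Submodule.coe_mem _
  -- For `x ∈ H 2` with components `π₀ x` and `π₁ x`, isotropy of all three vectors reduces `Q x =
  -- 0` to `ω x x = 0`.
  let ω : LinearMap.BilinForm ℂ (H 2) := Q.polarBilin.compl₁₂ π₁ π₀
  have hω : ∀ x y, ω x y = QuadraticMap.polar Q (π₁ x) (π₀ y) := fun _ _ => rfl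
  have halt : ∀ x, ω x x = 0 := fun x => by
    have h1 := (hH 2).map_eq_zero x.2
    rw [← hπ, QuadraticMap.map_add (⇑Q), (hH 0).map_eq_zero (hπ₀ x), (hH 1).map_eq_zero (hπ₁ x),
      add_zero, zero_add, QuadraticMap.polar_comm] at h1
    exact h1
  -- If `x` is in the kernel, `π₁ x` is orthogonal to `H 1` and `H 2`, which span `V`. So `π₁ x =
  -- 0`, and `x = π₀ x` lies in `H 0 ∩ H 2 = 0`.
  have hnd : ∀ x, (∀ y, ω x y = 0) → x = 0 := by
    intro x hx
    have h1 : π₁ x = 0 := by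
      apply polar_separating hQ
      intro w
      obtain ⟨u, hu, v, hv, rfl⟩ := Submodule.mem_sup.mp
        ((hcompl 1 2 (by decide)).sup_eq_top.symm ▸ Submodule.mem_top : w ∈ H 1 ⊔ H 2)
      rw [QuadraticMap.polar_add_right, (hH 1).polar_eq_zero (hπ₁ x) hu, zero_add]
      have h2 := hx ⟨v, hv⟩
      have h3 := hπ ⟨v, hv⟩
      change _ = v at h3
      rw [← h3, QuadraticMap.polar_add_right, (hH 1).polar_eq_zero (hπ₁ x) (hπ₁ _), add_zero]
      exact h2
    have h2 := hπ x
    rw [h1, add_zero] at h2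
    exact Subtype.ext (Submodule.disjoint_def.mp (hdisj 0 2 (by decide)) x (h2 ▸ hπ₀ x) x.2)
  obtain ⟨β, hβ⟩ := exists_symplectic_equiv ω halt hnd (hHr 2)
  refine exists_tripleFrame hH
    ((π₀ ∘ₗ β.toLinearMap).coprod (π₁ ∘ₗ β.toLinearMap) ∘ₗ LinearMap.snd ℂ _ _) ?_ ?_ ?_
  · intro x y
    have h1 : ∀ a b, QuadraticMap.polar Q (π₁ (β a)) (π₀ (β b)) = standardSymplectic m a b :=
      fun a b => hβ a b
    have h2 : ∀ a b, QuadraticMap.polar Q (π₀ (β a)) (π₁ (β b)) = standardSymplectic m b a :=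
      fun a b => by rw [QuadraticMap.polar_comm, h1]
    have h3 : ∀ a b, QuadraticMap.polar Q (π₀ (β a)) (π₀ (β b)) = 0 :=
      fun a b => (hH 0).polar_eq_zero (hπ₀ _) (hπ₀ _)
    have h4 : ∀ a b, QuadraticMap.polar Q (π₁ (β a)) (π₁ (β b)) = 0 :=
      fun a b => (hH 1).polar_eq_zero (hπ₁ _) (hπ₁ _)
    simp [TripleModel.form, QuadraticMap.polar_add_left, QuadraticMap.polar_add_right, h1, h2, h3,
      h4, add_comm]
  · rintro i ⟨pq, a, b⟩ ⟨-, hx⟩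
    fin_cases i
    · have hb : b = 0 := hx
      simpa [hb] using hπ₀ (β a)
    · have ha : a = 0 := hx
      simpa [ha] using hπ₁ (β b)
    · have hab : a = b := hx
      have := hπ (β b)
      simp only [hab, LinearMap.comp_apply, LinearMap.snd_apply, LinearMap.coprod_apply]
      change π₀ (β b) + π₁ (β b) ∈ H 2
      rw [this]
      exact (β b).2
  · rw [hrank]
    simp
    ring

end

/-! ### Triples meeting pairwise in lines: reduction to the transversal case -/

section

/-- Normal form of three Lagrangian subspaces that meet pairwise in lines, but have no common
line. -/
theorem exists_tripleFrame_of_lines [FiniteDimensional ℂ V] {m : ℕ} {Q : QuadraticForm ℂ V}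
    (hQ : Q.Nondegenerate) {H : Fin 3 → Submodule ℂ V} (hH : ∀ i, IsLagrangian Q (H i))
    (hne : ∀ i j, ¬ Disjoint (H i) (H j))
    (hline : ∀ i j, i ≠ j → ∃ φ : Module.Dual ℂ V, ∀ v ∈ H i, v ∈ H j → φ v = 0 → v = 0)
    (htriple : ∀ v, (∀ i, v ∈ H i) → v = 0) (hrank : Module.finrank ℂ V = 4 * m + 6) :
    ∃ θ : TripleModel True m ≃ₗ[ℂ] V, IsTripleFrame Q H θ := by
  have hthird : ∀ k : Fin 3, ∃ i j : Fin 3, i ≠ j ∧ i ≠ k ∧ j ≠ k ∧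
      ∀ l, l ≠ k → l = i ∨ l = j := by decide
  have hother : ∀ i j : Fin 3, ∃ k, i ≠ k ∧ j ≠ k := by decide
  have ha : ∀ k, ∃ a : V, a ≠ 0 ∧ ∀ i, i ≠ k → a ∈ H i := fun k => by
    obtain ⟨i, j, -, -, -, hl⟩ := hthird k
    have h := hne i j
    rw [Submodule.disjoint_def] at h
    push Not at h
    obtain ⟨a, hai, haj, ha0⟩ := h
    refine ⟨a, ha0, fun l hlk => ?_⟩
    rcases hl l hlk with rfl | rfl
    exacts [hai, haj]
  choose a ha0 ha using ha
  -- `a k` lies in the two subspaces other than `H k`. If it were orthogonal to `H k`, it would lie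
  -- in all three.
  have hb : ∀ k, ∃ b ∈ H k, QuadraticMap.polar Q (a k) b = 1 := fun k => by
    by_contra! h
    refine ha0 k (htriple _ fun i => ?_)
    by_cases hik : i = k
    · subst hik
      refine (hH i _).mpr fun w hw => ?_
      by_contra h0
      refine h _ ((H i).smul_mem (QuadraticMap.polar Q (a i) w)⁻¹ hw) ?_
      rw [QuadraticMap.polar_smul_right, smul_eq_mul, inv_mul_cancel₀ h0]
    · exact ha k i hik
  choose b hb hab using hb
  have haa : ∀ i j, QuadraticMap.polar Q (a i) (a j) = 0 := fun i j => by
    obtain ⟨k, hki, hkj⟩ := hother i j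
    exact (hH k).polar_eq_zero (ha i k hki.symm) (ha j k hkj.symm)
  have hab' : ∀ i j, QuadraticMap.polar Q (a i) (b j) = if i = j then 1 else 0 := fun i j => by
    split_ifs with h
    · subst h; exact hab i
    · exact (hH j).polar_eq_zero (ha i j (Ne.symm h)) (hb j)
  have hba' : ∀ i j, QuadraticMap.polar Q (b i) (a j) = if i = j then 1 else 0 := fun i j => by
    rw [QuadraticMap.polar_comm, hab']; simp [eq_comm]
  -- The correction makes the `c j` mutually orthogonal: each of `i`, `j` contributes half of `polar
  -- Q (b i) (b j)`. It keeps `c j` in `H j`, because the coefficient of the only `a k` outside `H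
  -- j`, namely `a j`, is zero.
  let c : Fin 3 → V := fun j =>
    b j - (2⁻¹ : ℂ) • ∑ k, QuadraticMap.polar Q (b j) (b k) • a k
  have hcH : ∀ j, c j ∈ H j := fun j => by
    refine sub_mem (hb j) (Submodule.smul_mem _ _ (Submodule.sum_mem _ fun k _ => ?_))
    by_cases hk : j = k
    · subst hk
      rw [(hH j).polar_eq_zero (hb j) (hb j), zero_smul]
      exact zero_mem _
    · exact Submodule.smul_mem _ _ (ha k j hk)
  have hac : ∀ i j, QuadraticMap.polar Q (a i) (c j) = if i = j then 1 else 0 := fun i j => by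
    simp [c, QuadraticMap.polar_sub_right, QuadraticMap.polar_smul_right,
      QuadraticMap.polar_sum_right, haa, hab']
  have hca : ∀ i j, QuadraticMap.polar Q (c i) (a j) = if i = j then 1 else 0 := fun i j => by
    rw [QuadraticMap.polar_comm, hac]; simp [eq_comm]
  have hcc : ∀ i j, QuadraticMap.polar Q (c i) (c j) = 0 := fun i j => by
    simp [c, QuadraticMap.polar_sub_right, QuadraticMap.polar_sub_left,
      QuadraticMap.polar_smul_right, QuadraticMap.polar_smul_left, QuadraticMap.polar_sum_left,
      QuadraticMap.polar_sum_right, haa, hab', hba']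
    rw [QuadraticMap.polar_comm Q (b j) (b i)]
    ring
  let φ : V →ₗ[ℂ] (Fin 3 → ℂ) × (Fin 3 → ℂ) :=
    (LinearMap.pi fun j => Q.polarBilin (a j)).prod (LinearMap.pi fun j => Q.polarBilin (c j))
  have hφs : Function.Surjective φ := by
    rintro ⟨s, t⟩
    refine ⟨∑ j, s j • c j + ∑ j, t j • a j, ?_⟩
    refine Prod.ext (funext fun j => ?_) (funext fun j => ?_)
    · change QuadraticMap.polar Q (a j) _ = s j
      simp [QuadraticMap.polar_add_right, QuadraticMap.polar_sum_right,
        QuadraticMap.polar_smul_right, haa, hac]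
    · change QuadraticMap.polar Q (c j) _ = t j
      simp [QuadraticMap.polar_add_right, QuadraticMap.polar_sum_right,
        QuadraticMap.polar_smul_right, hca, hcc]
  let N := LinearMap.ker φ
  have hNmem : ∀ v, v ∈ N ↔ ∀ j, QuadraticMap.polar Q (a j) v = 0 ∧
      QuadraticMap.polar Q (c j) v = 0 := fun v => by
    rw [LinearMap.mem_ker, Prod.ext_iff, funext_iff, funext_iff, forall_and]
    rfl
  have hNrank : Module.finrank ℂ N = 4 * m := by
    have h1 := φ.finrank_range_add_finrank_ker
    rw [LinearMap.range_eq_top.mpr hφs, finrank_top, Module.finrank_prod,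
      Module.finrank_fintype_fun_eq_card, Fintype.card_fin, hrank] at h1
    change 3 + 3 + Module.finrank ℂ N = _ at h1
    omega
  -- The orthogonal projection onto `N`. It preserves each `H i`, since a coefficient vanishes
  -- whenever the corresponding `a j` or `c j` is not in `H i`; hence the `H i ∩ N` are Lagrangian
  -- in `N`.
  let π : V → V := fun v => v - ∑ j, QuadraticMap.polar Q (c j) v • a j -
    ∑ j, QuadraticMap.polar Q (a j) v • c j
  have hπN : ∀ v, π v ∈ N := fun v => by
    rw [hNmem]
    intro j
    constructor <;>
    simp [π, QuadraticMap.polar_sub_right, QuadraticMap.polar_sum_right,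
        QuadraticMap.polar_smul_right, haa, hac, hca, hcc]
  have hπH : ∀ i, ∀ v ∈ H i, π v ∈ H i := fun i v hv => by
    refine sub_mem (sub_mem hv (Submodule.sum_mem _ fun j _ => ?_))
      (Submodule.sum_mem _ fun j _ => ?_) <;> by_cases hij : i = j
    · subst hij
      rw [(hH i).polar_eq_zero (hcH i) hv, zero_smul]
      exact zero_mem _
    · exact Submodule.smul_mem _ _ (ha j i hij)
    · subst hij
      exact Submodule.smul_mem _ _ (hcH i)
    · rw [(hH i).polar_eq_zero (ha j i hij) hv, zero_smul]
      exact zero_mem _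
  have hπpol : ∀ v ∈ N, ∀ w, QuadraticMap.polar Q v w = QuadraticMap.polar Q v (π w) := by
    intro v hv w
    rw [hNmem] at hv
    have h1 : ∀ j, QuadraticMap.polar Q v (a j) = 0 := fun j => by
      rw [QuadraticMap.polar_comm]; exact (hv j).1
    have h2 : ∀ j, QuadraticMap.polar Q v (c j) = 0 := fun j => by
      rw [QuadraticMap.polar_comm]; exact (hv j).2
    simp [π, QuadraticMap.polar_sub_right, QuadraticMap.polar_sum_right,
      QuadraticMap.polar_smul_right, h1, h2]
  let QN : QuadraticForm ℂ N := Q.comp N.subtype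
  have hpolN : ∀ v w : N, QuadraticMap.polar QN v w = QuadraticMap.polar Q (v : V) (w : V) :=
    fun v w => rfl
  have hQN : QN.Nondegenerate := by
    rw [← QuadraticMap.nondegenerate_polar_iff,
      LinearMap.IsRefl.nondegenerate_iff_separatingLeft
        (fun x y h => (QuadraticMap.polar_comm QN y x).trans h)]
    intro v hv
    refine Subtype.ext (polar_separating hQ fun w => ?_)
    rw [hπpol v v.2]
    exact hv ⟨π w, hπN w⟩
  obtain ⟨θN, hθN⟩ := exists_tripleFrame_of_disjoint hQN (m := m)
    (H := fun i => (H i).comap N.subtype) (fun i v => ⟨fun hv w hw => (hH i).polar_eq_zero hv hw,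
      fun hv => (hH i _).mpr fun w hw => by
        change QuadraticMap.polar Q (v : V) w = 0
        rw [hπpol v v.2]
        exact hv ⟨π w, hπN w⟩ (hπH i w hw)⟩)
    (fun i j hij => by
      rw [Submodule.disjoint_def]
      intro v hvi hvj
      obtain ⟨ψ, hψ⟩ := hline i j hij
      obtain ⟨k, hki, hkj⟩ := hother i j
      have hψa : ψ (a k) ≠ 0 := fun h => ha0 k (hψ _ (ha k i hki) (ha k j hkj) h)
      -- The form `ψ` is injective on `H i ∩ H j`, so this intersection is the line of `a k`.
      -- Orthogonality of `v` to `c k` then kills the coefficient.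
      have h1 : (v : V) - (ψ v / ψ (a k)) • a k = 0 := by
        refine hψ _ (sub_mem hvi (Submodule.smul_mem _ _ (ha k i hki)))
          (sub_mem hvj (Submodule.smul_mem _ _ (ha k j hkj))) ?_
        rw [map_sub, map_smul, smul_eq_mul, div_mul_cancel₀ _ hψa, sub_self]
      have h2 := ((hNmem v).mp v.2 k).2
      rw [sub_eq_zero.mp h1, QuadraticMap.polar_smul_right, hca, if_pos rfl, smul_eq_mul,
        mul_one] at h2
      rw [h2, zero_smul, sub_zero] at h1
      exact Subtype.ext h1) hNrank
  let θ₀ : TripleModel True m →ₗ[ℂ] V :=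
    (((Fintype.linearCombination ℂ fun j : TripleIndex True => a j).coprod
      (Fintype.linearCombination ℂ fun j : TripleIndex True => c j)).coprod
        (N.subtype ∘ₗ θN.toLinearMap ∘ₗ LinearMap.inr ℂ _ _))
  have hθ₀ : ∀ x, θ₀ x = (∑ j, x.1.1 j • a j + ∑ j, x.1.2 j • c j) + (θN (0, x.2) : V) :=
    fun x => by simp [θ₀, Fintype.linearCombination_apply]
  refine exists_tripleFrame hH θ₀ ?_ ?_ ?_
  · intro x y
    have h1 : ∀ (j : Fin 3) (v : N), QuadraticMap.polar Q (a j) v = 0 :=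
      fun j v => ((hNmem v).mp v.2 j).1
    have h2 : ∀ (j : Fin 3) (v : N), QuadraticMap.polar Q (c j) v = 0 :=
      fun j v => ((hNmem v).mp v.2 j).2
    have h3 : ∀ (j : Fin 3) (v : N), QuadraticMap.polar Q v (a j) = 0 :=
      fun j v => by rw [QuadraticMap.polar_comm, h1]
    have h4 : ∀ (j : Fin 3) (v : N), QuadraticMap.polar Q v (c j) = 0 :=
      fun j v => by rw [QuadraticMap.polar_comm, h2]
    have h5 : QuadraticMap.polar Q (θN (0, x.2) : V) (θN (0, y.2) : V) =
        standardSymplectic m x.2.2 y.2.1 + standardSymplectic m y.2.2 x.2.1 := by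
      rw [← hpolN, hθN.polar_eq]
      simp [TripleModel.form]
    rw [hθ₀, hθ₀]
    simp [TripleModel.form, QuadraticMap.polar_add_left, QuadraticMap.polar_add_right,
      QuadraticMap.polar_sum_left, QuadraticMap.polar_sum_right, QuadraticMap.polar_smul_left,
      QuadraticMap.polar_smul_right, h1, h2, h3, h4, h5, haa, hac, hca, hcc, Subtype.coe_inj]
    rw [add_comm]
    simp only [mul_comm]
  · rintro i x ⟨hx, hx'⟩
    rw [hθ₀]
    refine add_mem (add_mem (Submodule.sum_mem _ fun j _ => ?_)
      (Submodule.sum_mem _ fun j _ => ?_)) ?_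
    · by_cases hj : i = j
      · have := hx j
        rw [if_pos hj.symm] at this
        rw [this, zero_smul]
        exact zero_mem _
      · exact Submodule.smul_mem _ _ (ha j i hj)
    · by_cases hj : i = j
      · subst hj
        exact Submodule.smul_mem _ _ (hcH j)
      · have := hx j
        rw [if_neg (Ne.symm hj)] at this
        rw [this, zero_smul]
        exact zero_mem _
    · exact (hθN.mem_iff i (0, x.2)).mpr ⟨fun j => j.2.elim, hx'⟩
  · rw [hrank]
    have : Fintype.card (TripleIndex True) = 3 := rfl
    simp
    omega

end

section

/-! ### Triples of points of the spinor variety in normal form -/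

namespace Polarization

variable [FiniteDimensional ℂ V] {Q : QuadraticForm ℂ V} {P : Polarization Q} {ε : Prop}
  [Decidable ε] {m : ℕ}

theorem smul_eq_of_isotropicSpace (hQ : Q.Nondegenerate) {g : spinGroup Q} {x y : P.SpinorVariety}
    (h : ∀ v ∈ P.isotropicSpace x, (spinGroup.toSO Q g : V ≃ₗ[ℂ] V) v ∈ P.isotropicSpace y) :
    g • x = y := by
  apply isotropicSpace_injective hQ
  refine (isLagrangian_isotropicSpace hQ _).eq_of_le (isLagrangian_isotropicSpace hQ _) ?_
  rw [isotropicSpace_smul]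
  rintro _ ⟨v, hv, rfl⟩
  exact h v hv

theorem mem_isotropicSpace_smul_iff (g : spinGroup Q) (x : P.SpinorVariety) (v : V) :
    (spinGroup.toSO Q g : V ≃ₗ[ℂ] V) v ∈ P.isotropicSpace (g • x) ↔ v ∈ P.isotropicSpace x := by
  rw [isotropicSpace_smul, Submodule.mem_map_equiv, LinearEquiv.symm_apply_apply]

/-- Two triples in normal form are conjugate under the spin group. -/
theorem exists_smul_eq_of_isTripleFrame (hQ : Q.Nondegenerate) {x y : Fin 3 → P.SpinorVariety}
    {θ θ' : TripleModel ε m ≃ₗ[ℂ] V} (hθ : IsTripleFrame Q (fun i => P.isotropicSpace (x i)) θ)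
    (hθ' : IsTripleFrame Q (fun i => P.isotropicSpace (y i)) θ') :
    ∃ g : spinGroup Q, g • x = y := by
  let T : V ≃ₗ[ℂ] V := θ.symm.trans θ'
  have hT : ∀ v, Q (T v) = Q v := by
    apply isometry_of_polar_eq
    intro v w
    change QuadraticMap.polar Q (θ' (θ.symm v)) (θ' (θ.symm w)) = _
    rw [hθ'.polar_eq, ← hθ.polar_eq, θ.apply_symm_apply, θ.apply_symm_apply]
  have hTmem : ∀ i, ∀ v ∈ P.isotropicSpace (x i), T v ∈ P.isotropicSpace (y i) := by
    intro i v hv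
    obtain ⟨z, rfl⟩ := θ.surjective v
    change θ' (θ.symm (θ z)) ∈ _
    rw [θ.symm_apply_apply]
    exact (hθ'.mem_iff i z).mpr ((hθ.mem_iff i z).mp hv)
  -- The determinant needs no separate check: `T` carries one member of the family to another.
  obtain ⟨g, hg⟩ := spinGroup.toSO_surjective hQ ⟨T, hT, det_eq_one_of_map_le hQ hT (hTmem 0)⟩
  refine ⟨g, funext fun i => smul_eq_of_isotropicSpace hQ fun v hv => ?_⟩
  rw [hg]
  exact hTmem i v hv

/-- The sets of coordinates of the points of `S₊` are stable under the isometries of the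
coordinate space that preserve a Lagrangian subspace. -/
theorem exists_isotropicSpace_preimage (hQ : Q.Nondegenerate) {θ : TripleModel ε m ≃ₗ[ℂ] V}
    (hθ : ∀ x y, QuadraticMap.polar Q (θ x) (θ y) = TripleModel.form x y)
    (τ : TripleModel ε m →ₗ[ℂ] TripleModel ε m)
    (hτ : ∀ x y, TripleModel.form (τ x) (τ y) = TripleModel.form x y)
    (L : Submodule ℂ (TripleModel ε m)) (hτL : ∀ x ∈ L, τ x ∈ L)
    (hL : ∀ x, x ∈ L ↔ ∀ y ∈ L, TripleModel.form x y = 0)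
    (x : P.SpinorVariety) :
    ∃ y : P.SpinorVariety, ∀ z, θ z ∈ P.isotropicSpace y ↔ θ (τ z) ∈ P.isotropicSpace x := by
  obtain ⟨τ', hτ'⟩ := exists_linearEquiv_of_form τ TripleModel.form
    (fun y => by rw [← hθ, map_zero, QuadraticMap.polar_zero_left])
    (fun x hx => TripleModel.eq_zero_of_form_eq_zero x fun y => (hτ x y).symm.trans (hx y)) rfl
  let T : V ≃ₗ[ℂ] V := (θ.symm.trans τ').trans θ
  have hTθ : ∀ z, T (θ z) = θ (τ z) := fun z => by simp [T, hτ']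
  have hT : ∀ v, Q (T v) = Q v := by
    apply isometry_of_polar_eq
    intro v w
    obtain ⟨a, rfl⟩ := θ.surjective v
    obtain ⟨b, rfl⟩ := θ.surjective w
    rw [hTθ, hTθ, hθ, hθ, hτ]
  have hLag : IsLagrangian Q (L.map (θ : TripleModel ε m →ₗ[ℂ] V)) := by
    intro v
    obtain ⟨a, rfl⟩ := θ.surjective v
    rw [Submodule.mem_map_equiv, θ.symm_apply_apply, hL]
    constructor
    · rintro h _ ⟨b, hb, rfl⟩
      exact (hθ a b).trans (h b hb)
    · intro h b hb
      rw [← hθ]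
      exact h _ ⟨b, hb, rfl⟩
  have hdet := hLag.det_eq_one hQ hT (by
    rintro _ ⟨b, hb, rfl⟩
    exact ⟨τ b, hτL b hb, (hTθ b).symm⟩)
  obtain ⟨y, hy⟩ := exists_isotropicSpace_eq_map hQ x
    (⟨T, hT, hdet⟩ : specialOrthogonalGroup Q)⁻¹
  refine ⟨y, fun z => ?_⟩
  rw [hy, ← hTθ]
  constructor
  · rintro ⟨w, hw, hwz⟩
    have h : T.symm w = θ z := hwz
    rwa [← h, T.apply_symm_apply]
  · exact fun h => ⟨T (θ z), h, T.symm_apply_apply _⟩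

end Polarization

/-! ### Isometries of the coordinate space and Lagrangian subspaces that they preserve -/

namespace TripleModel

variable {ε : Prop} [Decidable ε] {m : ℕ}

/-- The Lagrangian subspace where the second hyperbolic coordinates and the second symplectic
component vanish. -/
def lagrangianSnd (ε : Prop) (m : ℕ) : Submodule ℂ (TripleModel ε m) where
  carrier := {x | x.1.2 = 0 ∧ x.2.2 = 0}
  zero_mem' := by simp
  add_mem' := by rintro a b ⟨h1, h2⟩ ⟨h3, h4⟩; simp [h1, h2, h3, h4]
  smul_mem' := by rintro c a ⟨h1, h2⟩; simp [h1, h2]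

/-- The Lagrangian subspace where the second hyperbolic coordinates and the first symplectic
component vanish. -/
def lagrangianFst (ε : Prop) (m : ℕ) : Submodule ℂ (TripleModel ε m) where
  carrier := {x | x.1.2 = 0 ∧ x.2.1 = 0}
  zero_mem' := by simp
  add_mem' := by rintro a b ⟨h1, h2⟩ ⟨h3, h4⟩; simp [h1, h2, h3, h4]
  smul_mem' := by rintro c a ⟨h1, h2⟩; simp [h1, h2]

theorem mem_lagrangianSnd_iff (x : TripleModel ε m) :
    x ∈ lagrangianSnd ε m ↔ ∀ y ∈ lagrangianSnd ε m, form x y = 0 := by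
  constructor
  · rintro ⟨h1, h2⟩ y ⟨h3, h4⟩
    simp [form, h1, h2, h3, h4]
  · intro h
    refine ⟨funext fun j => ?_, standardSymplectic_separating m _ fun y => ?_⟩
    · simpa [form, Pi.single_apply] using h ((Pi.single j 1, 0), 0) ⟨rfl, rfl⟩
    · simpa [form] using h (0, (y, 0)) ⟨rfl, rfl⟩

theorem mem_lagrangianFst_iff (x : TripleModel ε m) :
    x ∈ lagrangianFst ε m ↔ ∀ y ∈ lagrangianFst ε m, form x y = 0 := by
  constructor
  · rintro ⟨h1, h2⟩ y ⟨h3, h4⟩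
    simp [form, h1, h2, h3, h4]
  · intro h
    refine ⟨funext fun j => ?_, standardSymplectic_separating m _ fun y => ?_⟩
    · simpa [form, Pi.single_apply] using h ((Pi.single j 1, 0), 0) ⟨rfl, rfl⟩
    · rw [standardSymplectic_neg]
      simpa [form] using h (0, (0, y)) ⟨rfl, rfl⟩

/-- The shear adding a multiple of the first symplectic component to the second. -/
def shearSnd (ε : Prop) (m : ℕ) (s : ℂ) : TripleModel ε m →ₗ[ℂ] TripleModel ε m where
  toFun x := (x.1, (x.2.1, x.2.2 + s • x.2.1))
  map_add' x y := by ext <;> simp; ring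
  map_smul' c x := by ext <;> simp; ring

/-- The shear adding a multiple of the second symplectic component to the first. -/
def shearFst (ε : Prop) (m : ℕ) (s : ℂ) : TripleModel ε m →ₗ[ℂ] TripleModel ε m where
  toFun x := (x.1, (x.2.1 + s • x.2.2, x.2.2))
  map_add' x y := by ext <;> simp; ring
  map_smul' c x := by ext <;> simp; ring

theorem form_shearSnd (s : ℂ) (x y : TripleModel ε m) :
    form (shearSnd ε m s x) (shearSnd ε m s y) = form x y := by
  simp only [form, shearSnd, LinearMap.coe_mk, AddHom.coe_mk, map_add, map_smul,
    LinearMap.add_apply, LinearMap.smul_apply, smul_eq_mul]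
  rw [standardSymplectic_neg m y.2.1]
  ring

theorem form_shearFst (s : ℂ) (x y : TripleModel ε m) :
    form (shearFst ε m s x) (shearFst ε m s y) = form x y := by
  simp only [form, shearFst, LinearMap.coe_mk, AddHom.coe_mk, map_add, map_smul, smul_eq_mul]
  rw [standardSymplectic_neg m y.2.2 x.2.2]
  ring

/-- A permutation of the three subspaces, acting on the indices of the hyperbolic planes. -/
def permIndex (ε : Prop) (σ : Equiv.Perm (Fin 3)) : Equiv.Perm (TripleIndex ε) :=
  σ.subtypeEquiv fun _ => Iff.rfl

/-- The permutation of the hyperbolic planes. -/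
def permPlanes (ε : Prop) (m : ℕ) (σ : Equiv.Perm (Fin 3)) :
    TripleModel ε m →ₗ[ℂ] TripleModel ε m where
  toFun x := ((fun j => x.1.1 (permIndex ε σ j), fun j => x.1.2 (permIndex ε σ j)), x.2)
  map_add' _ _ := rfl
  map_smul' _ _ := rfl

theorem form_permPlanes (σ : Equiv.Perm (Fin 3)) (x y : TripleModel ε m) :
    form (permPlanes ε m σ x) (permPlanes ε m σ y) = form x y := by
  simp only [form, permPlanes, LinearMap.coe_mk, AddHom.coe_mk]
  rw [Equiv.sum_comp (permIndex ε σ) fun j => x.1.1 j * y.1.2 j,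
    Equiv.sum_comp (permIndex ε σ) fun j => x.1.2 j * y.1.1 j]

/-- The isometry exchanging the coordinates of the planes `1` and `2` crosswise. -/
def crossPlanes (ε : Prop) (m : ℕ) : TripleModel ε m →ₗ[ℂ] TripleModel ε m where
  toFun x := ((fun j => if (j : Fin 3) = 0 then x.1.1 j
      else x.1.2 (permIndex ε (Equiv.swap 1 2) j),
    fun j => if (j : Fin 3) = 0 then x.1.2 j else x.1.1 (permIndex ε (Equiv.swap 1 2) j)), x.2)
  map_add' x y := by
    refine Prod.ext (Prod.ext (funext fun j => ?_) (funext fun j => ?_)) rfl <;>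
    by_cases h : (j : Fin 3) = 0 <;> simp [h]
  map_smul' c x := by
    refine Prod.ext (Prod.ext (funext fun j => ?_) (funext fun j => ?_)) rfl <;>
    by_cases h : (j : Fin 3) = 0 <;> simp [h]

theorem coe_permIndex (σ : Equiv.Perm (Fin 3)) (j : TripleIndex ε) :
    (permIndex ε σ j : Fin 3) = σ j := rfl

theorem swap_eq_zero_iff (j : Fin 3) : Equiv.swap 1 2 j = 0 ↔ j = 0 := by
  revert j; decide

theorem form_crossPlanes (x y : TripleModel ε m) :
    form (crossPlanes ε m x) (crossPlanes ε m y) = form x y := by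
  simp only [form, crossPlanes, LinearMap.coe_mk, AddHom.coe_mk]
  congr 1
  rw [← Finset.sum_add_distrib, ← Finset.sum_add_distrib]
  have h : ∀ f : TripleIndex ε → ℂ, ∑ j : TripleIndex ε, (if (j : Fin 3) = 0 then f j
      else f (permIndex ε (Equiv.swap 1 2) j)) = ∑ j, f j := fun f => by
    rw [← Equiv.sum_comp (permIndex ε (Equiv.swap 1 2)) f]
    refine Finset.sum_congr rfl fun j _ => ?_
    split_ifs with hj
    · congr 1
      exact Subtype.ext (by rw [coe_permIndex, hj]; decide)
    · rfl
  rw [← h fun j => x.1.1 j * y.1.2 j + x.1.2 j * y.1.1 j]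
  refine Finset.sum_congr rfl fun j _ => ?_
  split_ifs with hj
  · rfl
  · ring

/-- A Lagrangian subspace preserved by `crossPlanes`. -/
def lagrangianCross (ε : Prop) (m : ℕ) : Submodule ℂ (TripleModel ε m) where
  carrier := {x | (∀ j : TripleIndex ε, ((j : Fin 3) = 0 → x.1.2 j = 0) ∧
    ((j : Fin 3) = 1 → x.1.1 j = x.1.2 (permIndex ε (Equiv.swap 1 2) j)) ∧
    ((j : Fin 3) = 2 → x.1.1 j = -x.1.2 (permIndex ε (Equiv.swap 1 2) j))) ∧ x.2.2 = 0}
  zero_mem' := by simp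
  add_mem' := by
    rintro a b ⟨h1, h2⟩ ⟨h3, h4⟩
    refine ⟨fun j => ⟨fun h => ?_, fun h => ?_, fun h => ?_⟩, by simp [h2, h4]⟩
    · simp [(h1 j).1 h, (h3 j).1 h]
    · simp [(h1 j).2.1 h, (h3 j).2.1 h]
    · simp [(h1 j).2.2 h, (h3 j).2.2 h]; ring
  smul_mem' := by
    rintro c a ⟨h1, h2⟩
    refine ⟨fun j => ⟨fun h => ?_, fun h => ?_, fun h => ?_⟩, by simp [h2]⟩
    · simp [(h1 j).1 h]
    · simp [(h1 j).2.1 h]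
    · simp [(h1 j).2.2 h]

theorem sum_tripleIndex (h : ε) (f : TripleIndex ε → ℂ) :
    ∑ j, f j = f ⟨0, h⟩ + f ⟨1, h⟩ + f ⟨2, h⟩ := by
  rw [← Fin.sum_univ_three fun j => f ⟨j, h⟩]
  exact (Fintype.sum_equiv (Equiv.subtypeUnivEquiv fun _ => h).symm _ _ fun _ => rfl).symm

theorem mem_lagrangianCross_iff (x : TripleModel ε m) :
    x ∈ lagrangianCross ε m ↔ ∀ y ∈ lagrangianCross ε m, form x y = 0 := by
  have h10 : (1 : Fin 3) ≠ 0 := by decide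
  have h20 : (2 : Fin 3) ≠ 0 := by decide
  have h21 : (2 : Fin 3) ≠ 1 := by decide
  have h12 : (1 : Fin 3) ≠ 2 := by decide
  have hperm : ∀ h : ε, permIndex ε (Equiv.swap 1 2) ⟨1, h⟩ = ⟨2, h⟩ ∧
      permIndex ε (Equiv.swap 1 2) ⟨2, h⟩ = ⟨1, h⟩ := fun h =>
    ⟨Subtype.ext (Equiv.swap_apply_left _ _), Subtype.ext (Equiv.swap_apply_right _ _)⟩
  constructor
  · rintro ⟨h1, h2⟩ y ⟨h3, h4⟩
    by_cases hε : ε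
    · have a0 := (h1 ⟨0, hε⟩).1 rfl
      have a1 := (h1 ⟨1, hε⟩).2.1 rfl
      have a2 := (h1 ⟨2, hε⟩).2.2 rfl
      have b0 := (h3 ⟨0, hε⟩).1 rfl
      have b1 := (h3 ⟨1, hε⟩).2.1 rfl
      have b2 := (h3 ⟨2, hε⟩).2.2 rfl
      rw [(hperm hε).1] at a1 b1
      rw [(hperm hε).2] at a2 b2
      simp only [form, sum_tripleIndex hε, a0, a1, a2, b0, b1, b2, h2, h4, map_zero,
        LinearMap.zero_apply]
      ring
    · have : IsEmpty (TripleIndex ε) := ⟨fun j => hε j.2⟩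
      simp [form, h2, h4]
  · intro h
    refine ⟨fun j => ?_, standardSymplectic_separating m _ fun y => ?_⟩
    · obtain ⟨j, hε⟩ := j
      have test := fun (p q : TripleIndex ε → ℂ) hpq => h ((fun j => p j, fun j => q j), 0) ⟨hpq, rfl⟩
      simp only [form, sum_tripleIndex hε, Prod.fst_zero, Prod.snd_zero, map_zero,
        LinearMap.zero_apply, add_zero] at test
      refine ⟨?_, ?_, ?_⟩ <;> rintro ⟨⟩
      · have := test (fun j => if (j : Fin 3) = 0 then 1 else 0) 0 fun j => by
          refine ⟨fun _ => rfl, fun hj => ?_, fun hj => ?_⟩ <;> simp [hj]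
        simpa using this
      · have := test (fun j => if (j : Fin 3) = 2 then -1 else 0)
          (fun j => if (j : Fin 3) = 1 then 1 else 0) fun j => by
            refine ⟨fun hj => ?_, fun hj => ?_, fun hj => ?_⟩ <;> simp [hj, coe_permIndex]
        change _ = x.1.2 (permIndex ε (Equiv.swap 1 2) ⟨1, hε⟩)
        rw [(hperm hε).1]
        change x.1.1 ⟨1, hε⟩ = _
        simp only [h10.symm, h12, h21, h20.symm, if_true, if_false] at this
        linear_combination this
      · have := test (fun j => if (j : Fin 3) = 1 then 1 else 0)
          (fun j => if (j : Fin 3) = 2 then 1 else 0) fun j => by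
            refine ⟨fun hj => ?_, fun hj => ?_, fun hj => ?_⟩ <;> simp [hj, coe_permIndex]
        change _ = -x.1.2 (permIndex ε (Equiv.swap 1 2) ⟨2, hε⟩)
        rw [(hperm hε).2]
        change x.1.1 ⟨2, hε⟩ = _
        simp only [h10.symm, h12, h21, h20.symm, if_true, if_false] at this
        linear_combination this
    · simpa [form] using h (0, (y, 0)) ⟨fun j => by simp, rfl⟩

end TripleModel

/-! ### Existence of triples in normal form -/

namespace Polarization

variable [FiniteDimensional ℂ V] {Q : QuadraticForm ℂ V} {P : Polarization Q} {ε : Prop}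
  [Decidable ε] {m : ℕ}

theorem _root_.QuadraticMap.polar_linearCombination (Q : QuadraticForm ℂ V) {κ κ' : Type*}
    [Fintype κ] [Fintype κ'] (u : κ → V) (w : κ' → V) (s : κ → ℂ) (t : κ' → ℂ) :
    QuadraticMap.polar Q (∑ i, s i • u i) (∑ j, t j • w j) =
      ∑ i, ∑ j, s i * (t j * QuadraticMap.polar Q (u i) (w j)) := by
  simp only [QuadraticMap.polar_sum_left, QuadraticMap.polar_sum_right,
    QuadraticMap.polar_smul_left, QuadraticMap.polar_smul_right, smul_eq_mul, Finset.mul_sum]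
  rw [Finset.sum_comm]
  refine Finset.sum_congr rfl fun i _ => Finset.sum_congr rfl fun j _ => ?_
  ring

/-- Coordinates in which the base point of `S₊` is the first standard Lagrangian subspace. -/
theorem exists_basePoint_coordinates (hQ : Q.Nondegenerate)
    (hrank : Module.finrank ℂ (TripleModel ε m) = Module.finrank ℂ V) :
    ∃ θ : TripleModel ε m ≃ₗ[ℂ] V,
      (∀ x y, QuadraticMap.polar Q (θ x) (θ y) = TripleModel.form x y) ∧
      ∀ x, θ x ∈ P.E ↔ TripleModel.Mem 0 x := by
  have hE := P.isLagrangian_E hQ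
  have hF := P.isLagrangian_F hQ
  obtain ⟨e, f, he, hf, hef⟩ := IsLagrangian.exists_dual_frame hQ hE hF P.isCompl.disjoint
    (ι' := TripleIndex ε ⊕ (Fin m ⊕ Fin m)) (by
      have := hE.finrank hQ
      rw [← hrank] at this
      simp at this ⊢
      omega)
  have hee : ∀ i j, QuadraticMap.polar Q (e i) (e j) = 0 := fun i j =>
    hE.polar_eq_zero (he i) (he j)
  have hff : ∀ i j, QuadraticMap.polar Q (f i) (f j) = 0 := fun i j =>
    hF.polar_eq_zero (hf i) (hf j)
  have hfe : ∀ i j, QuadraticMap.polar Q (f i) (e j) = if i = j then 1 else 0 := fun i j => by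
    rw [QuadraticMap.polar_comm, hef]; simp [eq_comm]
  have hne : ∀ i j : TripleIndex ε, (i : Fin 3) = 0 → (j : Fin 3) ≠ 0 →
      (Sum.inl i : TripleIndex ε ⊕ (Fin m ⊕ Fin m)) ≠ Sum.inl j := by
    rintro i j h h' hij
    exact h' (Sum.inl_injective hij ▸ h)
  -- The standard subspace of index `0` uses the second half of the plane `0` and the first halves
  -- of the planes `1`, `2`, so `e` and `f` are exchanged in the plane `0` only.
  obtain ⟨e', he'⟩ : ∃ e' : TripleIndex ε → V, ∀ j, e' j =
    if (j : Fin 3) = 0 then f (.inl j) else e (.inl j) := ⟨_, fun _ => rfl⟩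
  obtain ⟨f', hf'⟩ : ∃ f' : TripleIndex ε → V, ∀ j, f' j =
    if (j : Fin 3) = 0 then e (.inl j) else f (.inl j) := ⟨_, fun _ => rfl⟩
  -- The dual vectors are reordered with signs so that their pairing with the `e (.inr j)` becomes
  -- the standard symplectic form.
  obtain ⟨g, hg⟩ : ∃ g : Fin m ⊕ Fin m → V, g =
    Sum.elim (fun i => -f (.inr (.inr i))) fun i => f (.inr (.inl i)) := ⟨_, rfl⟩
  have h1 : ∀ i j, QuadraticMap.polar Q (e' i) (e' j) = 0 := fun i j => by
    rw [he', he']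
    split_ifs with h h' h'
    · exact hff _ _
    · rw [hfe, if_neg (hne i j h h')]
    · rw [hef, if_neg (hne j i h' h).symm]
    · exact hee _ _
  have h2 : ∀ i j, QuadraticMap.polar Q (f' i) (f' j) = 0 := fun i j => by
    rw [hf', hf']
    split_ifs with h h' h'
    · exact hee _ _
    · rw [hef, if_neg (hne i j h h')]
    · rw [hfe, if_neg (hne j i h' h).symm]
    · exact hff _ _
  have h3 : ∀ i j, QuadraticMap.polar Q (e' i) (f' j) = if i = j then 1 else 0 := fun i j => by
    rw [he', hf']
    have hij : (if i = j then (1 : ℂ) else 0) =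
        if (Sum.inl i : TripleIndex ε ⊕ (Fin m ⊕ Fin m)) = Sum.inl j then 1 else 0 :=
      if_congr Sum.inl_injective.eq_iff.symm rfl rfl
    rw [hij]
    by_cases h : (i : Fin 3) = 0 <;> by_cases h' : (j : Fin 3) = 0
    · rw [if_pos h, if_pos h', hfe]
    · rw [if_pos h, if_neg h', hff, if_neg (hne i j h h')]
    · rw [if_neg h, if_pos h', hee, if_neg (hne j i h' h).symm]
    · rw [if_neg h, if_neg h', hef]
  have h4 : ∀ i j, QuadraticMap.polar Q (f' i) (e' j) = if i = j then 1 else 0 := fun i j => by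
    rw [QuadraticMap.polar_comm, h3]; simp only [eq_comm]
  have h5 : ∀ i j, QuadraticMap.polar Q (e' i) (e (.inr j)) = 0 := fun i j => by
    rw [he']; split_ifs
    · rw [hfe, if_neg Sum.inl_ne_inr]
    · exact hee _ _
  have h6 : ∀ i j, QuadraticMap.polar Q (f' i) (e (.inr j)) = 0 := fun i j => by
    rw [hf']; split_ifs
    · exact hee _ _
    · rw [hfe, if_neg Sum.inl_ne_inr]
  have hfg : ∀ i j, QuadraticMap.polar Q (f i) (g j) = 0 := fun i j => by
    rcases j with j | j
    · rw [hg, Sum.elim_inl, QuadraticMap.polar_neg_right, hff, neg_zero]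
    · rw [hg, Sum.elim_inr, hff]
  have heg : ∀ i j, QuadraticMap.polar Q (e (.inl i)) (g j) = 0 := fun i j => by
    rcases j with j | j
    · rw [hg, Sum.elim_inl, QuadraticMap.polar_neg_right, hef, if_neg Sum.inl_ne_inr, neg_zero]
    · rw [hg, Sum.elim_inr, hef, if_neg Sum.inl_ne_inr]
  have h7 : ∀ i j, QuadraticMap.polar Q (e' i) (g j) = 0 := fun i j => by
    rw [he']; split_ifs
    exacts [hfg _ _, heg _ _]
  have h8 : ∀ i j, QuadraticMap.polar Q (f' i) (g j) = 0 := fun i j => by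
    rw [hf']; split_ifs
    exacts [heg _ _, hfg _ _]
  have h9 : ∀ i j, QuadraticMap.polar Q (g i) (g j) = 0 := fun i j => by
    rcases i with i | i
    · nth_rw 1 [hg]
      rw [Sum.elim_inl, QuadraticMap.polar_neg_left, hfg, neg_zero]
    · nth_rw 1 [hg]
      rw [Sum.elim_inr, hfg]
  have hge : ∀ a b, QuadraticMap.polar Q (∑ j, b j • g j) (∑ j, a j • e (.inr j)) =
      standardSymplectic m b a := fun a b => by
    rw [QuadraticMap.polar_linearCombination, standardSymplectic_apply]
    simp [hg, hfe, QuadraticMap.polar_neg_left]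
    ring
  have heg' : ∀ a b, QuadraticMap.polar Q (∑ j, a j • e (.inr j)) (∑ j, b j • g j) =
      standardSymplectic m b a := fun a b => by rw [QuadraticMap.polar_comm, hge]
  have hz : ∀ {κ κ' : Type} [Fintype κ] [Fintype κ'] (u : κ → V) (w : κ' → V),
      (∀ i j, QuadraticMap.polar Q (u i) (w j) = 0) → ∀ (s : κ → ℂ) (t : κ' → ℂ),
      QuadraticMap.polar Q (∑ i, s i • u i) (∑ j, t j • w j) = 0 ∧
      QuadraticMap.polar Q (∑ j, t j • w j) (∑ i, s i • u i) = 0 := by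
    intro κ κ' _ _ u w h s t
    rw [QuadraticMap.polar_comm Q (∑ j, t j • w j), and_self,
      QuadraticMap.polar_linearCombination]
    simp only [h, mul_zero, Finset.sum_const_zero]
  have hd : ∀ u w : TripleIndex ε → V,
      (∀ i j, QuadraticMap.polar Q (u i) (w j) = if i = j then 1 else 0) →
      ∀ s t : TripleIndex ε → ℂ,
      QuadraticMap.polar Q (∑ i, s i • u i) (∑ j, t j • w j) = ∑ j, s j * t j := by
    intro u w h s t
    rw [QuadraticMap.polar_linearCombination]
    simp only [h, mul_ite, mul_one, mul_zero, Finset.sum_ite_eq, Finset.mem_univ, if_true]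
  let θ₀ : TripleModel ε m →ₗ[ℂ] V :=
    ((Fintype.linearCombination ℂ e').coprod (Fintype.linearCombination ℂ f')).coprod
      ((Fintype.linearCombination ℂ fun i => e (.inr i)).coprod (Fintype.linearCombination ℂ g))
  have hθ₀ : ∀ x, θ₀ x = (∑ j, x.1.1 j • e' j + ∑ j, x.1.2 j • f' j) +
      (∑ j, x.2.1 j • e (.inr j) + ∑ j, x.2.2 j • g j) :=
    fun x => by simp [θ₀, Fintype.linearCombination_apply]
  have hθ : ∀ x y, QuadraticMap.polar Q (θ₀ x) (θ₀ y) = TripleModel.form x y := by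
    intro x y
    rw [hθ₀, hθ₀]
    simp only [QuadraticMap.polar_add_left, QuadraticMap.polar_add_right, hz _ _ h1, hz _ _ h2,
      hz _ _ h5, hz _ _ h6, hz _ _ h7, hz _ _ h8, hz _ _ h9, hd _ _ h3, hd _ _ h4, hge, heg',
      hz (fun i => e (.inr i)) (fun i => e (.inr i)) fun i j => hee _ _]
    simp only [TripleModel.form]
    ring
  have hmem : ∀ x, TripleModel.Mem 0 x → θ₀ x ∈ P.E := by
    rintro x ⟨hx, hx'⟩
    have hx' : x.2.2 = 0 := hx'
    rw [hθ₀, hx']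
    refine add_mem (add_mem (Submodule.sum_mem _ fun j _ => ?_)
      (Submodule.sum_mem _ fun j _ => ?_)) (add_mem (Submodule.sum_mem _ fun j _ =>
        Submodule.smul_mem _ _ (he _)) (by simp))
    · by_cases hj : (j : Fin 3) = 0
      · have := hx j
        rw [if_pos hj] at this
        rw [this, zero_smul]
        exact zero_mem _
      · rw [he', if_neg hj]
        exact Submodule.smul_mem _ _ (he _)
    · by_cases hj : (j : Fin 3) = 0
      · rw [hf', if_pos hj]
        exact Submodule.smul_mem _ _ (he _)
      · have := hx j
        rw [if_neg hj] at this
        rw [this, zero_smul]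
        exact zero_mem _
  obtain ⟨θ, hθ'⟩ := exists_linearEquiv_of_form θ₀ (QuadraticMap.polar Q)
    (fun y => QuadraticMap.polar_zero_left Q y)
    (fun x hx => TripleModel.eq_zero_of_form_eq_zero x fun y => (hθ x y).symm.trans (hx y)) hrank
  refine ⟨θ, fun x y => by rw [hθ', hθ', hθ], fun x => ⟨fun h => ?_, fun h => ?_⟩⟩
  · refine TripleModel.mem_of_form_eq_zero 0 x fun y hy => ?_
    rw [← hθ, ← hθ']
    exact hE.polar_eq_zero h (hmem y hy)
  · rw [hθ']; exact hmem x h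

/-- There are triples of points of `S₊` in normal form, and pencils of points through them. -/
theorem exists_isTripleFrame (P : Polarization Q) (hQ : Q.Nondegenerate)
    (hrank : Module.finrank ℂ (TripleModel ε m) = Module.finrank ℂ V) :
    ∃ (x : Fin 3 → P.SpinorVariety) (θ : TripleModel ε m ≃ₗ[ℂ] V),
      IsTripleFrame Q (fun i => P.isotropicSpace (x i)) θ ∧
      ∀ s : ℂ, ∃ y : P.SpinorVariety, ∀ z, θ z ∈ P.isotropicSpace y ↔
        z.1.1 = 0 ∧ z.2.2 = s • z.2.1 := by
  open TripleModel in
  obtain ⟨θ, hθ, hθE⟩ := P.exists_basePoint_coordinates (ε := ε) (m := m) hQ hrank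
  have hbase : ∀ z, θ z ∈ P.isotropicSpace P.basePoint ↔ TripleModel.Mem 0 z := fun z => by
    rw [isotropicSpace_basePoint hQ, hθE]
  have hperm : ∀ σ, ∃ y : P.SpinorVariety, ∀ z, θ z ∈ P.isotropicSpace y ↔
      Mem 0 (permPlanes ε m σ z) := fun σ => by
    obtain ⟨y, hy⟩ := exists_isotropicSpace_preimage hQ hθ (permPlanes ε m σ)
      (form_permPlanes σ) (lagrangianSnd ε m)
      (fun z hz => ⟨funext fun j => congrFun hz.1 _, hz.2⟩) mem_lagrangianSnd_iff P.basePoint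
    exact ⟨y, fun z => by rw [hy, hbase]⟩
  have hsnd : ∀ s x, ∃ y : P.SpinorVariety, ∀ z, θ z ∈ P.isotropicSpace y ↔
      θ (shearSnd ε m s z) ∈ P.isotropicSpace x := fun s x =>
    exists_isotropicSpace_preimage hQ hθ (shearSnd ε m s) (form_shearSnd s) (lagrangianFst ε m)
      (fun z hz => hz) mem_lagrangianFst_iff x
  have hfst : ∀ s x, ∃ y : P.SpinorVariety, ∀ z, θ z ∈ P.isotropicSpace y ↔
      θ (shearFst ε m s z) ∈ P.isotropicSpace x := fun s x =>
    exists_isotropicSpace_preimage hQ hθ (shearFst ε m s) (form_shearFst s) (lagrangianSnd ε m)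
      (fun z hz => hz) mem_lagrangianSnd_iff x
  have hσ : ∀ i z, Mem 0 (permPlanes ε m (Equiv.swap 0 i) z) ↔
      (∀ j : TripleIndex ε, if (j : Fin 3) = i then z.1.1 j = 0 else z.1.2 j = 0) ∧
        z.2.2 = 0 := fun i z => by
    refine and_congr ⟨fun h j => ?_, fun h j => ?_⟩ Iff.rfl
    · have h1 := h (permIndex ε (Equiv.swap 0 i) j)
      have h2 : permIndex ε (Equiv.swap 0 i) (permIndex ε (Equiv.swap 0 i) j) = j :=
        Subtype.ext (Equiv.swap_apply_self _ _ _)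
      simp only [permPlanes, LinearMap.coe_mk, AddHom.coe_mk, h2, coe_permIndex] at h1
      rwa [if_congr (Equiv.eq_symm_apply _).symm rfl rfl, Equiv.symm_swap,
        Equiv.swap_apply_left] at h1
    · have h1 := h (permIndex ε (Equiv.swap 0 i) j)
      rw [coe_permIndex, if_congr (Equiv.eq_symm_apply _).symm rfl rfl, Equiv.symm_swap,
        Equiv.swap_apply_right] at h1
      exact h1
  -- A permutation of the planes puts the hyperbolic part in place. The symplectic condition `z.2.2
  -- = 0` is then turned into `z.2.2 = z.2.1` by one shear, and that into `z.2.1 = 0` by a second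
  -- one.
  obtain ⟨y₁, hy₁⟩ := hperm (Equiv.swap 0 1)
  obtain ⟨y₁', hy₁'⟩ := hsnd (-1) y₁
  obtain ⟨x₁, hx₁⟩ := hfst 1 y₁'
  obtain ⟨y₂, hy₂⟩ := hperm (Equiv.swap 0 2)
  obtain ⟨x₂, hx₂⟩ := hsnd (-1) y₂
  have hττ : ∀ j : TripleIndex ε,
      permIndex ε (Equiv.swap 1 2) (permIndex ε (Equiv.swap 1 2) j) = j :=
    fun j => Subtype.ext (Equiv.swap_apply_self _ _ _)
  have hcross : ∀ (z : TripleModel ε m) (j : TripleIndex ε), (j : Fin 3) ≠ 0 →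
      (crossPlanes ε m z).1.1 j = z.1.2 (permIndex ε (Equiv.swap 1 2) j) ∧
      (crossPlanes ε m z).1.2 j = z.1.1 (permIndex ε (Equiv.swap 1 2) j) := fun z j hj =>
    ⟨if_neg hj, if_neg hj⟩
  have hτ0 : ∀ j : TripleIndex ε, (j : Fin 3) ≠ 0 →
      (permIndex ε (Equiv.swap 1 2) j : Fin 3) ≠ 0 := fun j hj => by
    rwa [coe_permIndex, Ne, swap_eq_zero_iff]
  -- Relative to the base point, the subspace with all first hyperbolic coordinates zero has two
  -- planes flipped. Flipping one plane would leave the family; `crossPlanes` flips two at once and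
  -- has determinant one, as its invariant Lagrangian subspace shows. A shear then gives the slope
  -- `s`.
  obtain ⟨y₃, hy₃⟩ := exists_isotropicSpace_preimage hQ hθ (crossPlanes ε m) form_crossPlanes
    (lagrangianCross ε m) (by
      rintro z ⟨h1, h2⟩
      refine ⟨fun j => ⟨fun hj => ?_, fun hj => ?_, fun hj => ?_⟩, h2⟩
      · exact (if_pos hj).trans ((h1 j).1 hj)
      · have h0 : (j : Fin 3) ≠ 0 := by rw [hj]; decide
        rw [(hcross z j h0).1, (hcross z _ (hτ0 j h0)).2, hττ, (h1 j).2.1 hj]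
      · have h0 : (j : Fin 3) ≠ 0 := by rw [hj]; decide
        rw [(hcross z j h0).1, (hcross z _ (hτ0 j h0)).2, hττ, (h1 j).2.2 hj, neg_neg]) mem_lagrangianCross_iff P.basePoint
  refine ⟨![P.basePoint, x₁, x₂], θ, ⟨hθ, fun i z => ?_⟩, fun s => ?_⟩
  · fin_cases i
    · exact hbase z
    · change θ z ∈ P.isotropicSpace x₁ ↔ _
      rw [hx₁, hy₁', hy₁, hσ]
      refine and_congr Iff.rfl ?_
      simp [shearSnd, shearFst]
    · change θ z ∈ P.isotropicSpace x₂ ↔ _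
      rw [hx₂, hy₂, hσ]
      refine and_congr Iff.rfl ?_
      simp [shearSnd, ← sub_eq_add_neg, sub_eq_zero, eq_comm]
  · obtain ⟨y, hy⟩ := hsnd (-s) y₃
    refine ⟨y, fun z => ?_⟩
    rw [hy, hy₃, hbase]
    refine and_congr ⟨fun h => funext fun j => ?_, fun h j => ?_⟩ ?_
    · by_cases hj : (j : Fin 3) = 0
      · have h1 := h j
        rw [if_pos hj] at h1
        exact (if_pos hj).symm.trans h1
      · have h1 := h (permIndex ε (Equiv.swap 1 2) j)
        rw [if_neg (hτ0 j hj), (hcross _ _ (hτ0 j hj)).2, hττ] at h1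
        exact h1
    · by_cases hj : (j : Fin 3) = 0
      · rw [if_pos hj]
        exact (if_pos hj).trans (congrFun h j)
      · rw [if_neg hj, (hcross _ j hj).2]
        exact congrFun h _
    · simp [shearSnd, crossPlanes, ← sub_eq_add_neg, sub_eq_zero]

end Polarization

end

section

/-! ### The open orbit on triples -/

theorem exists_map_eq_one [FiniteDimensional ℂ V] {Q : QuadraticForm ℂ V} (hQ : Q.Nondegenerate)
    (hpos : 0 < Module.finrank ℂ V) : ∃ u, Q u = 1 := by
  have : Nontrivial V := Module.finrank_pos_iff.mp hpos
  by_contra! h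
  have h0 : ∀ v, Q v = 0 := fun v => by
    by_contra hv
    obtain ⟨c, u, -, hu, -⟩ := exists_smul_unit Q hv
    exact h u hu
  obtain ⟨v, hv⟩ := exists_ne (0 : V)
  exact hv (polar_separating hQ fun w => by simp [QuadraticMap.polar, h0])

/-- Two standard subspaces meet at most in the line of the first vector of the third plane. -/
theorem TripleModel.Mem.of_pair {ε : Prop} [Decidable ε] {m : ℕ} {i j : Fin 3} (hij : i ≠ j)
    {z : TripleModel ε m} (hi : TripleModel.Mem i z) (hj : TripleModel.Mem j z) :
    z.2 = 0 ∧ z.1.2 = 0 ∧ ∀ l : TripleIndex ε, ((l : Fin 3) = i ∨ (l : Fin 3) = j) → z.1.1 l = 0 := by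
  refine ⟨?_, funext fun l => ?_, fun l hl => ?_⟩
  · have h1 := hi.2
    have h2 := hj.2
    refine Prod.ext ?_ ?_ <;> fin_cases i <;> fin_cases j <;> simp_all
  · by_cases hl : (l : Fin 3) = i
    · have h1 := hj.1 l
      rwa [if_neg (hl ▸ hij)] at h1
    · have h1 := hi.1 l
      rwa [if_neg hl] at h1
  · rcases hl with hl | hl
    · have h1 := hi.1 l
      rwa [if_pos hl] at h1
    · have h1 := hj.1 l
      rwa [if_pos hl] at h1

theorem TripleModel.finrank_eq (ε : Prop) [Decidable ε] (m : ℕ) :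
    Module.finrank ℂ (TripleModel ε m) = 4 * m + if ε then 6 else 0 := by
  have h : Fintype.card (TripleIndex ε) = if ε then 3 else 0 := by
    split_ifs with hε
    · rw [Fintype.card_congr (Equiv.subtypeUnivEquiv fun _ => hε), Fintype.card_fin]
    · rw [Fintype.card_eq_zero_iff]
      exact ⟨fun j => hε j.2⟩
  simp only [Module.finrank_prod, Module.finrank_fintype_fun_eq_card, h, Fintype.card_sum,
    Fintype.card_fin]
  split_ifs <;> ring

namespace Polarization

variable [FiniteDimensional ℂ V] {Q : QuadraticForm ℂ V} {P : Polarization Q} {ε : Prop}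
  [Decidable ε] {m k n : ℕ}

theorem isOpen_setOf_forall_mem (s : Set (Fin k)) (B : Module.Dual ℂ V) :
    IsOpen[P.zariski k]
      {x | ∀ v, (∀ i ∈ s, v ∈ P.isotropicSpace (x i)) → B v = 0 → v = 0} := by
  classical
  convert P.isOpen_setOf_injective (fun i => if i ∈ s then LinearMap.id else 0) B using 8 with x v i
  by_cases hi : i ∈ s <;> simp [hi]

/-- The triples that admit a frame, within `k`-tuples. -/
def frameSet (P : Polarization Q) (ε : Prop) [Decidable ε] (m : ℕ) (ι : Fin 3 → Fin k) :
    Set (Fin k → P.SpinorVariety) :=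
  {x | ∃ θ : TripleModel ε m ≃ₗ[ℂ] V, IsTripleFrame Q (fun i => P.isotropicSpace (x (ι i))) θ}

theorem smul_mem_frameSet {ι : Fin 3 → Fin k} {x : Fin k → P.SpinorVariety}
    (hx : x ∈ P.frameSet ε m ι) (g : spinGroup Q) : g • x ∈ P.frameSet ε m ι := by
  obtain ⟨θ, hθ⟩ := hx
  refine ⟨θ.trans (spinGroup.toSO Q g : V ≃ₗ[ℂ] V), fun z w => ?_, fun i z => ?_⟩
  · rw [← hθ.polar_eq]
    exact polar_map_of_isometry (spinGroup.toSO Q g).2.1 _ _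
  · rw [← hθ.mem_iff]
    exact mem_isotropicSpace_smul_iff g _ _

theorem isOpen_frameSet_false (hQ : Q.Nondegenerate) (hrank : Module.finrank ℂ V = 4 * m)
    (ι : Fin 3 → Fin k) : IsOpen[P.zariski k] (P.frameSet False m ι) := by
  let := P.zariski k
  have h : P.frameSet False m ι = ⋂ i : Fin 3, ⋂ j : Fin 3, ⋂ _ : i ≠ j,
      {x | ∀ v, (∀ l ∈ ({ι i, ι j} : Set (Fin k)), v ∈ P.isotropicSpace (x l)) →
        (0 : Module.Dual ℂ V) v = 0 → v = 0} := by
    ext x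
    simp only [Set.mem_iInter, Set.mem_ofPred_eq, Set.mem_insert_iff, Set.mem_singleton_iff,
      forall_eq_or_imp, forall_eq]
    constructor
    · rintro ⟨θ, hθ⟩ i j hij v ⟨hi, hj⟩ -
      obtain ⟨z, rfl⟩ := θ.surjective v
      have hz := ((hθ.mem_iff i z).mp hi).of_pair hij ((hθ.mem_iff j z).mp hj)
      have : z = 0 := Prod.ext (Prod.ext (funext fun l => l.2.elim) hz.2.1) hz.1
      rw [this, map_zero]
    · intro h
      exact exists_tripleFrame_of_disjoint hQ (fun i => isLagrangian_isotropicSpace hQ _)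
        (fun i j hij => Submodule.disjoint_def.mpr fun v hi hj => h i j hij v ⟨hi, hj⟩ rfl) hrank
  rw [h]
  exact isOpen_iInter_of_finite fun i => isOpen_iInter_of_finite fun j =>
    isOpen_iInter_of_finite fun _ => isOpen_setOf_forall_mem _ _

theorem isOpen_frameSet_true (hQ : Q.Nondegenerate) (hrank : Module.finrank ℂ V = 4 * m + 6)
    (ι : Fin 3 → Fin k) : IsOpen[P.zariski k] (P.frameSet True m ι) := by
  let := P.zariski k
  -- An intersection of dimension at most one is one on which some linear form `B` is injective: a
  -- union of open conditions.
  have h : P.frameSet True m ι = (⋂ i : Fin 3, ⋂ j : Fin 3, ⋂ _ : i ≠ j, ⋃ B : Module.Dual ℂ V,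
      {x | ∀ v, (∀ l ∈ ({ι i, ι j} : Set (Fin k)), v ∈ P.isotropicSpace (x l)) →
        B v = 0 → v = 0}) ∩
      {x | ∀ v, (∀ l ∈ Set.range ι, v ∈ P.isotropicSpace (x l)) →
        (0 : Module.Dual ℂ V) v = 0 → v = 0} := by
    ext x
    simp only [Set.mem_inter_iff, Set.mem_iInter, Set.mem_iUnion, Set.mem_ofPred_eq,
      Set.mem_insert_iff, Set.mem_singleton_iff, forall_eq_or_imp, forall_eq, Set.forall_mem_range]
    constructor
    · rintro ⟨θ, hθ⟩
      refine ⟨fun i j hij => ?_, fun v hv _ => ?_⟩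
      · obtain ⟨k, hk⟩ : ∃ k : Fin 3, ∀ l, l ≠ k → l = i ∨ l = j := by
          revert i j; decide
        refine ⟨LinearMap.proj ⟨k, trivial⟩ ∘ₗ LinearMap.fst ℂ _ _ ∘ₗ LinearMap.fst ℂ _ _ ∘ₗ
          θ.symm.toLinearMap, fun v hv hB => ?_⟩
        obtain ⟨z, rfl⟩ := θ.surjective v
        have hz := ((hθ.mem_iff i z).mp hv.1).of_pair hij ((hθ.mem_iff j z).mp hv.2)
        have hB : z.1.1 ⟨k, trivial⟩ = 0 := by simpa using hB
        have : z = 0 := by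
          refine Prod.ext (Prod.ext (funext fun l => ?_) hz.2.1) hz.1
          by_cases hl : (l : Fin 3) = k
          · subst hl; exact hB
          · exact hz.2.2 l (hk _ hl)
        rw [this, map_zero]
      · obtain ⟨z, rfl⟩ := θ.surjective v
        have h1 := fun i => (hθ.mem_iff i z).mp (hv i)
        have h01 := (h1 0).of_pair (by decide : (0 : Fin 3) ≠ 1) (h1 1)
        have : z = 0 := by
          refine Prod.ext (Prod.ext (funext fun l => ?_) h01.2.1) h01.1
          have h2 := (h1 l).1 l
          rwa [if_pos rfl] at h2
        rw [this, map_zero]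
    · rintro ⟨h1, h2⟩
      -- That the intersections are not zero would not be an open condition, but it is automatic
      -- because `2m + 3` is odd.
      refine exists_tripleFrame_of_lines hQ (fun i => isLagrangian_isotropicSpace hQ _)
        (fun i j => not_disjoint_isotropicSpace hQ (n := 2 * m + 3) (by omega)
          (by rw [Nat.not_even_iff_odd]; exact ⟨m + 1, by omega⟩) _ _) (fun i j hij => ?_)
        (fun v hv => h2 v hv rfl) hrank
      obtain ⟨B, hB⟩ := h1 i j hij
      exact ⟨B, fun v hi hj => hB v ⟨hi, hj⟩⟩
  rw [h]
  exact (isOpen_iInter_of_finite fun i => isOpen_iInter_of_finite fun j =>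
    isOpen_iInter_of_finite fun _ => isOpen_iUnion fun B => isOpen_setOf_forall_mem _ _).inter
      (isOpen_setOf_forall_mem _ _)

theorem isOpen_frameSet (hQ : Q.Nondegenerate)
    (hrank : Module.finrank ℂ (TripleModel ε m) = Module.finrank ℂ V) (ι : Fin 3 → Fin k) :
    IsOpen[P.zariski k] (P.frameSet ε m ι) := by
  rw [TripleModel.finrank_eq] at hrank
  by_cases hε : ε
  · rw [if_pos hε] at hrank
    obtain rfl : ε = True := eq_true hε
    convert isOpen_frameSet_true (P := P) hQ (m := m) hrank.symm ι
  · rw [if_neg hε] at hrank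
    obtain rfl : ε = False := eq_false hε
    convert isOpen_frameSet_false (P := P) hQ (m := m) hrank.symm ι

/-- The triples in normal form are a single open dense orbit. -/
theorem exists_orbit_eq_frameSet (P : Polarization Q) (hQ : Q.Nondegenerate)
    (hrank : Module.finrank ℂ (TripleModel ε m) = Module.finrank ℂ V)
    (hpos : 0 < Module.finrank ℂ V) :
    ∃ x : Fin 3 → P.SpinorVariety, MulAction.orbit (spinGroup Q) x = P.frameSet ε m id ∧
      IsOpen[P.zariski 3] (MulAction.orbit (spinGroup Q) x) ∧
      @Dense _ (P.zariski 3) (MulAction.orbit (spinGroup Q) x) := by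
  obtain ⟨x, θ, hθ, -⟩ := P.exists_isTripleFrame hQ hrank
  have hx : x ∈ P.frameSet ε m id := ⟨θ, hθ⟩
  have horbit : MulAction.orbit (spinGroup Q) x = P.frameSet ε m id := by
    ext y
    constructor
    · rintro ⟨g, rfl⟩
      exact smul_mem_frameSet hx g
    · rintro ⟨θ', hθ'⟩
      exact exists_smul_eq_of_isTripleFrame hQ hθ hθ'
  have hopen := isOpen_frameSet (P := P) hQ hrank id
  obtain ⟨u₀, hu₀⟩ := exists_map_eq_one hQ hpos
  exact ⟨x, horbit, horbit ▸ hopen, horbit ▸ dense_of_isOpen hu₀ hopen ⟨x, hx⟩⟩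

/-- For `n = 1` the annihilators are lines that are never disjoint, by parity, so they coincide. -/
theorem subsingleton_spinorVariety (P : Polarization Q) (hQ : Q.Nondegenerate)
    (hrank : Module.finrank ℂ V = 2) : Subsingleton P.SpinorVariety := by
  refine ⟨fun x y => isotropicSpace_injective hQ ?_⟩
  have h1 : ∀ x, Module.finrank ℂ (P.isotropicSpace x) = 1 := fun x =>
    finrank_isotropicSpace hQ (n := 1) (by omega) x
  have h2 := not_disjoint_isotropicSpace hQ (n := 1) (by omega) (by decide) x y
  rw [disjoint_iff, ← Ne, ← Submodule.one_le_finrank_iff] at h2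
  exact (Submodule.eq_of_le_of_finrank_le inf_le_left (by rw [h1]; exact h2)).symm.trans
    (Submodule.eq_of_le_of_finrank_le inf_le_right (by rw [h1]; exact h2))

end Polarization

end

section

/-! ### The stabilizer of a triple in normal form -/

theorem _root_.LinearMap.toMatrix'_mem_symplecticGroup_iff {m : ℕ}
    (f : (Fin m ⊕ Fin m → ℂ) →ₗ[ℂ] (Fin m ⊕ Fin m → ℂ)) :
    LinearMap.toMatrix' f ∈ Matrix.symplecticGroup (Fin m) ℂ ↔
      ∀ x y, standardSymplectic m (f x) (f y) = standardSymplectic m x y := by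
  rw [SymplecticGroup.mem_iff']
  have h : Matrix.toBilin' ((LinearMap.toMatrix' f).transpose * Matrix.J (Fin m) ℂ *
      LinearMap.toMatrix' f) = (standardSymplectic m).comp f f := by
    rw [← Matrix.toBilin'_comp, Matrix.toLin'_toMatrix']
    rfl
  rw [← Matrix.toBilin'.injective.eq_iff, h]
  constructor
  · intro h x y
    exact LinearMap.congr_fun₂ h x y
  · intro h
    exact LinearMap.ext₂ h

theorem mem_stabilizer_iff_of_isLagrangian {Q : QuadraticForm ℂ V} {κ : Type*}
    {H : κ → Submodule ℂ V} (hH : ∀ i, IsLagrangian Q (H i)) (T : specialOrthogonalGroup Q) :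
    T ∈ MulAction.stabilizer (specialOrthogonalGroup Q) H ↔
      ∀ i, ∀ v ∈ H i, (T : V ≃ₗ[ℂ] V) v ∈ H i := by
  rw [MulAction.mem_stabilizer_iff, funext_iff]
  refine forall_congr' fun i => ?_
  have h : (T • H) i = (H i).map ((T : V ≃ₗ[ℂ] V) : V →ₗ[ℂ] V) := rfl
  rw [h]
  constructor
  · intro h v hv
    rw [← h]
    exact ⟨v, hv, rfl⟩
  · intro h
    refine ((hH i).map T.2.1).eq_of_le (hH i) ?_
    rintro _ ⟨v, hv, rfl⟩
    exact h v hv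

namespace IsTripleFrame

variable [FiniteDimensional ℂ V] {Q : QuadraticForm ℂ V} {H : Fin 3 → Submodule ℂ V} {m : ℕ}
  {θ : TripleModel False m ≃ₗ[ℂ] V}

theorem mem_zero_iff (hθ : IsTripleFrame Q H θ) (z : TripleModel False m) :
    θ z ∈ H 0 ↔ z.2.2 = 0 := by
  rw [hθ.mem_iff]
  exact and_iff_right fun j => j.2.elim

theorem mem_one_iff (hθ : IsTripleFrame Q H θ) (z : TripleModel False m) :
    θ z ∈ H 1 ↔ z.2.1 = 0 := by
  rw [hθ.mem_iff]
  exact and_iff_right fun j => j.2.elim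

theorem mem_two_iff (hθ : IsTripleFrame Q H θ) (z : TripleModel False m) :
    θ z ∈ H 2 ↔ z.2.1 = z.2.2 := by
  rw [hθ.mem_iff]
  exact and_iff_right fun j => j.2.elim

/-- The linear map induced on the symplectic space by a linear automorphism. -/
def action (θ : TripleModel False m ≃ₗ[ℂ] V) (T : V ≃ₗ[ℂ] V) :
    (Fin m ⊕ Fin m → ℂ) →ₗ[ℂ] (Fin m ⊕ Fin m → ℂ) :=
  LinearMap.fst ℂ _ _ ∘ₗ LinearMap.snd ℂ _ _ ∘ₗ θ.symm.toLinearMap ∘ₗ T.toLinearMap ∘ₗ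
    θ.toLinearMap ∘ₗ LinearMap.inr ℂ _ _ ∘ₗ LinearMap.inl ℂ _ _

theorem action_apply (θ : TripleModel False m ≃ₗ[ℂ] V) (T : V ≃ₗ[ℂ] V) (k : Fin m ⊕ Fin m → ℂ) :
    action θ T k = (θ.symm (T (θ (0, (k, 0))))).2.1 := rfl

/-- Preserving `H 0` and `H 1` makes `T` block diagonal, and preserving the diagonal `H 2` makes the
two blocks equal. -/
theorem apply_eq (hθ : IsTripleFrame Q H θ) {T : V ≃ₗ[ℂ] V} (hT : ∀ i, ∀ v ∈ H i, T v ∈ H i)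
    (z : TripleModel False m) : T (θ z) = θ (0, (action θ T z.2.1, action θ T z.2.2)) := by
  have hz : ∀ z w : TripleModel False m, z.2 = w.2 → z = w := fun z w h =>
    Prod.ext (Subsingleton.elim _ _) h
  let τ : TripleModel False m →ₗ[ℂ] TripleModel False m :=
    θ.symm.toLinearMap ∘ₗ T.toLinearMap ∘ₗ θ.toLinearMap
  have hτ : ∀ z, θ (τ z) = T (θ z) := fun z => θ.apply_symm_apply _
  have h0 : ∀ a, τ (0, (a, 0)) = (0, (action θ T a, 0)) := fun a => by
    refine hz _ _ (Prod.ext rfl ?_)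
    rw [← hθ.mem_zero_iff, hτ]
    exact hT 0 _ ((hθ.mem_zero_iff _).mpr rfl)
  have h1 : ∀ b, (τ (0, (0, b))).2.1 = 0 := fun b => by
    rw [← hθ.mem_one_iff, hτ]
    exact hT 1 _ ((hθ.mem_one_iff _).mpr rfl)
  have h2 : ∀ b, (τ (0, (b, b))).2.1 = (τ (0, (b, b))).2.2 := fun b => by
    rw [← hθ.mem_two_iff, hτ]
    exact hT 2 _ ((hθ.mem_two_iff _).mpr rfl)
  have hadd : ∀ a b, τ (0, (a, b)) = τ (0, (a, 0)) + τ (0, (0, b)) := fun a b => by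
    rw [← map_add]; simp
  have h3 : ∀ b, τ (0, (0, b)) = (0, (0, action θ T b)) := fun b => by
    refine hz _ _ (Prod.ext (h1 b) ?_)
    have h := h2 b
    rw [hadd, h0] at h
    simpa [h1] using h.symm
  rw [← hτ, hz z (0, (z.2.1, z.2.2)) rfl, hadd, h0, h3]
  simp

theorem polar_zero (hθ : IsTripleFrame Q H θ) (x y : TripleModel False m) :
    QuadraticMap.polar Q (θ x) (θ y) =
      standardSymplectic m x.2.2 y.2.1 + standardSymplectic m y.2.2 x.2.1 := by
  simp [hθ.polar_eq, TripleModel.form]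

/-- The basis of the first subspace given by a frame. -/
theorem exists_basis (hθ : IsTripleFrame Q H θ) :
    ∃ b : Module.Basis (Fin m ⊕ Fin m) ℂ (H 0), ∀ j, (b j : V) = θ (0, (Pi.single j 1, 0)) := by
  let f : (Fin m ⊕ Fin m → ℂ) →ₗ[ℂ] H 0 :=
    (θ.toLinearMap ∘ₗ LinearMap.inr ℂ _ _ ∘ₗ LinearMap.inl ℂ _ _).codRestrict (H 0) fun k =>
      (hθ.mem_zero_iff _).mpr rfl
  have hf : ∀ k, (f k : V) = θ (0, (k, 0)) := fun _ => rfl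
  have hbij : Function.Bijective f := by
    constructor
    · intro k l hkl
      have h : θ (0, (k, 0)) = θ (0, (l, 0)) := by rw [← hf, ← hf, hkl]
      simpa using θ.injective h
    · rintro ⟨v, hv⟩
      obtain ⟨z, rfl⟩ := θ.surjective v
      refine ⟨z.2.1, Subtype.ext ?_⟩
      rw [hf]
      congr 1
      exact Prod.ext (Subsingleton.elim _ _) (Prod.ext rfl ((hθ.mem_zero_iff z).mp hv).symm)
  refine ⟨(Pi.basisFun ℂ _).map (LinearEquiv.ofBijective f hbij), fun j => ?_⟩
  rw [Module.Basis.map_apply, Pi.basisFun_apply]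
  exact hf _

/-- The stabilizer of a triple in normal form is the symplectic group. -/
theorem exists_stabilizer_equiv (hQ : Q.Nondegenerate) (hH : ∀ i, IsLagrangian Q (H i))
    (hθ : IsTripleFrame Q H θ) (b : Module.Basis (Fin m ⊕ Fin m) ℂ (H 0))
    (hb : ∀ j, (b j : V) = θ (0, (Pi.single j 1, 0))) :
    ∃ Ψ : MulAction.stabilizer (specialOrthogonalGroup Q) H ≃*
        Matrix.symplecticGroup (Fin m) ℂ,
      ∀ (T : MulAction.stabilizer (specialOrthogonalGroup Q) H) (j : Fin m ⊕ Fin m),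
        ((T : specialOrthogonalGroup Q) : V ≃ₗ[ℂ] V) (b j) =
          ∑ i, (Ψ T : Matrix (Fin m ⊕ Fin m) (Fin m ⊕ Fin m) ℂ) i j • (b i : V) := by
  have hstab : ∀ (T : MulAction.stabilizer (specialOrthogonalGroup Q) H) z,
      ((T : specialOrthogonalGroup Q) : V ≃ₗ[ℂ] V) (θ z) =
        θ (0, (action θ (T : specialOrthogonalGroup Q) z.2.1,
          action θ (T : specialOrthogonalGroup Q) z.2.2)) := fun T z =>
    hθ.apply_eq ((mem_stabilizer_iff_of_isLagrangian hH _).mp T.2) z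
  let Ψ₀ : MulAction.stabilizer (specialOrthogonalGroup Q) H →*
      Matrix.symplecticGroup (Fin m) ℂ := MonoidHom.mk'
    (fun T => ⟨LinearMap.toMatrix' (action θ (T : specialOrthogonalGroup Q)), by
      rw [LinearMap.toMatrix'_mem_symplecticGroup_iff]
      intro x y
      have h := polar_map_of_isometry (T : specialOrthogonalGroup Q).2.1
        (θ (0, (0, x))) (θ (0, (y, 0)))
      rw [hstab, hstab, hθ.polar_zero, hθ.polar_zero] at h
      simpa using h⟩) (by
      intro S T
      apply Subtype.ext
      change LinearMap.toMatrix' _ = LinearMap.toMatrix' _ * LinearMap.toMatrix' _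
      rw [← LinearMap.toMatrix'_mul]
      congr 1
      refine LinearMap.ext fun k => ?_
      have h : ((S * T : MulAction.stabilizer (specialOrthogonalGroup Q) H) :
          specialOrthogonalGroup Q).1 (θ (0, (k, 0))) = S.1.1 (T.1.1 (θ (0, (k, 0)))) := rfl
      rw [hstab T, hstab S] at h
      rw [action_apply, h, θ.symm_apply_apply]
      rfl)
  have hΨ₀ : ∀ T, (Ψ₀ T : Matrix (Fin m ⊕ Fin m) (Fin m ⊕ Fin m) ℂ) =
      LinearMap.toMatrix' (action θ (T : specialOrthogonalGroup Q)) := fun _ => rfl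
  have hbij : Function.Bijective Ψ₀ := by
    constructor
    · intro S T hST
      have h : action θ (S : specialOrthogonalGroup Q) = action θ (T : specialOrthogonalGroup Q) :=
        LinearMap.toMatrix'.injective (congrArg Subtype.val hST)
      refine Subtype.ext (Subtype.ext (LinearEquiv.ext fun v => ?_))
      obtain ⟨z, rfl⟩ := θ.surjective v
      rw [hstab S, hstab T, h]
    · rintro ⟨A, hA⟩
      let f := Matrix.toLin' A
      have hfA : LinearMap.toMatrix' f = A := LinearMap.toMatrix'_toLin' A
      have hf : ∀ x y, standardSymplectic m (f x) (f y) = standardSymplectic m x y := by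
        rw [← LinearMap.toMatrix'_mem_symplecticGroup_iff, hfA]
        exact hA
      -- Conversely, `A ⊕ A` with `A` symplectic respects the form and the three standard subspaces.
      let τ₀ : TripleModel False m →ₗ[ℂ] V :=
        θ.toLinearMap ∘ₗ LinearMap.prodMap LinearMap.id (LinearMap.prodMap f f)
      have hτ₀ : ∀ z, τ₀ z = θ (z.1, (f z.2.1, f z.2.2)) := fun _ => rfl
      have hτ₀' : ∀ x y, QuadraticMap.polar Q (τ₀ x) (τ₀ y) = TripleModel.form x y :=
        fun x y => by rw [hτ₀, hτ₀, hθ.polar_zero, hf, hf, ← hθ.polar_zero, hθ.polar_eq]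
      obtain ⟨τ, hτ⟩ := exists_linearEquiv_of_form τ₀ (QuadraticMap.polar Q)
        (fun y => QuadraticMap.polar_zero_left Q y)
        (fun x hx => TripleModel.eq_zero_of_form_eq_zero x fun y =>
          (hτ₀' x y).symm.trans (hx y)) θ.finrank_eq
      let T : V ≃ₗ[ℂ] V := θ.symm.trans τ
      have hTθ : ∀ z, T (θ z) = θ (z.1, (f z.2.1, f z.2.2)) := fun z => by
        rw [← hτ₀, ← hτ, LinearEquiv.trans_apply, θ.symm_apply_apply]
      have hT : ∀ v, Q (T v) = Q v := by
        apply isometry_of_polar_eq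
        intro v w
        obtain ⟨x, rfl⟩ := θ.surjective v
        obtain ⟨y, rfl⟩ := θ.surjective w
        rw [hTθ, hTθ, ← hτ₀, ← hτ₀, hτ₀', hθ.polar_eq]
      have hTH : ∀ i, ∀ v ∈ H i, T v ∈ H i := by
        intro i v hv
        obtain ⟨z, rfl⟩ := θ.surjective v
        rw [hTθ]
        fin_cases i
        · refine (hθ.mem_zero_iff _).mpr ?_
          have h := (hθ.mem_zero_iff _).mp hv
          simp [h]
        · refine (hθ.mem_one_iff _).mpr ?_
          have h := (hθ.mem_one_iff _).mp hv
          simp [h]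
        · refine (hθ.mem_two_iff _).mpr ?_
          have h := (hθ.mem_two_iff _).mp hv
          simp [h]
      refine ⟨⟨⟨T, hT, (hH 0).det_eq_one hQ hT (hTH 0)⟩,
        (mem_stabilizer_iff_of_isLagrangian hH _).mpr hTH⟩, Subtype.ext ?_⟩
      refine (congrArg LinearMap.toMatrix' ?_).trans hfA
      refine LinearMap.ext fun k => ?_
      rw [action_apply]
      change (θ.symm (T (θ _))).2.1 = _
      rw [hTθ, θ.symm_apply_apply]
  refine ⟨MulEquiv.ofBijective Ψ₀ hbij, fun T j => ?_⟩
  rw [MulEquiv.ofBijective_apply, hΨ₀, hb, hstab]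
  simp only [hb, ← map_smul, ← map_sum, map_zero, LinearMap.toMatrix'_apply]
  congr 1
  refine Prod.ext (Subsingleton.elim _ _) ?_
  rw [Prod.snd_sum]
  refine Prod.ext ?_ ?_
  · rw [Prod.fst_sum]
    funext l
    simp [Pi.single_apply, Finset.sum_apply]
  · rw [Prod.snd_sum]
    simp

end IsTripleFrame

namespace Polarization

variable [FiniteDimensional ℂ V] {Q : QuadraticForm ℂ V} {P : Polarization Q} {k : ℕ}

theorem toSO_mem_stabilizer_iff (hQ : Q.Nondegenerate) (y : Fin k → P.SpinorVariety)
    (g : spinGroup Q) :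
    spinGroup.toSO Q g ∈ MulAction.stabilizer (specialOrthogonalGroup Q)
      (fun i => P.isotropicSpace (y i)) ↔ g ∈ MulAction.stabilizer (spinGroup Q) y := by
  rw [mem_stabilizer_iff_of_isLagrangian fun i => isLagrangian_isotropicSpace hQ _]
  constructor
  · exact fun h => funext fun i => smul_eq_of_isotropicSpace hQ (h i)
  · intro h i v hv
    have h1 := (mem_isotropicSpace_smul_iff g (y i) v).mpr hv
    rwa [show g • y i = y i from congrFun h i] at h1

/-- The stabilizer in the spin group is the full preimage under `spinGroup.toSO` of the stabilizer
of the subspaces. So surjectivity and the kernel `{1, -1}` are inherited by the composition with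
`Ψ`. -/
theorem exists_symplectic_stabilizer (hQ : Q.Nondegenerate) {m : ℕ} {y : Fin 3 → P.SpinorVariety}
    (hy : y ∈ P.frameSet False m id) :
    ∃ b : Module.Basis (Fin m ⊕ Fin m) ℂ (P.isotropicSpace (y 0)),
      (∃ Φ : MulAction.stabilizer (spinGroup Q) y →* Matrix.symplecticGroup (Fin m) ℂ,
        Function.Surjective Φ ∧
        (∀ g, Φ g = 1 ↔
          ((g : spinGroup Q) : CliffordAlgebra Q) = 1 ∨
          ((g : spinGroup Q) : CliffordAlgebra Q) = -1) ∧
        ∀ (g : MulAction.stabilizer (spinGroup Q) y) (j : Fin m ⊕ Fin m),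
          ((g : spinGroup Q) : CliffordAlgebra Q) * CliffordAlgebra.ι Q (b j) *
            (((g : spinGroup Q)⁻¹ : spinGroup Q) : CliffordAlgebra Q) =
          CliffordAlgebra.ι Q
            (∑ i, (Φ g : Matrix (Fin m ⊕ Fin m) (Fin m ⊕ Fin m) ℂ) i j • (b i : V))) ∧
      (∃ Ψ : MulAction.stabilizer (specialOrthogonalGroup Q)
            (fun i => P.isotropicSpace (y i)) ≃* Matrix.symplecticGroup (Fin m) ℂ,
        ∀ (T : MulAction.stabilizer (specialOrthogonalGroup Q)
            (fun i => P.isotropicSpace (y i))) (j : Fin m ⊕ Fin m),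
          ((T : specialOrthogonalGroup Q) : V ≃ₗ[ℂ] V) (b j) =
            ∑ i, (Ψ T : Matrix (Fin m ⊕ Fin m) (Fin m ⊕ Fin m) ℂ) i j • (b i : V)) := by
  obtain ⟨θ, hθ⟩ := hy
  obtain ⟨b, hb⟩ := hθ.exists_basis
  obtain ⟨Ψ, hΨ⟩ := hθ.exists_stabilizer_equiv hQ (fun i => isLagrangian_isotropicSpace hQ _) b hb
  let r : MulAction.stabilizer (spinGroup Q) y →*
      MulAction.stabilizer (specialOrthogonalGroup Q) (fun i => P.isotropicSpace (y i)) :=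
    ((spinGroup.toSO Q).comp (MulAction.stabilizer (spinGroup Q) y).subtype).codRestrict _
      fun g => (toSO_mem_stabilizer_iff hQ y _).mpr g.2
  have hr : ∀ g, ((r g : specialOrthogonalGroup Q)) = spinGroup.toSO Q g := fun _ => rfl
  refine ⟨b, ⟨Ψ.toMonoidHom.comp r, ?_, fun g => ?_, fun g j => ?_⟩, Ψ, hΨ⟩
  · refine Ψ.surjective.comp fun T => ?_
    obtain ⟨g, hg⟩ := spinGroup.toSO_surjective hQ (T : specialOrthogonalGroup Q)
    exact ⟨⟨g, (toSO_mem_stabilizer_iff hQ y g).mp (hg ▸ T.2)⟩, Subtype.ext hg⟩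
  · rw [← spinGroup.toSO_eq_one_iff hQ, ← hr, OneMemClass.coe_eq_one]
    exact MulEquiv.map_eq_one_iff Ψ
  · rw [spinGroup.mul_ι_mul_inv, ← hr]
    exact congrArg _ (hΨ (r g) j)

end Polarization

end

section

/-! ### There is no open orbit on quadruples -/

/-- If `π₁` is invertible, this is an eigenvector of `π₁⁻¹ π₂`; otherwise a vector of the kernel of
`π₁` serves, with `(s : t) = (0 : 1)`. -/
theorem exists_pencil_eigenvector {X K : Type*} [AddCommGroup X] [Module ℂ X]
    [FiniteDimensional ℂ X] [AddCommGroup K] [Module ℂ K] [FiniteDimensional ℂ K]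
    (π₁ π₂ : X →ₗ[ℂ] K) (h : Module.finrank ℂ K ≤ Module.finrank ℂ X)
    (hpos : 0 < Module.finrank ℂ X) :
    ∃ (x : X) (s t : ℂ) (k : K), x ≠ 0 ∧ (s ≠ 0 ∨ t ≠ 0) ∧ π₁ x = s • k ∧ π₂ x = t • k := by
  by_cases hinj : Function.Injective π₁
  · have hrank : Module.finrank ℂ X = Module.finrank ℂ K :=
      le_antisymm (LinearMap.finrank_le_finrank_of_injective hinj) h
    let e := LinearEquiv.ofInjectiveOfFinrankEq π₁ hinj hrank
    have : Nontrivial X := Module.finrank_pos_iff.mp hpos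
    obtain ⟨μ, hμ⟩ := Module.End.exists_eigenvalue (e.symm.toLinearMap ∘ₗ π₂)
    obtain ⟨x, hx⟩ := hμ.exists_hasEigenvector
    refine ⟨x, 1, μ, π₁ x, hx.2, .inl one_ne_zero, (one_smul _ _).symm, ?_⟩
    have h1 : e.symm (π₂ x) = μ • x := hx.apply_eq_smul
    rw [LinearEquiv.symm_apply_eq, map_smul] at h1
    exact h1
  · rw [injective_iff_map_eq_zero] at hinj
    push Not at hinj
    obtain ⟨x, hx, hx0⟩ := hinj
    exact ⟨x, 0, 1, π₂ x, hx0, .inr one_ne_zero, by rw [hx, zero_smul], (one_smul _ _).symm⟩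

namespace TripleModel

variable {ε : Prop} [Decidable ε] {m : ℕ}

/-- Vectors of the coordinate space with proportional symplectic components. -/
def pencil (ε : Prop) (m : ℕ) (r : Fin 3 → ℂ) (s t : ℂ) :
    ((TripleIndex ε → ℂ) × (Fin m ⊕ Fin m → ℂ)) →ₗ[ℂ] TripleModel ε m where
  toFun x := ((fun j => r j * x.1 j, 0), (s • x.2, t • x.2))
  map_add' x y := by ext <;> simp [mul_add]
  map_smul' c x := by ext <;> simp [mul_left_comm]

/-- The pairs `(u, v)` with `u`, `v`, `u + v` in the three standard subspaces. -/
def splitting (ε : Prop) (m : ℕ) :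
    ((TripleIndex ε → ℂ) × (Fin m ⊕ Fin m → ℂ)) →ₗ[ℂ] TripleModel ε m × TripleModel ε m :=
  (pencil ε m ![0, 1, 1] 1 0).prod (pencil ε m ![1, 0, -1] 0 1)

theorem splitting_combination (s t : ℂ) (x : (TripleIndex ε → ℂ) × (Fin m ⊕ Fin m → ℂ)) :
    s • (splitting ε m x).1 + t • (splitting ε m x).2 = pencil ε m ![t, s, s - t] s t x := by
  refine Prod.ext (Prod.ext (funext fun j => ?_) ?_) (Prod.ext ?_ ?_)
  · obtain ⟨j, hj⟩ := j
    fin_cases j <;> simp [splitting, pencil]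
    ring
  all_goals simp [splitting, pencil]

theorem mem_splitting (x : (TripleIndex ε → ℂ) × (Fin m ⊕ Fin m → ℂ)) :
    Mem 0 (splitting ε m x).1 ∧ Mem 1 (splitting ε m x).2 ∧
      Mem 2 ((splitting ε m x).1 + (splitting ε m x).2) := by
  have h := splitting_combination 1 1 x
  rw [one_smul, one_smul] at h
  rw [h]
  refine ⟨⟨fun ⟨j, hj⟩ => ?_, ?_⟩, ⟨fun ⟨j, hj⟩ => ?_, ?_⟩, ⟨fun ⟨j, hj⟩ => ?_, ?_⟩⟩
  all_goals try fin_cases j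
  all_goals simp [splitting, pencil]

/-- With `mem_splitting` and injectivity, `splitting` parametrizes all such pairs, so the pencil
condition on a quadruple becomes a linear system in `n` unknowns. -/
theorem exists_splitting {u v : TripleModel ε m} (hu : Mem 0 u) (hv : Mem 1 v)
    (huv : Mem 2 (u + v)) : ∃ x, splitting ε m x = (u, v) := by
  refine ⟨(fun j => if (j : Fin 3) = 0 then v.1.1 j else u.1.1 j, u.2.1), ?_⟩
  have h1 : u.2.2 = 0 := hu.2
  have h2 : v.2.1 = 0 := hv.2
  have h3 : u.2.1 + v.2.1 = u.2.2 + v.2.2 := huv.2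
  rw [h1, h2, add_zero, zero_add] at h3
  refine Prod.ext (Prod.ext (Prod.ext (funext fun ⟨j, hj⟩ => ?_) (funext fun ⟨j, hj⟩ => ?_)) ?_)
    (Prod.ext (Prod.ext (funext fun ⟨j, hj⟩ => ?_) (funext fun ⟨j, hj⟩ => ?_)) ?_)
  on_goal 3 => simp [splitting, pencil, h1, Prod.ext_iff]
  on_goal 5 => simp [splitting, pencil, h2, h3, Prod.ext_iff]
  all_goals
    have hu := hu.1 ⟨j, hj⟩
    have hv := hv.1 ⟨j, hj⟩
    have huv := huv.1 ⟨j, hj⟩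
    fin_cases j <;> simp [splitting, pencil] at hu hv huv ⊢ <;> grind

theorem splitting_injective : Function.Injective (splitting ε m) := by
  rw [injective_iff_map_eq_zero]
  intro x hx
  have h1 := congrArg Prod.fst hx
  have h2 := congrArg Prod.snd hx
  refine Prod.ext (funext fun ⟨j, hj⟩ => ?_) ?_
  · have h3 := congrFun (congrArg (fun z => z.1.1) h1) ⟨j, hj⟩
    have h4 := congrFun (congrArg (fun z => z.1.1) h2) ⟨j, hj⟩
    fin_cases j <;> simp [splitting, pencil] at h3 h4 ⊢ <;> assumption
  · simpa [splitting, pencil] using congrArg (fun z => z.2.1) h1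

end TripleModel

namespace Polarization

variable [FiniteDimensional ℂ V] {Q : QuadraticForm ℂ V} {P : Polarization Q} {ε : Prop}
  [Decidable ε] {m k n : ℕ}

/-- By irreducibility an open orbit meets every nonempty open set, and if that set is invariant it
contains the whole orbit. -/
theorem mem_of_isOpen_orbit (hQ : Q.Nondegenerate) (hpos : 0 < Module.finrank ℂ V)
    {x : Fin k → P.SpinorVariety} (hx : IsOpen[P.zariski k] (MulAction.orbit (spinGroup Q) x))
    {U : Set (Fin k → P.SpinorVariety)} (hU : IsOpen[P.zariski k] U) (hne : U.Nonempty)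
    (hinv : ∀ (g : spinGroup Q), ∀ y ∈ U, g • y ∈ U) : x ∈ U := by
  obtain ⟨u₀, hu₀⟩ := exists_map_eq_one hQ hpos
  obtain ⟨y, ⟨g, hg⟩, hy⟩ := inter_nonempty_of_isOpen hu₀ hx hU ⟨x, MulAction.mem_orbit_self x⟩ hne
  have h := hinv g⁻¹ y hy
  rw [← hg] at h
  simpa using h

/-- The quadruples for which a linear system on pairs of vectors has no solution but zero. -/
def pencilSet (P : Polarization Q) (s t : ℂ) (B : Module.Dual ℂ (V × V)) :
    Set (Fin 4 → P.SpinorVariety) :=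
  {x | ∀ c : V × V, c.1 ∈ P.isotropicSpace (x 0) → c.2 ∈ P.isotropicSpace (x 1) →
    c.1 + c.2 ∈ P.isotropicSpace (x 2) → s • c.1 + t • c.2 ∈ P.isotropicSpace (x 3) →
    B c = 0 → c = 0}

theorem isOpen_pencilSet (s t : ℂ) (B : Module.Dual ℂ (V × V)) :
    IsOpen[P.zariski 4] (P.pencilSet s t B) := by
  convert P.isOpen_setOf_injective ![LinearMap.fst ℂ V V, LinearMap.snd ℂ V V,
    LinearMap.fst ℂ V V + LinearMap.snd ℂ V V,
    s • LinearMap.fst ℂ V V + t • LinearMap.snd ℂ V V] B using 1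
  ext x
  simp [pencilSet, Fin.forall_fin_succ]

theorem smul_mem_pencilSet {s t : ℂ} {B : Module.Dual ℂ (V × V)} (g : spinGroup Q)
    {x : Fin 4 → P.SpinorVariety} (hx : x ∈ P.pencilSet s t B) :
    g • x ∈ P.pencilSet s t (B ∘ₗ ((spinGroup.toSO Q g : V ≃ₗ[ℂ] V).symm.prodCongr
      (spinGroup.toSO Q g : V ≃ₗ[ℂ] V).symm).toLinearMap) := by
  rintro ⟨a, b⟩ h0 h1 h2 h3 hB
  obtain ⟨a, rfl⟩ := (spinGroup.toSO Q g : V ≃ₗ[ℂ] V).surjective a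
  obtain ⟨b, rfl⟩ := (spinGroup.toSO Q g : V ≃ₗ[ℂ] V).surjective b
  simp only [← map_smul, ← map_add] at h2 h3
  have h := hx (a, b) ((mem_isotropicSpace_smul_iff g _ _).mp h0)
    ((mem_isotropicSpace_smul_iff g _ _).mp h1) ((mem_isotropicSpace_smul_iff g _ _).mp h2)
    ((mem_isotropicSpace_smul_iff g _ _).mp h3) (by simpa using hB)
  rw [Prod.ext_iff] at h ⊢
  simpa using h

theorem mem_pencilSet_of_isOpen_orbit (hQ : Q.Nondegenerate) (hpos : 0 < Module.finrank ℂ V)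
    {x : Fin 4 → P.SpinorVariety} (hx : IsOpen[P.zariski 4] (MulAction.orbit (spinGroup Q) x))
    {s t : ℂ} (hne : (P.pencilSet s t 0).Nonempty) : x ∈ P.pencilSet s t 0 :=
  mem_of_isOpen_orbit hQ hpos hx (isOpen_pencilSet s t 0) hne fun g y hy => by
    simpa using smul_mem_pencilSet g hy

/-- For fixed `B` the set is not invariant, as the group moves `B`; the union over all `B` is. -/
theorem exists_mem_pencilSet_of_isOpen_orbit (hQ : Q.Nondegenerate)
    (hpos : 0 < Module.finrank ℂ V) {x : Fin 4 → P.SpinorVariety}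
    (hx : IsOpen[P.zariski 4] (MulAction.orbit (spinGroup Q) x))
    {s t : ℂ} {B : Module.Dual ℂ (V × V)} (hne : (P.pencilSet s t B).Nonempty) :
    ∃ B, x ∈ P.pencilSet s t B := by
  let := P.zariski 4
  rw [← Set.mem_iUnion]
  refine mem_of_isOpen_orbit hQ hpos hx (isOpen_iUnion fun B => isOpen_pencilSet s t B)
    (Set.nonempty_iUnion.mpr ⟨B, hne⟩) fun g y hy => ?_
  obtain ⟨B, hB⟩ := Set.mem_iUnion.mp hy
  exact Set.mem_iUnion.mpr ⟨_, smul_mem_pencilSet g hB⟩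

end Polarization

/-- The three special values `t = 0`, `s = 0`, `s = t` are distinct points of the projective line,
so at most one line of trivial pairs occurs and a single form `B` suffices. -/
theorem pencil_coefficient_unique {s t : ℂ} (hst : s ≠ 0 ∨ t ≠ 0) {i j : Fin 3}
    (hi : ![t, s, s - t] i = 0) (hj : ![t, s, s - t] j = 0) : i = j := by
  fin_cases i <;> fin_cases j <;> simp_all [sub_eq_zero]

/-- A quadruple in a pencil set, in the coordinates of a frame of its first three members. -/
theorem IsTripleFrame.mem_pencilSet_iff [FiniteDimensional ℂ V] {Q : QuadraticForm ℂ V}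
    {P : Polarization Q} {ε : Prop} [Decidable ε] {m : ℕ} {x : Fin 4 → P.SpinorVariety}
    {θ : TripleModel ε m ≃ₗ[ℂ] V}
    (hθ : IsTripleFrame Q (fun i : Fin 3 => P.isotropicSpace (x i.castSucc)) θ) (s t : ℂ)
    (B : Module.Dual ℂ (V × V)) :
    x ∈ P.pencilSet s t B ↔ ∀ z, θ (TripleModel.pencil ε m ![t, s, s - t] s t z) ∈
      P.isotropicSpace (x 3) → B ((θ.prodCongr θ) (TripleModel.splitting ε m z)) = 0 → z = 0 := by
  constructor
  · intro h z hz hB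
    obtain ⟨h0, h1, h2⟩ := TripleModel.mem_splitting z
    have := h ((θ.prodCongr θ) (TripleModel.splitting ε m z)) ((hθ.mem_iff 0 _).mpr h0)
      ((hθ.mem_iff 1 _).mpr h1) (by
        have := (hθ.mem_iff 2 _).mpr h2
        rwa [map_add] at this) (by
        rw [← TripleModel.splitting_combination, map_add, map_smul, map_smul] at hz
        exact hz) hB
    rw [LinearEquiv.map_eq_zero_iff] at this
    exact (injective_iff_map_eq_zero _).mp TripleModel.splitting_injective z this
  · rintro h ⟨a, b⟩ h0 h1 h2 h3 hB
    obtain ⟨u, rfl⟩ := θ.surjective a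
    obtain ⟨v, rfl⟩ := θ.surjective b
    rw [← map_add] at h2
    obtain ⟨z, hz⟩ := TripleModel.exists_splitting ((hθ.mem_iff 0 _).mp h0)
      ((hθ.mem_iff 1 _).mp h1) ((hθ.mem_iff 2 _).mp h2)
    have hz0 := h z (by
      rw [← TripleModel.splitting_combination, hz, map_add, map_smul, map_smul]
      exact h3) (by rw [hz]; exact hB)
    rw [hz0, map_zero, eq_comm, Prod.mk_eq_zero] at hz
    rw [hz.1, hz.2, map_zero]
    rfl

end

/-! ### Moduli of quadruples: every pencil set is avoided by some eigenvalue -/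

section

namespace Polarization

variable [FiniteDimensional ℂ V] {Q : QuadraticForm ℂ V} {P : Polarization Q} {ε : Prop}
  [Decidable ε] {m k n : ℕ}

/-- A quadruple whose first three members are in normal form, and whose fourth member is a graph
with slope `r`. -/
theorem exists_quadruple (P : Polarization Q) (hQ : Q.Nondegenerate)
    (hrank : Module.finrank ℂ (TripleModel ε m) = Module.finrank ℂ V) (r : ℂ) :
    ∃ (x : Fin 4 → P.SpinorVariety) (θ : TripleModel ε m ≃ₗ[ℂ] V),
      IsTripleFrame Q (fun i : Fin 3 => P.isotropicSpace (x i.castSucc)) θ ∧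
      ∀ z, θ z ∈ P.isotropicSpace (x 3) ↔ z.1.1 = 0 ∧ z.2.2 = r • z.2.1 := by
  obtain ⟨x, θ, hθ, hy⟩ := P.exists_isTripleFrame (ε := ε) (m := m) hQ hrank
  obtain ⟨y, hy⟩ := hy r
  refine ⟨Fin.snoc (α := fun _ => P.SpinorVariety) x y, θ, ?_, fun z => ?_⟩
  · simpa using hθ
  · rw [← hy]
    rfl

theorem exists_pencilSet_nonempty (P : Polarization Q) (hQ : Q.Nondegenerate)
    (hrank : Module.finrank ℂ (TripleModel ε m) = Module.finrank ℂ V) {s t : ℂ}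
    (hst : s ≠ 0 ∨ t ≠ 0) :
    (∃ B, (P.pencilSet s t B).Nonempty) ∧
    ((∀ i : TripleIndex ε, ![t, s, s - t] i ≠ 0) → (P.pencilSet s t 0).Nonempty) := by
  -- The fourth subspace is taken with a slope different from `t / s`, so the pencil meets it in no
  -- nonzero symplectic component.
  obtain ⟨r, hr⟩ : ∃ r, t - r * s ≠ 0 := by
    by_cases hs : s = 0
    · exact ⟨0, by simpa [hs] using hst⟩
    · exact ⟨t / s - 1, by field_simp; simpa using hs⟩
  obtain ⟨x, θ, hθ, hx⟩ := P.exists_quadruple (ε := ε) (m := m) hQ hrank r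
  have hmem : ∀ z, θ (TripleModel.pencil ε m ![t, s, s - t] s t z) ∈ P.isotropicSpace (x 3) →
      z.2 = 0 ∧ ∀ j : TripleIndex ε, ![t, s, s - t] j * z.1 j = 0 := by
    intro z hz
    obtain ⟨h1, h2⟩ := (hx _).mp hz
    have h2 : t • z.2 = r • s • z.2 := h2
    rw [smul_smul, ← sub_eq_zero, ← sub_smul] at h2
    exact ⟨(smul_eq_zero.mp h2).resolve_left hr, fun j => congrFun h1 j⟩
  let p : TripleModel ε m →ₗ[ℂ] (TripleIndex ε → ℂ) := LinearMap.fst ℂ _ _ ∘ₗ LinearMap.fst ℂ _ _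
  refine ⟨⟨((∑ j, LinearMap.proj j ∘ₗ p).coprod
    (∑ j : TripleIndex ε, (![1, 0, 0] : Fin 3 → ℂ) j • LinearMap.proj j ∘ₗ p)) ∘ₗ
      (θ.prodCongr θ).symm.toLinearMap, x,
      (hθ.mem_pencilSet_iff s t _).mpr fun z hz hB => ?_⟩, fun h => ⟨x,
      (hθ.mem_pencilSet_iff s t 0).mpr fun z hz _ => ?_⟩⟩
  · obtain ⟨h1, h2⟩ := hmem z hz
    -- The form chosen for `B` is the sum of the first hyperbolic coordinates of `u` plus the
    -- coordinate `0` of `v`. On a split pair it is the sum of the three parameters, so it detects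
    -- whichever single parameter is left free.
    have hB : ∑ j, z.1 j = 0 := by
      rw [← hB]
      simp only [LinearMap.comp_apply, LinearEquiv.coe_coe, LinearEquiv.symm_apply_apply,
        LinearMap.coprod_apply, LinearMap.sum_apply, LinearMap.smul_apply, p,
        LinearMap.fst_apply, LinearMap.proj_apply, ← Finset.sum_add_distrib]
      refine Finset.sum_congr rfl fun ⟨j, hj⟩ _ => ?_
      fin_cases j <;> simp [TripleModel.splitting, TripleModel.pencil]
    refine Prod.ext (funext fun i => ?_) h1
    by_contra hi
    have h3 : ![t, s, s - t] i = 0 := (mul_eq_zero.mp (h2 i)).resolve_right hi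
    rw [Finset.sum_eq_single i (fun j _ hj => by
      by_contra hj0
      exact hj (Subtype.ext (pencil_coefficient_unique hst
        ((mul_eq_zero.mp (h2 j)).resolve_right hj0) h3))) (by simp)] at hB
    exact hi hB
  · obtain ⟨h1, h2⟩ := hmem z hz
    exact Prod.ext (funext fun i => (mul_eq_zero.mp (h2 i)).resolve_left (h i)) h1

/-- A vector in the fourth subspace and in the member of the first three on which the pencil
degenerates vanishes, if its dual coordinate does. -/
theorem eq_zero_of_mem_pencilSet {x : Fin 4 → P.SpinorVariety} {θ : TripleModel ε m ≃ₗ[ℂ] V}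
    (hθ : IsTripleFrame Q (fun i : Fin 3 => P.isotropicSpace (x i.castSucc)) θ) {s t : ℂ}
    (hst : s ≠ 0 ∨ t ≠ 0) {B : Module.Dual ℂ (V × V)} (hx : x ∈ P.pencilSet s t B)
    {i : TripleIndex ε} (hi : ![t, s, s - t] i = 0) {w : TripleModel ε m}
    (hw : TripleModel.Mem i w) (hw3 : θ w ∈ P.isotropicSpace (x 3)) (hwi : w.1.2 i = 0) :
    w = 0 := by
  rw [hθ.mem_pencilSet_iff] at hx
  -- This is the trivial pair: its image under the degenerate pencil is `0`, which lies in every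
  -- fourth subspace, so only `B` can exclude it.
  have hBi : B ((θ.prodCongr θ) (TripleModel.splitting ε m (Pi.single i 1, 0))) ≠ 0 := by
    intro h
    have h0 := hx (Pi.single i 1, 0) (by
      convert (P.isotropicSpace (x 3)).zero_mem
      rw [LinearEquiv.map_eq_zero_iff]
      refine Prod.ext (Prod.ext (funext fun j => ?_) rfl) (by simp [TripleModel.pencil])
      by_cases hj : j = i
      · subst hj
        simp [TripleModel.pencil, hi]
      · simp [TripleModel.pencil, hj]) h
    simpa using congrArg (fun z => z.1 i) h0
  obtain ⟨k, hk⟩ : ∃ k, w.2 = (s • k, t • k) := by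
    have h2 := hw.2
    obtain ⟨i, hε⟩ := i
    fin_cases i
    · have ht : t = 0 := hi
      have h2 : w.2.2 = 0 := h2
      have hs : s ≠ 0 := hst.resolve_right (not_not.mpr ht)
      exact ⟨s⁻¹ • w.2.1, Prod.ext (smul_inv_smul₀ hs _).symm (by simp [ht, h2])⟩
    · have hs : s = 0 := hi
      have h2 : w.2.1 = 0 := h2
      have ht : t ≠ 0 := hst.resolve_left (not_not.mpr hs)
      exact ⟨t⁻¹ • w.2.2, Prod.ext (by simp [hs, h2]) (smul_inv_smul₀ ht _).symm⟩
    · have hst' : s = t := sub_eq_zero.mp hi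
      have h2 : w.2.1 = w.2.2 := h2
      subst hst'
      have hs : s ≠ 0 := hst.elim id id
      exact ⟨s⁻¹ • w.2.1, Prod.ext (smul_inv_smul₀ hs _).symm
        (by rw [h2]; exact (smul_inv_smul₀ hs _).symm)⟩
  have hq : w.1.2 = 0 := funext fun j => by
    by_cases hj : j = i
    · rw [hj]; exact hwi
    · have h := hw.1 j
      rwa [if_neg (fun h => hj (Subtype.ext h))] at h
  have hpi : w.1.1 i = 0 := by
    have h := hw.1 i
    rwa [if_pos rfl] at h
  let p : TripleIndex ε → ℂ := fun j => w.1.1 j / ![t, s, s - t] j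
  have hp : ∀ c : ℂ, TripleModel.pencil ε m ![t, s, s - t] s t (p + Pi.single i c, k) = w := by
    intro c
    refine Prod.ext (Prod.ext (funext fun j => ?_) hq.symm) hk.symm
    change ![t, s, s - t] j * (w.1.1 j / ![t, s, s - t] j + Pi.single (M := fun _ => ℂ) i c j) = _
    by_cases hj : j = i
    · rw [hj, hi, hpi, zero_mul]
    · have hj0 : ![t, s, s - t] j ≠ 0 := fun h =>
        hj (Subtype.ext (pencil_coefficient_unique hst h hi))
      rw [Pi.single_eq_of_ne hj, add_zero, mul_div_cancel₀ _ hj0]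
  -- The parameter of index `i` does not affect the image under the pencil, so it can be adjusted to
  -- make `B` vanish.
  let c : ℂ := -B ((θ.prodCongr θ) (TripleModel.splitting ε m (p, k))) /
    B ((θ.prodCongr θ) (TripleModel.splitting ε m (Pi.single i 1, 0)))
  have h0 := hx (p + Pi.single i c, k) (by rw [hp]; exact hw3) (by
    have h : ((p + Pi.single i c, k) : (TripleIndex ε → ℂ) × (Fin m ⊕ Fin m → ℂ)) =
        (p, k) + c • (Pi.single i 1, 0) := by
      ext j <;> simp [Pi.single_apply]
    rw [h, map_add, map_smul, map_add, map_smul, map_add, map_smul, smul_eq_mul,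
      div_mul_cancel₀ _ hBi]
    ring)
  rw [← hp c, h0, map_zero]

/-- The vectors of the fourth subspace without second hyperbolic coordinates form a space of
dimension at least `2m`, so their two symplectic components have an eigenvector, which solves the
system for some `(s : t)`. A quadruple with open orbit, however, lies in the pencil set of every `(s
: t)`, with a suitable `B` at the special values. -/
theorem not_isOpen_orbit (P : Polarization Q) (hQ : Q.Nondegenerate)
    (hrank : Module.finrank ℂ (TripleModel ε m) = Module.finrank ℂ V) (hm : 0 < m)
    (x : Fin 4 → P.SpinorVariety) : ¬ IsOpen[P.zariski 4] (MulAction.orbit (spinGroup Q) x) := by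
  intro hx
  have hrank' := hrank
  rw [TripleModel.finrank_eq] at hrank'
  have hpos : 0 < Module.finrank ℂ V := by omega
  have hframe : x ∈ P.frameSet ε m Fin.castSucc := by
    refine mem_of_isOpen_orbit hQ hpos hx (isOpen_frameSet hQ hrank _) ?_
      fun g y hy => smul_mem_frameSet hy g
    obtain ⟨y, θ, hθ, -⟩ := P.exists_quadruple (ε := ε) (m := m) hQ hrank 0
    exact ⟨y, θ, hθ⟩
  obtain ⟨θ, hθ⟩ := hframe
  have hL := isLagrangian_isotropicSpace hQ (x 3)
  let f : P.isotropicSpace (x 3) →ₗ[ℂ] (TripleIndex ε → ℂ) :=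
    LinearMap.snd ℂ _ _ ∘ₗ LinearMap.fst ℂ _ _ ∘ₗ θ.symm.toLinearMap ∘ₗ
      (P.isotropicSpace (x 3)).subtype
  let π : LinearMap.ker f →ₗ[ℂ] (Fin m ⊕ Fin m → ℂ) × (Fin m ⊕ Fin m → ℂ) :=
    LinearMap.snd ℂ _ _ ∘ₗ θ.symm.toLinearMap ∘ₗ (P.isotropicSpace (x 3)).subtype ∘ₗ
      (LinearMap.ker f).subtype
  have hdim : 2 * m ≤ Module.finrank ℂ (LinearMap.ker f) := by
    have h1 := f.finrank_range_add_finrank_ker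
    have h2 := (LinearMap.range f).finrank_le
    have h3 := hL.finrank hQ
    have h4 : Module.finrank ℂ (TripleIndex ε → ℂ) = if ε then 3 else 0 := by
      have := TripleModel.finrank_eq ε m
      simp only [Module.finrank_prod, Module.finrank_fintype_fun_eq_card, Fintype.card_sum,
        Fintype.card_fin] at this ⊢
      split_ifs at this ⊢ <;> omega
    split_ifs at h4 hrank' <;> omega
  obtain ⟨⟨⟨v, hv3⟩, hvf⟩, s, t, k, hv0, hst, hs, ht⟩ := exists_pencil_eigenvector
    (LinearMap.fst ℂ _ _ ∘ₗ π) (LinearMap.snd ℂ _ _ ∘ₗ π)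
    (by simpa [← two_mul] using hdim) (by omega)
  obtain ⟨z, rfl⟩ := θ.surjective v
  have hz0 : z ≠ 0 := by
    rintro rfl
    exact hv0 (Subtype.ext (Subtype.ext (map_zero θ)))
  have hq : z.1.2 = 0 := by simpa [f] using hvf
  have hs : z.2.1 = s • k := by simpa [π] using hs
  have ht : z.2.2 = t • k := by simpa [π] using ht
  obtain ⟨⟨B, hB⟩, hB0⟩ := P.exists_pencilSet_nonempty (ε := ε) (m := m) hQ hrank hst
  by_cases hspecial : ∀ i : TripleIndex ε, ![t, s, s - t] i ≠ 0
  · have hmem := mem_pencilSet_of_isOpen_orbit hQ hpos hx (hB0 hspecial)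
    rw [hθ.mem_pencilSet_iff] at hmem
    have hz : TripleModel.pencil ε m ![t, s, s - t] s t
        (fun j => z.1.1 j / ![t, s, s - t] j, k) = z := by
      refine Prod.ext (Prod.ext (funext fun j => ?_) hq.symm) (Prod.ext hs.symm ht.symm)
      exact mul_div_cancel₀ _ (hspecial j)
    have h0 := hmem _ (by rw [hz]; exact hv3) rfl
    rw [h0, map_zero] at hz
    exact hz0 hz.symm
  · push Not at hspecial
    obtain ⟨i, hi⟩ := hspecial
    obtain ⟨B', hmem⟩ := exists_mem_pencilSet_of_isOpen_orbit hQ hpos hx hB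
    -- At a special value the eigenvector `z` might fail to come from the pencil, because its
    -- coordinate `z.1.1 i` need not vanish. By parity the fourth subspace contains a vector `w ≠ 0`
    -- of the `i`-th one, and `w.1.2 i ≠ 0` by the preceding lemma. Orthogonality of `z` and `w`
    -- will force `z.1.1 i = 0`.
    have hdisj := not_disjoint_isotropicSpace hQ (n := 2 * m + 3)
      (by rw [if_pos i.2] at hrank'; omega)
      (by rw [Nat.not_even_iff_odd]; exact ⟨m + 1, by omega⟩) (x (i : Fin 3).castSucc) (x 3)
    rw [Submodule.disjoint_def] at hdisj
    push Not at hdisj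
    obtain ⟨d, hdi, hd3, hd0⟩ := hdisj
    obtain ⟨w, rfl⟩ := θ.surjective d
    have hw := (hθ.mem_iff i w).mp hdi
    have hwi : w.1.2 i ≠ 0 := fun h => hd0 (by
      rw [eq_zero_of_mem_pencilSet hθ hst hmem hi hw hd3 h, map_zero])
    have hz2 : ![z.2.2 = 0, z.2.1 = 0, z.2.1 = z.2.2] i := by
      obtain ⟨i, hε⟩ := i
      fin_cases i
      · have h : t = 0 := hi
        change z.2.2 = 0
        rw [ht, h, zero_smul]
      · have h : s = 0 := hi
        change z.2.1 = 0
        rw [hs, h, zero_smul]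
      · have h : s - t = 0 := hi
        change z.2.1 = z.2.2
        rw [hs, ht, sub_eq_zero.mp h]
    have hform := hL.polar_eq_zero hv3 hd3
    rw [hθ.polar_eq] at hform
    -- The symplectic components of `z` and `w` lie in the same standard Lagrangian, so only the
    -- product `z.1.1 i * w.1.2 i` remains in the form.
    have hΩ : standardSymplectic m z.2.2 w.2.1 + standardSymplectic m w.2.2 z.2.1 = 0 := by
      have hw2 := hw.2
      obtain ⟨i, hε⟩ := i
      fin_cases i
      · have h1 : z.2.2 = 0 := hz2
        have h2 : w.2.2 = 0 := hw2
        simp [h1, h2]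
      · have h1 : z.2.1 = 0 := hz2
        have h2 : w.2.1 = 0 := hw2
        simp [h1, h2]
      · have h1 : z.2.1 = z.2.2 := hz2
        have h2 : w.2.1 = w.2.2 := hw2
        rw [h1, h2, standardSymplectic_neg, neg_add_cancel]
    have hpi : z.1.1 i = 0 := by
      rw [TripleModel.form, hΩ, hq, add_zero, Finset.sum_eq_single i (fun j _ hj => by
        have h := hw.1 j
        rw [if_neg (fun h => hj (Subtype.ext h))] at h
        rw [h, mul_zero]) (by simp)] at hform
      simpa [hwi] using hform
    refine hz0 (eq_zero_of_mem_pencilSet hθ hst hmem hi ⟨fun j => ?_, hz2⟩ hv3 (congrFun hq i))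
    split_ifs with hj
    · rw [show j = i from Subtype.ext hj, hpi]
    · exact congrFun hq j

end Polarization

end

end

/-! ### The theorem, by the parity of `n` -/

theorem mainTheorem8 {V : Type*} [AddCommGroup V] [Module ℂ V] [FiniteDimensional ℂ V]
    (Q : QuadraticForm ℂ V) (hQ : Q.Nondegenerate) (P : Polarization Q)
    (n : ℕ) (hn : 0 < n) (hdim : Module.finrank ℂ V = 2 * n) :
    (∃ x : Fin 3 → P.SpinorVariety,
      IsOpen[P.zariski 3] (MulAction.orbit (spinGroup Q) x) ∧
      @Dense _ (P.zariski 3) (MulAction.orbit (spinGroup Q) x) ∧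
      ∀ m : ℕ, n = 2 * m → ∀ y ∈ MulAction.orbit (spinGroup Q) x,
        ∃ b : Module.Basis (Fin m ⊕ Fin m) ℂ (P.isotropicSpace (y 0)),
          (∃ Φ : MulAction.stabilizer (spinGroup Q) y →* Matrix.symplecticGroup (Fin m) ℂ,
            Function.Surjective Φ ∧
            (∀ g, Φ g = 1 ↔
              ((g : spinGroup Q) : CliffordAlgebra Q) = 1 ∨
              ((g : spinGroup Q) : CliffordAlgebra Q) = -1) ∧
            ∀ (g : MulAction.stabilizer (spinGroup Q) y) (j : Fin m ⊕ Fin m),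
              ((g : spinGroup Q) : CliffordAlgebra Q) * CliffordAlgebra.ι Q (b j) *
                (((g : spinGroup Q)⁻¹ : spinGroup Q) : CliffordAlgebra Q) =
              CliffordAlgebra.ι Q
                (∑ i, (Φ g : Matrix (Fin m ⊕ Fin m) (Fin m ⊕ Fin m) ℂ) i j • (b i : V))) ∧
          (∃ Ψ : MulAction.stabilizer (specialOrthogonalGroup Q)
                (fun i => P.isotropicSpace (y i)) ≃* Matrix.symplecticGroup (Fin m) ℂ,
            ∀ (T : MulAction.stabilizer (specialOrthogonalGroup Q)
                (fun i => P.isotropicSpace (y i))) (j : Fin m ⊕ Fin m),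
              ((T : specialOrthogonalGroup Q) : V ≃ₗ[ℂ] V) (b j) =
                ∑ i, (Ψ T : Matrix (Fin m ⊕ Fin m) (Fin m ⊕ Fin m) ℂ) i j • (b i : V))) ∧
    (n ≠ 1 → n ≠ 3 → ∀ x : Fin 4 → P.SpinorVariety,
      ¬ IsOpen[P.zariski 4] (MulAction.orbit (spinGroup Q) x)) := by
  have hpos : 0 < Module.finrank ℂ V := by omega
  refine ⟨?_, fun h1 h3 => ?_⟩
  · rcases n.even_or_odd' with ⟨m, rfl | rfl⟩
    · obtain ⟨x, hx, hopen, hdense⟩ := P.exists_orbit_eq_frameSet (ε := False) (m := m) hQ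
        (by rw [TripleModel.finrank_eq, if_neg not_false]; omega) hpos
      refine ⟨x, hopen, hdense, fun m' hm' y hy => ?_⟩
      obtain rfl : m = m' := by omega
      exact Polarization.exists_symplectic_stabilizer hQ (hx ▸ hy)
    · rcases Nat.eq_zero_or_pos m with rfl | hm
      · have := P.subsingleton_spinorVariety hQ (by omega)
        let x : Fin 3 → P.SpinorVariety := fun _ => P.basePoint
        have hx : MulAction.orbit (spinGroup Q) x = Set.univ :=
          Set.eq_univ_of_forall fun y => ⟨1, Subsingleton.elim _ _⟩
        let := P.zariski 3
        refine ⟨x, hx ▸ isOpen_univ, hx ▸ dense_univ, fun m hm => by omega⟩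
      -- The three planes take up `3` of `n = 2m + 1`, leaving `2(m - 1)` for the symplectic part.
      · obtain ⟨x, -, hopen, hdense⟩ := P.exists_orbit_eq_frameSet (ε := True) (m := m - 1) hQ
          (by rw [TripleModel.finrank_eq, if_pos trivial]; omega) hpos
        exact ⟨x, hopen, hdense, fun m hm => by omega⟩
  · rcases n.even_or_odd' with ⟨m, rfl | rfl⟩
    · exact P.not_isOpen_orbit (ε := False) (m := m) hQ
        (by rw [TripleModel.finrank_eq, if_neg not_false]; omega) (by omega)
    · exact P.not_isOpen_orbit (ε := True) (m := m - 1) hQ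
        (by rw [TripleModel.finrank_eq, if_pos trivial]; omega) (by omega)
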